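/- Let $c\ge 1$ be an integer, $\mu,\nu\in\mathbb R$, $e(x)=e^{2\pi i x}$. Let $D_0$ be the $*$-algebra of finitely supported families $F=(F(p,\cdot,\cdot))_{p\in\mathbb Z}$ of continuous functions $\mathbb R\times S^1\to\mathbb C$ ($S^1=\mathbb R/\mathbb Z$) with $F(p,x+1,y)=e(-cp(y-p\nu))F(p,x,y)$, with product $(FG)(p,x,y)=\sum_q F(q,x,y)\,G(p-q,x-2q\mu,y-2q\nu)$ and involution $F^*(p,x,y)=\overline{F(-p,x-2p\mu,y-2p\nu)}$. The quantum Heisenberg manifold $D=D^c_{\mu,\nu}$ is the universal $C^*$-algebra of $D_0$; equivalently, it is the generalised crossed product of $C(T^2)$ by the Hilbert bimodule $M$ of the elements of degree $p=1$. The Heisenberg group, in coordinates $(r,s,t)\in\mathbb R^3$ with the law $(r,s,t)(r',s',t')=(r+r',s+s',t+t'-csr')$, acts on $D$ by $\alpha_{(r,s,t)}(F)(p,x,y)=e\big(p(t-cs(x-r-p\mu))\big)F(p,x-r,y-s)$. Let $\mathcal D\subseteq D$ be the $*$-subalgebra of the $a$ for which $g\mapsto\alpha_g(a)$ is $C^\infty$,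 let $\partial_1,\partial_2,\partial_3$ be the derivatives of $\alpha$ at the identity in the directions $r,s,t$, and let $\tau(F)=\int_0^1\int_{S^1}F(0,x,y)\,dy\,dx$. On $\mathcal D$ consider the multilinear forms $$\tau,\qquad \varphi_i(a_0,a_1)=\tau(a_0\partial_i a_1)\ (i=1,2,3),\qquad \varphi_{i,3}(a_0,a_1,a_2)=\tau\big(a_0(\partial_i a_1\,\partial_3 a_2-\partial_3a_1\,\partial_ia_2)\big)\ (i=1,2),$$ $$\varphi_{1,2,3}(a_0,a_1,a_2,a_3)=\sum_{\sigma\in\Sigma_3}\varepsilon(\sigma)\,\tau\big(a_0\,\partial_{\sigma(1)}a_1\,\partial_{\sigma(2)}a_2\,\partial_{\sigma(3)}a_3\big).$$ Let $U_1=\delta_{0,p}\,e(x)$, $U_2=\delta_{0,p}\,e(y)$. A smooth frame is a pair $\xi_1,\xi_2\in M\cap\mathcal D$ with $\sum_p\xi_p^*\xi_p=1=\sum_p\xi_p\xi_p^*$. For a smooth frame put $U_{p,1}=U_1$, $U_{p,2}=U_2$, $U_{p,3}=\xi_p$ and $$c_1=U_1^*\otimes U_1,\qquad c_2=U_2^*\otimes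 U_2,\qquad c_3=\sum_{p=1}^2\xi_p^*\otimes\xi_p,$$ $$c_{j,3}=\sum_{p=1}^2\big(\xi_p^*U_j^*\otimes U_j\otimes\xi_p-U_j^*\xi_p^*\otimes\xi_p\otimes U_j\big)\quad(j=1,2),$$ $$c_{1,2,3}=\sum_{p=1}^2\sum_{\sigma\in\Sigma_3}\varepsilon(\sigma)\,U_{p,\sigma(3)}^*U_{p,\sigma(2)}^*U_{p,\sigma(1)}^*\otimes U_{p,\sigma(1)}\otimes U_{p,\sigma(2)}\otimes U_{p,\sigma(3)}.$$ A cut-off pair consists of smooth $1$-periodic functions $\chi_1,\chi_2:\mathbb R\to\mathbb R$ with $\chi_1^2+\chi_2^2=1$, $\chi_1=0$ on $[\frac13,\frac23]$ and $\chi_2=0$ on $[-\frac16,\frac16]$. A pair $\xi_1,\xi_2\in M$ is built from $(\chi_1,\chi_2)$ at $a\in\mathbb R$ if $\xi_1(x,y)=\chi_1(x-a)$ for $x\in[a-\frac12,a+\frac12]$ and $\xi_2(x,y)=\chi_2(x-a)$ for $x\in[a,a+1]$. There are nonzero constants $k_1,k_2,k_3,k_{1,3},k_{2,3},k_{1,2,3}\in\mathbb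 C$ (independent of the frame) such that the following holds. 1. Cut-off pairs exist. For every cut-off pair there are $a\in\mathbb R$ and a smooth frame built from it at $a$ for which $c_1,c_2,c_3,c_{1,3},c_{2,3},c_{1,2,3}$ are Hochschild cycles of $\mathcal D$ and $$\langle c_j,\varphi_i\rangle=\delta_{j,i}k_i,\qquad\langle c_{j,3},\varphi_{i,3}\rangle=\delta_{j,i}k_{i,3},\qquad\langle c_{1,2,3},\varphi_{1,2,3}\rangle=k_{1,2,3}\neq0 .$$ 2. For every cut-off pair and every $a\in\mathbb R$ there is a smooth frame built from it at $a$ with $\langle c_3,\varphi_1\rangle=0$. 3. For every smooth frame the six chains are Hochschild cycles and all the equalities in 1 hold, except possibly $\langle c_3,\varphi_1\rangle=0$ and $\langle c_3,\varphi_2\rangle=0$. Moreover $\tau,\varphi_i,\varphi_{i,3},\varphi_{1,2,3}$ are Hochschild cocycles on $\mathcal D$, and their classes are linearly independent in Hochschild cohomology: $[\tau]\ne0$ in $HH^0(\mathcal D)$, $[\varphi_1],[\varphi_2],[\varphi_3]$ are independent in $HH^1(\mathcal D)$, $[\varphi_{1,3}],[\varphi_{2,3}]$ are independent in $HH^2(\mathcal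 D)$, and $[\varphi_{1,2,3}]\neq0$ in $HH^3(\mathcal D)$. -/

import Mathlib

noncomputable section

open scoped ContDiff TensorProduct

namespace QHM

/-- `e(x) = exp(2πix)`. -/
def e (x : ℝ) : ℂ := Complex.exp (2 * Real.pi * Complex.I * x)

lemma e_add (x y : ℝ) : e (x + y) = e x * e y := by
  simp only [e, ← Complex.exp_add]
  congr 1
  push_cast
  ring

lemma star_e (x : ℝ) : star (e x) = e (-x) := by
  simp only [e, Complex.star_def, ← Complex.exp_conj]
  congr 1
  simp [Complex.conj_ofNat]

lemma e_zero : e 0 = 1 := by simp [e]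

lemma e_neg_mul (x : ℝ) : e (-x) * e x = 1 := by rw [← e_add]; simp [e_zero]

lemma norm_e (x : ℝ) : ‖e x‖ = 1 := by
  have : (2 * Real.pi * Complex.I * x : ℂ) = ((2 * Real.pi * x : ℝ) : ℂ) * Complex.I := by
    push_cast; ring
  rw [e, this, Complex.norm_exp_ofReal_mul_I]

lemma e_one : e 1 = 1 := by simp [e, Complex.exp_two_pi_mul_I]

lemma continuous_e : Continuous e := by unfold e; fun_prop

/-- The translation `(n • f)(x, y) = f(x - 2nμ, y - 2nν)`. -/
def shift (μ ν : ℝ) (n : ℤ) : C(ℝ × ℝ, ℂ) →⋆ₐ[ℂ] C(ℝ × ℝ, ℂ) :=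
  ContinuousMap.compStarAlgHom' ℂ ℂ
    ⟨fun z => (z.1 - n * (2 * μ), z.2 - n * (2 * ν)), by fun_prop⟩

@[simp] lemma shift_apply (μ ν : ℝ) (n : ℤ) (f : C(ℝ × ℝ, ℂ)) (x y : ℝ) :
    shift μ ν n f (x, y) = f (x - n * (2 * μ), y - n * (2 * ν)) := rfl

lemma shift_shift (μ ν : ℝ) (n m : ℤ) (f : C(ℝ × ℝ, ℂ)) :
    shift μ ν n (shift μ ν m f) = shift μ ν (n + m) f := by
  ext ⟨x, y⟩
  simp only [shift_apply]
  congr 2 <;> push_cast <;> ring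

lemma shift_zero (μ ν : ℝ) (f : C(ℝ × ℝ, ℂ)) : shift μ ν 0 f = f := by
  ext ⟨x, y⟩
  simp

/-- Finitely supported functions `F : ℤ → C(ℝ²)`, written `F p (x, y)`; they carry the convolution
product and the involution of the quantum Heisenberg manifolds. -/
def Conv (_μ _ν : ℝ) : Type := ℤ →₀ C(ℝ × ℝ, ℂ)

namespace Conv

variable {μ ν : ℝ}

instance : AddCommGroup (Conv μ ν) := inferInstanceAs (AddCommGroup (ℤ →₀ C(ℝ × ℝ, ℂ)))
instance : Module ℂ (Conv μ ν) := inferInstanceAs (Module ℂ (ℤ →₀ C(ℝ × ℝ, ℂ)))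
instance : FunLike (Conv μ ν) ℤ C(ℝ × ℝ, ℂ) :=
  inferInstanceAs (FunLike (ℤ →₀ C(ℝ × ℝ, ℂ)) ℤ C(ℝ × ℝ, ℂ))

/-- The element `f` placed in degree `p`. -/
def single (p : ℤ) (f : C(ℝ × ℝ, ℂ)) : Conv μ ν := Finsupp.single p f

@[simp] lemma add_apply (F G : Conv μ ν) (p : ℤ) : (F + G) p = F p + G p := rfl
@[simp] lemma zero_apply (p : ℤ) : (0 : Conv μ ν) p = 0 := rfl
@[simp] lemma smul_apply (k : ℂ) (F : Conv μ ν) (p : ℤ) : (k • F) p = k • F p := rfl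
@[ext] lemma ext {F G : Conv μ ν} (h : ∀ p, F p = G p) : F = G := Finsupp.ext h

lemma single_apply (p q : ℤ) (f : C(ℝ × ℝ, ℂ)) :
    (single p f : Conv μ ν) q = if p = q then f else 0 := Finsupp.single_apply

lemma single_add (p : ℤ) (f g : C(ℝ × ℝ, ℂ)) :
    (single p (f + g) : Conv μ ν) = single p f + single p g := Finsupp.single_add p f g
lemma single_zero (p : ℤ) : (single p 0 : Conv μ ν) = 0 := Finsupp.single_zero p

/-- Additive maps out of `Conv` are determined on homogeneous elements. -/
lemma induction {P : Conv μ ν → Prop} (F : Conv μ ν) (h0 : P 0)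
    (hadd : ∀ F G, P F → P G → P (F + G)) (hs : ∀ p f, P (single p f)) : P F :=
  Finsupp.induction_linear F h0 hadd hs

/-- The product `(F * G)(p, x, y) = ∑ q, F(q, x, y) G(p - q, x - 2qμ, y - 2qν)`, see `mul_apply`. -/
def mulAux (μ ν : ℝ) (F G : ℤ →₀ C(ℝ × ℝ, ℂ)) : ℤ →₀ C(ℝ × ℝ, ℂ) :=
  F.sum fun q f => G.sum fun m g => Finsupp.single (q + m) (f * shift μ ν q g)

/-- The involution `F*(p, x, y) = conj F(-p, x - 2pμ, y - 2pν)`, see `star_apply`. -/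
def starAux (μ ν : ℝ) (F : ℤ →₀ C(ℝ × ℝ, ℂ)) : ℤ →₀ C(ℝ × ℝ, ℂ) :=
  F.sum fun q f => Finsupp.single (-q) (shift μ ν (-q) (star f))

lemma mulAux_add (F G H : ℤ →₀ C(ℝ × ℝ, ℂ)) :
    mulAux μ ν F (G + H) = mulAux μ ν F G + mulAux μ ν F H := by
  simp only [mulAux]
  rw [← Finsupp.sum_add]
  refine Finsupp.sum_congr fun q _ => ?_
  exact Finsupp.sum_add_index' (by simp)
    (by intros; rw [map_add, mul_add, Finsupp.single_add])

lemma add_mulAux (F G H : ℤ →₀ C(ℝ × ℝ, ℂ)) :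
    mulAux μ ν (F + G) H = mulAux μ ν F H + mulAux μ ν G H := by
  simp only [mulAux]
  refine Finsupp.sum_add_index' (by simp) ?_
  intro q f g
  rw [← Finsupp.sum_add]
  refine Finsupp.sum_congr fun m _ => ?_
  rw [add_mul, Finsupp.single_add]

lemma mulAux_single (p q : ℤ) (f g : C(ℝ × ℝ, ℂ)) :
    mulAux μ ν (Finsupp.single p f) (Finsupp.single q g) =
      Finsupp.single (p + q) (f * shift μ ν p g) := by
  simp only [mulAux]
  rw [Finsupp.sum_single_index, Finsupp.sum_single_index] <;> simp

lemma starAux_add (F G : ℤ →₀ C(ℝ × ℝ, ℂ)) :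
    starAux μ ν (F + G) = starAux μ ν F + starAux μ ν G := by
  simp only [starAux]
  exact Finsupp.sum_add_index' (by simp)
    (by intros; rw [star_add, map_add, Finsupp.single_add])

lemma starAux_single (p : ℤ) (f : C(ℝ × ℝ, ℂ)) :
    starAux μ ν (Finsupp.single p f) = Finsupp.single (-p) (shift μ ν (-p) (star f)) := by
  simp only [starAux]
  rw [Finsupp.sum_single_index]; simp

instance : Mul (Conv μ ν) where
  mul F G := mulAux μ ν F G

instance : Star (Conv μ ν) where
  star F := starAux μ ν F

instance : One (Conv μ ν) where
  one := single 0 1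

lemma one_def : (1 : Conv μ ν) = single 0 1 := rfl

protected lemma mul_add (F G H : Conv μ ν) : F * (G + H) = F * G + F * H := mulAux_add F G H

protected lemma add_mul (F G H : Conv μ ν) : (F + G) * H = F * H + G * H := add_mulAux F G H

lemma single_mul_single (p q : ℤ) (f g : C(ℝ × ℝ, ℂ)) :
    (single p f * single q g : Conv μ ν) = single (p + q) (f * shift μ ν p g) :=
  mulAux_single p q f g

protected lemma zero_mul (F : Conv μ ν) : 0 * F = 0 := by
  change mulAux μ ν 0 F = 0
  simp [mulAux]
protected lemma mul_zero (F : Conv μ ν) : F * 0 = 0 := by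
  change mulAux μ ν F 0 = 0
  simp [mulAux, Finsupp.sum]

protected lemma star_add (F G : Conv μ ν) : star (F + G) = star F + star G := starAux_add F G

protected lemma star_zero : star (0 : Conv μ ν) = 0 := by
  change starAux μ ν 0 = 0
  simp [starAux]

lemma star_single (p : ℤ) (f : C(ℝ × ℝ, ℂ)) :
    star (single p f : Conv μ ν) = single (-p) (shift μ ν (-p) (star f)) := starAux_single p f

instance : Ring (Conv μ ν) where
  left_distrib := Conv.mul_add
  right_distrib := Conv.add_mul
  zero_mul := Conv.zero_mul
  mul_zero := Conv.mul_zero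
  mul_assoc F G H := by
    induction F using Conv.induction with
    | h0 => simp only [Conv.zero_mul]
    | hadd F F' h h' => simp only [Conv.add_mul, h, h']
    | hs p f =>
    induction G using Conv.induction with
    | h0 => simp only [Conv.zero_mul, Conv.mul_zero]
    | hadd F F' h h' => simp only [Conv.add_mul, Conv.mul_add, h, h']
    | hs q g =>
    induction H using Conv.induction with
    | h0 => simp only [Conv.mul_zero]
    | hadd F F' h h' => simp only [Conv.mul_add, h, h']
    | hs r h =>
    simp only [single_mul_single, map_mul, shift_shift, add_assoc, mul_assoc]
  one_mul F := by
    induction F using Conv.induction with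
    | h0 => exact Conv.mul_zero _
    | hadd F F' h h' => simp only [Conv.mul_add, h, h']
    | hs p f => simp only [one_def, single_mul_single, shift_zero, zero_add, one_mul]
  mul_one F := by
    induction F using Conv.induction with
    | h0 => exact Conv.zero_mul _
    | hadd F F' h h' => simp only [Conv.add_mul, h, h']
    | hs p f => simp only [one_def, single_mul_single, map_one, add_zero, mul_one]
  neg_add_cancel := neg_add_cancel
  zsmul := fun n F => n • F
  zsmul_zero' := SubNegMonoid.zsmul_zero'
  zsmul_succ' := SubNegMonoid.zsmul_succ'
  zsmul_neg' := SubNegMonoid.zsmul_neg'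
  nsmul := fun n F => n • F
  nsmul_zero := AddMonoid.nsmul_zero
  nsmul_succ := AddMonoid.nsmul_succ
  sub_eq_add_neg := sub_eq_add_neg

lemma smul_single (k : ℂ) (p : ℤ) (f : C(ℝ × ℝ, ℂ)) :
    k • (single p f : Conv μ ν) = single p (k • f) := Finsupp.smul_single k p f

instance : Algebra ℂ (Conv μ ν) := Algebra.ofModule
  (by
    intro k F G
    induction F using Conv.induction with
    | h0 => simp only [smul_zero, zero_mul]
    | hadd F F' h h' => simp only [smul_add, add_mul, h, h']
    | hs p f =>
    induction G using Conv.induction with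
    | h0 => simp only [smul_zero, mul_zero]
    | hadd F F' h h' => simp only [smul_add, mul_add, h, h']
    | hs q g => simp only [smul_single, single_mul_single, smul_mul_assoc])
  (by
    intro k F G
    induction F using Conv.induction with
    | h0 => simp only [smul_zero, zero_mul]
    | hadd F F' h h' => simp only [smul_add, add_mul, h, h']
    | hs p f =>
    induction G using Conv.induction with
    | h0 => simp only [smul_zero, mul_zero]
    | hadd F F' h h' => simp only [smul_add, mul_add, h, h']
    | hs q g => simp only [smul_single, single_mul_single, mul_smul_comm, map_smul])

instance : StarRing (Conv μ ν) where
  star_add := Conv.star_add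
  star_involutive F := by
    induction F using Conv.induction with
    | h0 => simp only [Conv.star_zero]
    | hadd F F' h h' => simp only [Conv.star_add, h, h']
    | hs p f => simp only [star_single, map_star, star_star, shift_shift, neg_neg, add_neg_cancel, shift_zero]
  star_mul F G := by
    induction F using Conv.induction with
    | h0 => simp only [Conv.star_zero, zero_mul, mul_zero]
    | hadd F F' h h' => simp only [Conv.star_add, add_mul, mul_add, h, h']
    | hs p f =>
    induction G using Conv.induction with
    | h0 => simp only [Conv.star_zero, zero_mul, mul_zero]
    | hadd F F' h h' => simp only [Conv.star_add, add_mul, mul_add, h, h']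
    | hs q g =>
    simp only [single_mul_single, star_single, star_mul, map_mul, map_star, shift_shift, neg_add_rev]
    rw [neg_add_cancel_right]

instance : StarModule ℂ (Conv μ ν) where
  star_smul k F := by
    induction F using Conv.induction with
    | h0 => simp only [Conv.star_zero, smul_zero]
    | hadd F F' h h' => simp only [smul_add, Conv.star_add, h, h']
    | hs p f => simp only [smul_single, star_single, star_smul, map_smul]

lemma finite_support_mul (F G : Conv μ ν) (p : ℤ) (x y : ℝ) : (Function.support fun q : ℤ =>
    F q (x, y) * G (p - q) (x - q * (2 * μ), y - q * (2 * ν))).Finite := by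
  refine (Finsupp.hasFiniteSupport (F : ℤ →₀ C(ℝ × ℝ, ℂ))).subset fun q hq h => hq ?_
  have h : F q = 0 := h
  simp [h]

lemma mul_apply (F G : Conv μ ν) (p : ℤ) (x y : ℝ) :
    (F * G) p (x, y) = ∑ᶠ q : ℤ, F q (x, y) * G (p - q) (x - q * (2 * μ), y - q * (2 * ν)) := by
  induction F using Conv.induction with
  | h0 => simp
  | hadd F F' h h' =>
    rw [add_mul, add_apply, ContinuousMap.add_apply, h, h', ← finsum_add_distrib (finite_support_mul F G p x y)
      (finite_support_mul F' G p x y)]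
    simp [add_mul]
  | hs q f =>
    rw [finsum_eq_single _ q (fun r hr => by rw [single_apply, if_neg (Ne.symm hr)]; simp),
      single_apply, if_pos rfl]
    induction G using Conv.induction with
    | h0 => simp
    | hadd G G' h h' => simp [mul_add, h, h']
    | hs r g =>
      rw [single_mul_single, single_apply, single_apply]
      by_cases h : q + r = p
      · have h' : r = p - q := by omega
        simp [h']
      · have h' : ¬ r = p - q := by omega
        simp [h, h']

lemma star_apply (F : Conv μ ν) (p : ℤ) (x y : ℝ) :
    (star F) p (x, y) = star (F (-p) (x - p * (2 * μ), y - p * (2 * ν))) := by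
  induction F using Conv.induction with
  | h0 => simp
  | hadd F F' h h' => simp [h, h']
  | hs q f =>
    rw [star_single, single_apply, single_apply]
    by_cases h : -q = p
    · subst h; simp
    · have h' : ¬ q = -p := by omega
      simp [h, h']

end Conv

/-- The quasi-periodicity of the degree `p` functions:
`f(x + 1, y) = e(-c p (y - p ν)) f(x, y)` and `f(x, y + 1) = f(x, y)`
(so `f` is a continuous function on `ℝ × S¹`). For `p = 1` this is the Hilbert bimodule `M`,
for `p = 0` it is the algebra of continuous functions on the two-torus. -/
def QuasiPeriodic (c : ℕ) (ν : ℝ) (p : ℤ) (f : C(ℝ × ℝ, ℂ)) : Prop :=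
  ∀ x y : ℝ, f (x + 1, y) = e (-(c * p * (y - p * ν))) * f (x, y) ∧ f (x, y + 1) = f (x, y)

/-- The `*`-algebra `D₀` of finitely supported families of quasi-periodic functions. -/
def preQHM (c : ℕ) (μ ν : ℝ) : StarSubalgebra ℂ (Conv μ ν) where
  carrier := {F | ∀ p : ℤ, QuasiPeriodic c ν p (F p)}
  zero_mem' := fun p x y => by simp
  add_mem' := fun {F G} hF hG p x y => by
    simp only [Conv.add_apply, ContinuousMap.add_apply]
    rw [(hF p x y).1, (hF p x y).2, (hG p x y).1, (hG p x y).2]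
    exact ⟨by ring, rfl⟩
  mul_mem' := fun {F G} hF hG p x y => by
    rw [Conv.mul_apply, Conv.mul_apply, Conv.mul_apply,
      mul_finsum]
    refine ⟨finsum_congr fun q => ?_, finsum_congr fun q => ?_⟩
    · rw [(hF q x y).1, show x + 1 - q * (2 * μ) = x - q * (2 * μ) + 1 by ring, (hG _ _ _).1]
      have : e (-(c * p * (y - p * ν))) = e (-(c * q * (y - q * ν))) *
          e (-(c * (p - q : ℤ) * (y - q * (2 * ν) - (p - q : ℤ) * ν))) := by
        rw [← e_add]; congr 1; push_cast; ring
      rw [this]; ring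
    · rw [(hF q x y).2, show y + 1 - q * (2 * ν) = y - q * (2 * ν) + 1 by ring, (hG _ _ _).2]
  algebraMap_mem' := fun k p x y => by
    rw [Algebra.algebraMap_eq_smul_one, Conv.smul_apply, Conv.one_def, Conv.single_apply]
    by_cases h : 0 = p
    · subst h; simp [e_zero]
    · simp [h]
  star_mem' := fun {F} hF p x y => by
    have hF : ∀ p : ℤ, QuasiPeriodic c ν p (F p) := hF
    rw [Conv.star_apply, Conv.star_apply, Conv.star_apply,
      show x + 1 - p * (2 * μ) = x - p * (2 * μ) + 1 by ring,
      show y + 1 - p * (2 * ν) = y - p * (2 * ν) + 1 by ring, (hF _ _ _).1, (hF _ _ _).2,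
      star_mul', star_e]
    refine ⟨?_, rfl⟩
    congr 2
    push_cast
    ring

/-- The element of `D₀` given by one quasi-periodic function in degree `p`. -/
def homog {c : ℕ} (μ : ℝ) {ν : ℝ} (p : ℤ) (f : C(ℝ × ℝ, ℂ)) (hf : QuasiPeriodic c ν p f) :
    preQHM c μ ν :=
  ⟨Conv.single p f, fun q x y => by
    rw [Conv.single_apply]
    by_cases h : p = q
    · subst h; simpa using hf x y
    · simp [h]⟩

section norm

variable {c : ℕ} {μ ν : ℝ}

lemma QuasiPeriodic.bounded {p : ℤ} {f : C(ℝ × ℝ, ℂ)} (hf : QuasiPeriodic c ν p f) :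
    ∃ M : ℝ, ∀ z, ‖f z‖ ≤ M := by
  obtain ⟨M, hM⟩ := (isCompact_Icc (a := (0 : ℝ)) (b := 1) |>.prod
    (isCompact_Icc (a := (0 : ℝ)) (b := 1))).exists_bound_of_continuousOn f.continuous.continuousOn
  have h1 : ∀ y, Function.Periodic (fun x => ‖f (x, y)‖) 1 := fun y x => by
    simp [(hf x y).1, norm_e]
  have h2 : ∀ x, Function.Periodic (fun y => ‖f (x, y)‖) 1 := fun x y => by
    simp [(hf x y).2]
  refine ⟨M, fun ⟨x, y⟩ => ?_⟩
  obtain ⟨x', hx', hx⟩ := (h1 y).exists_mem_Ico₀ one_pos x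
  obtain ⟨y', hy', hy⟩ := (h2 x').exists_mem_Ico₀ one_pos y
  have := hM (x', y') ⟨⟨hx'.1, hx'.2.le⟩, ⟨hy'.1, hy'.2.le⟩⟩
  rwa [hx, hy]

open scoped CStarAlgebra in
attribute [local instance] CStarAlgebra.spectralOrder CStarAlgebra.spectralOrderedRing in
lemma norm_le_of_sum_squares {B : Type} [CStarAlgebra B] {a b : B} {M : ℝ} (hM : 0 ≤ M)
    (h : star a * a + star b * b = algebraMap ℝ B (M ^ 2)) : ‖a‖ ≤ M := by
  have h1 : star a * a ≤ algebraMap ℝ B (M ^ 2) := by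
    rw [← h]; exact le_add_of_nonneg_right (star_mul_self_nonneg b)
  have h2 : ‖star a * a‖ ≤ M ^ 2 :=
    (CStarAlgebra.norm_le_iff_le_algebraMap _ (by positivity) (star_mul_self_nonneg a)).2 h1
  rw [CStarRing.norm_star_mul_self] at h2
  nlinarith [norm_nonneg a]

lemma norm_homog_le {p : ℤ} {f : C(ℝ × ℝ, ℂ)} (hf : QuasiPeriodic c ν p f) {M : ℝ}
    (hM : ∀ z, ‖f z‖ ≤ M) {B : Type} [CStarAlgebra B] (ρ : preQHM c μ ν →⋆ₐ[ℂ] B) :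
    ‖ρ (homog μ p f hf)‖ ≤ M := by
  have hM0 : 0 ≤ M := (norm_nonneg _).trans (hM 0)
  let g : C(ℝ × ℝ, ℂ) :=
    ⟨fun z => ((√(M ^ 2 - ‖shift μ ν (-p) f z‖ ^ 2) : ℝ) : ℂ), by fun_prop⟩
  have hg : QuasiPeriodic c ν 0 g := fun x y => by
    have h1 := hf (x + p * (2 * μ)) (y + p * (2 * ν))
    have e1 : x + 1 + p * (2 * μ) = x + p * (2 * μ) + 1 := by ring
    have e2 : y + 1 + p * (2 * ν) = y + p * (2 * ν) + 1 := by ring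
    simp only [g, ContinuousMap.coe_mk, shift_apply, Int.cast_neg, neg_mul, sub_neg_eq_add, e1, e2,
      h1.1, h1.2]
    simp [norm_e, e_zero]
  have key : star (homog μ p f hf) * homog μ p f hf + star (homog μ 0 g hg) * homog μ 0 g hg
      = algebraMap ℂ (preQHM c μ ν) ((M ^ 2 : ℝ) : ℂ) := by
    apply Subtype.ext
    change star (Conv.single p f) * Conv.single p f + star (Conv.single 0 g) * Conv.single 0 g
      = algebraMap ℂ (Conv μ ν) _
    rw [Algebra.algebraMap_eq_smul_one, Conv.star_single, Conv.star_single, Conv.one_def,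
      Conv.single_mul_single, Conv.single_mul_single, Conv.smul_single, neg_add_cancel, neg_zero,
      add_zero, ← Conv.single_add]
    congr 1
    ext ⟨x, y⟩
    have hle : 0 ≤ M ^ 2 - ‖f (x + p * (2 * μ), y + p * (2 * ν))‖ ^ 2 := by
      have := hM (x + p * (2 * μ), y + p * (2 * ν))
      nlinarith [norm_nonneg (f (x + p * (2 * μ), y + p * (2 * ν)))]
    simp only [ContinuousMap.add_apply, ContinuousMap.mul_apply, shift_apply,
      ContinuousMap.star_apply, ContinuousMap.smul_apply, ContinuousMap.one_apply, g,
      ContinuousMap.coe_mk, Int.cast_neg, Int.cast_zero, neg_mul, zero_mul, sub_neg_eq_add, sub_zero,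
      smul_eq_mul, mul_one, Complex.star_def, Complex.conj_ofReal, Complex.conj_mul']
    rw [← Complex.ofReal_mul, Real.mul_self_sqrt hle]
    push_cast
    ring
  refine norm_le_of_sum_squares (b := ρ (homog μ 0 g hg)) hM0 ?_
  rw [← map_star, ← map_star, ← map_mul, ← map_mul, ← map_add, key, AlgHomClass.commutes]
  rfl

lemma eq_sum_homog (F : preQHM c μ ν) :
    F = ∑ p ∈ Finsupp.support (F : Conv μ ν), homog μ p ((F : Conv μ ν) p) (F.2 p) := by
  apply Subtype.ext
  have := Finsupp.sum_single (F : Conv μ ν)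
  rw [AddSubmonoidClass.coe_finsetSum]
  exact this.symm

/-- The values `‖ρ(F)‖`, for all `*`-representations `ρ` of `D₀` in unital C*-algebras. A
`*`-representation of `D₀` amounts to a covariant representation of the bimodule `M`: its
restrictions to the degrees `0` and `1` are the two components. -/
def repNorms (F : preQHM c μ ν) : Set ℝ :=
  {r | ∃ (B : Type) (_ : CStarAlgebra B) (ρ : preQHM c μ ν →⋆ₐ[ℂ] B), r = ‖ρ F‖}

lemma repNorms_bddAbove (F : preQHM c μ ν) : BddAbove (repNorms F) := by
  choose M hM using fun p : ℤ => QuasiPeriodic.bounded (F.2 p)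
  refine ⟨∑ p ∈ Finsupp.support (F : Conv μ ν), M p, ?_⟩
  rintro _ ⟨B, _, ρ, rfl⟩
  conv_lhs => rw [eq_sum_homog F, map_sum]
  exact (norm_sum_le _ _).trans (Finset.sum_le_sum fun p _ => norm_homog_le (F.2 p) (hM p) ρ)

end norm

section regular

/-- The Hilbert space `ℓ²(ℤ)`. -/
abbrev Hil : Type := lp (fun _ : ℤ => ℂ) 2

lemma summable_sq (v : Hil) : Summable fun n => ‖v n‖ ^ 2 := by
  have := (lp.memℓp v).summable (by norm_num)
  simpa using this

lemma norm_sq_eq (v : Hil) : ‖v‖ ^ 2 = ∑' n, ‖v n‖ ^ 2 := by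
  have := lp.norm_rpow_eq_tsum (p := 2) (by norm_num) v
  simpa using this

lemma exists_weightedShift (p : ℤ) (a : ℤ → ℂ) (M : ℝ) (hM : ∀ n, ‖a n‖ ≤ M) :
    ∃ T : Hil →L[ℂ] Hil, ∀ v n, T v n = a n * v (n + p) := by
  have hM0 : 0 ≤ M := (norm_nonneg _).trans (hM 0)
  have hs (v : Hil) : Summable fun n => ‖v (n + p)‖ ^ 2 :=
    (Equiv.addRight p).summable_iff.2 (summable_sq v)
  have hle (v : Hil) (n : ℤ) : ‖a n * v (n + p)‖ ^ 2 ≤ M ^ 2 * ‖v (n + p)‖ ^ 2 := by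
    rw [norm_mul, mul_pow]
    gcongr
    exact hM n
  have hs' (v : Hil) : Summable fun n => ‖a n * v (n + p)‖ ^ 2 :=
    Summable.of_nonneg_of_le (fun n => by positivity) (hle v) ((hs v).mul_left _)
  have hmem (v : Hil) : Memℓp (fun n => a n * v (n + p)) 2 := memℓp_gen (by simpa using hs' v)
  refine ⟨LinearMap.mkContinuous
    { toFun := fun v => ⟨fun n => a n * v (n + p), hmem v⟩
      map_add' := fun v w => by ext n; exact mul_add (a n) (v (n + p)) (w (n + p))
      map_smul' := fun k v => by ext n; simp [mul_left_comm] } M ?_, fun v n => rfl⟩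
  intro v
  rw [← sq_le_sq₀ (norm_nonneg _) (by positivity), norm_sq_eq, mul_pow, norm_sq_eq, ← tsum_mul_left]
  calc ∑' n, ‖a n * v (n + p)‖ ^ 2 ≤ ∑' n, M ^ 2 * ‖v (n + p)‖ ^ 2 :=
        (hs' v).tsum_le_tsum (hle v) ((hs v).mul_left _)
    _ = ∑' n, M ^ 2 * ‖v n‖ ^ 2 := (Equiv.addRight p).tsum_eq fun n => M ^ 2 * ‖v n‖ ^ 2

variable {c : ℕ} {μ ν : ℝ}

/-- The orbit `z - 2n(μ, ν)` of `z = (x, y)`. -/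
def orbit (μ ν : ℝ) (z : ℝ × ℝ) (n : ℤ) : ℝ × ℝ := (z.1 - n * (2 * μ), z.2 - n * (2 * ν))

lemma shift_orbit (z : ℝ × ℝ) (n p : ℤ) (f : C(ℝ × ℝ, ℂ)) :
    shift μ ν p f (orbit μ ν z n) = f (orbit μ ν z (n + p)) := by
  simp only [orbit, shift_apply]
  congr 2 <;> push_cast <;> ring

lemma finite_support_op (F : Conv μ ν) (w : ℝ × ℝ) (v : ℤ → ℂ) :
    (Function.support fun p : ℤ => F p w * v p).Finite := by
  refine (Finsupp.hasFiniteSupport (F : ℤ →₀ C(ℝ × ℝ, ℂ))).subset fun q hq h => hq ?_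
  have h : F q = 0 := h
  simp [h]

lemma exists_regular (z : ℝ × ℝ) (F : preQHM c μ ν) : ∃ T : Hil →L[ℂ] Hil,
    ∀ v n, T v n = ∑ᶠ p : ℤ, (F : Conv μ ν) p (orbit μ ν z n) * v (n + p) := by
  choose M hM using fun p : ℤ => QuasiPeriodic.bounded (F.2 p)
  choose T hT using fun p : ℤ => exists_weightedShift p
    (fun n => (F : Conv μ ν) p (orbit μ ν z n)) (M p) (fun n => hM p _)
  refine ⟨∑ p ∈ Finsupp.support (F : Conv μ ν), T p, fun v n => ?_⟩
  rw [finsum_eq_sum_of_support_subset (s := Finsupp.support (F : Conv μ ν))]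
  · rw [sum_apply, lp.coeFn_sum, Finset.sum_apply]
    exact Finset.sum_congr rfl fun p _ => hT p v n
  · intro p hp
    rw [Finset.mem_coe]
    exact Finsupp.mem_support_iff.2 fun (h : (F : Conv μ ν) p = 0) => hp (by simp [h])

/-- The operators of the regular representation over the point `z`. -/
def regularOp (z : ℝ × ℝ) (F : preQHM c μ ν) : Hil →L[ℂ] Hil := (exists_regular z F).choose

lemma regularOp_apply (z : ℝ × ℝ) (F : preQHM c μ ν) (v : Hil) (n : ℤ) : regularOp z F v n =
    ∑ᶠ p : ℤ, (F : Conv μ ν) p (orbit μ ν z n) * v (n + p) := (exists_regular z F).choose_spec v n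

lemma regularOp_homog (z : ℝ × ℝ) {p : ℤ} {f : C(ℝ × ℝ, ℂ)} (hf : QuasiPeriodic c ν p f) (v : Hil)
    (n : ℤ) : regularOp z (homog μ p f hf) v n = f (orbit μ ν z n) * v (n + p) := by
  rw [regularOp_apply, finsum_eq_single _ p]
  · change (Conv.single p f : Conv μ ν) p _ * _ = _
    rw [Conv.single_apply, if_pos rfl]
  · intro q hq
    change (Conv.single p f : Conv μ ν) q _ * _ = _
    rw [Conv.single_apply, if_neg hq.symm]
    simp

lemma regularOp_add (z : ℝ × ℝ) (F G : preQHM c μ ν) :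
    regularOp z (F + G) = regularOp z F + regularOp z G := by
  ext v n
  rw [add_apply, lp.coeFn_add, Pi.add_apply, regularOp_apply, regularOp_apply,
    regularOp_apply, ← finsum_add_distrib (finite_support_op _ _ fun p => v (n + p))
      (finite_support_op _ _ fun p => v (n + p))]
  exact finsum_congr fun p => add_mul _ _ _

lemma homog_induction {P : preQHM c μ ν → Prop} (F : preQHM c μ ν) (h0 : P 0)
    (hadd : ∀ F G, P F → P G → P (F + G)) (hs : ∀ p f hf, P (homog μ p f hf)) : P F := by
  rw [eq_sum_homog F]
  exact Finset.sum_induction _ P hadd h0 fun p _ => hs _ _ _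

lemma regularOp_zero (z : ℝ × ℝ) : regularOp z (0 : preQHM c μ ν) = 0 := by
  have := regularOp_add z (0 : preQHM c μ ν) 0
  rwa [add_zero, right_eq_add] at this

lemma regularOp_smul (z : ℝ × ℝ) (k : ℂ) (F : preQHM c μ ν) :
    regularOp z (k • F) = k • regularOp z F := by
  ext v n
  rw [smul_apply, lp.coeFn_smul, Pi.smul_apply, regularOp_apply,
    regularOp_apply, smul_eq_mul, mul_finsum]
  exact finsum_congr fun p => mul_assoc _ _ _

lemma homog_mul_homog {p q : ℤ} {f g : C(ℝ × ℝ, ℂ)} (hf : QuasiPeriodic c ν p f)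
    (hg : QuasiPeriodic c ν q g) (h) :
    homog μ p f hf * homog μ q g hg = homog μ (p + q) (f * shift μ ν p g) h :=
  Subtype.ext (Conv.single_mul_single p q f g)

lemma regularOp_mul (z : ℝ × ℝ) (F G : preQHM c μ ν) :
    regularOp z (F * G) = regularOp z F * regularOp z G := by
  induction F using homog_induction with
  | h0 => rw [zero_mul, regularOp_zero, zero_mul]
  | hadd F F' h h' => rw [add_mul, regularOp_add, regularOp_add, add_mul, h, h']
  | hs p f hf =>
  induction G using homog_induction with
  | h0 => rw [mul_zero, regularOp_zero, mul_zero]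
  | hadd F F' h h' => rw [mul_add, regularOp_add, regularOp_add, mul_add, h, h']
  | hs q g hg =>
  have hfg : QuasiPeriodic c ν (p + q) (f * shift μ ν p g) := by
    have := (homog μ p f hf * homog μ q g hg).2 (p + q)
    change QuasiPeriodic c ν (p + q)
      ((Conv.single p f * Conv.single q g : Conv μ ν) (p + q)) at this
    rwa [Conv.single_mul_single, Conv.single_apply, if_pos rfl] at this
  rw [homog_mul_homog hf hg hfg]
  ext v n
  rw [mul_apply_eq_comp, regularOp_homog, regularOp_homog, regularOp_homog,
    ContinuousMap.mul_apply, shift_orbit, mul_assoc, add_assoc]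

lemma inner_eq (v w : Hil) : inner ℂ v w = ∑' n, w n * star (v n) := by
  rw [lp.inner_eq_tsum]
  rfl

lemma regularOp_star (z : ℝ × ℝ) (F : preQHM c μ ν) :
    regularOp z (star F) = star (regularOp z F) := by
  induction F using homog_induction with
  | h0 => rw [star_zero, regularOp_zero, star_zero]
  | hadd F F' h h' => rw [star_add, regularOp_add, regularOp_add, star_add, h, h']
  | hs p f hf =>
  have hf' : QuasiPeriodic c ν (-p) (shift μ ν (-p) (star f)) := by
    have := (star (homog μ p f hf)).2 (-p)
    change QuasiPeriodic c ν (-p) ((star (Conv.single p f) : Conv μ ν) (-p)) at this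
    rwa [Conv.star_single, Conv.single_apply, if_pos rfl] at this
  have h1 : star (homog μ p f hf) = homog μ (-p) (shift μ ν (-p) (star f)) hf' :=
    Subtype.ext (Conv.star_single p f)
  rw [h1, ContinuousLinearMap.star_eq_adjoint]
  refine (ContinuousLinearMap.eq_adjoint_iff _ _).2 fun v w => ?_
  rw [inner_eq, inner_eq, ← (Equiv.addRight p).tsum_eq]
  refine tsum_congr fun n => ?_
  rw [regularOp_homog, regularOp_homog, shift_orbit, Equiv.coe_addRight, add_neg_cancel_right,
    ContinuousMap.star_apply, star_mul', star_star]
  ring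

lemma quasiPeriodic_one : QuasiPeriodic c ν 0 1 := fun x y => by simp [e_zero]

/-- The regular representation of `D₀` on `ℓ²(ℤ)` over the point `z`. -/
def regular (z : ℝ × ℝ) : preQHM c μ ν →⋆ₐ[ℂ] (Hil →L[ℂ] Hil) where
  toFun := regularOp z
  map_one' := by
    have h1 : (1 : preQHM c μ ν) = homog μ 0 1 quasiPeriodic_one := rfl
    rw [h1]
    ext v n
    rw [regularOp_homog]
    simp
  map_mul' := regularOp_mul z
  map_zero' := regularOp_zero z
  map_add' := regularOp_add z
  commutes' := fun k => by
    have h1 : (1 : preQHM c μ ν) = homog μ 0 1 quasiPeriodic_one := rfl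
    rw [Algebra.algebraMap_eq_smul_one, Algebra.algebraMap_eq_smul_one, regularOp_smul, h1]
    congr 1
    ext v n
    rw [regularOp_homog]
    simp
  map_star' := regularOp_star z

lemma norm_apply_zero_le_regular (z : ℝ × ℝ) (F : preQHM c μ ν) :
    ‖(F : Conv μ ν) 0 z‖ ≤ ‖regular z F‖ := by
  let v : Hil := lp.single 2 0 1
  have hv : ‖v‖ = 1 := by simp [v, lp.norm_single]
  have h1 : regular z F v 0 = (F : Conv μ ν) 0 z := by
    change regularOp z F v 0 = _
    rw [regularOp_apply, finsum_eq_single _ 0]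
    · simp [orbit, v]
    · intro p hp
      simp [v, hp]
  calc ‖(F : Conv μ ν) 0 z‖ = ‖regular z F v 0‖ := by rw [h1]
    _ ≤ ‖regular z F v‖ := lp.norm_apply_le_norm (by norm_num) _ _
    _ ≤ ‖regular z F‖ * ‖v‖ := ContinuousLinearMap.le_opNorm _ _
    _ = ‖regular z F‖ := by rw [hv, mul_one]

lemma repNorms_nonempty (F : preQHM c μ ν) : (repNorms F).Nonempty :=
  ⟨_, Hil →L[ℂ] Hil, inferInstance, regular 0, rfl⟩

end regular


section action

variable {c : ℕ} {μ ν : ℝ}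

/-! ### The action of the Heisenberg group -/

/-- The degree `p` part of the action of the element `(r, s, t)` of the Heisenberg group:
`f ↦ e(p (t - c s (x - r - p μ))) f(x - r, y - s)`. -/
def twist (c : ℕ) (μ r s t : ℝ) (p : ℤ) (f : C(ℝ × ℝ, ℂ)) : C(ℝ × ℝ, ℂ) :=
  ⟨fun z => e (p * (t - c * s * (z.1 - r - p * μ))) * f (z.1 - r, z.2 - s),
    (continuous_e.comp (by fun_prop)).mul (by fun_prop)⟩

lemma twist_apply (r s t : ℝ) (p : ℤ) (f : C(ℝ × ℝ, ℂ)) (x y : ℝ) : twist c μ r s t p f (x, y) =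
    e (p * (t - c * s * (x - r - p * μ))) * f (x - r, y - s) := rfl

lemma twist_zero (r s t : ℝ) (p : ℤ) : twist c μ r s t p 0 = 0 := by
  ext ⟨x, y⟩; simp [twist_apply]

/-- `α_{(r,s,t)}(F)(p, x, y) = e(p (t - c s (x - r - p μ))) F(p, x - r, y - s)`. -/
def actAux (c : ℕ) (μ r s t : ℝ) (F : ℤ →₀ C(ℝ × ℝ, ℂ)) : ℤ →₀ C(ℝ × ℝ, ℂ) :=
  Finsupp.onFinset F.support (fun p => twist c μ r s t p (F p)) fun p hp => by
    rw [Finsupp.mem_support_iff]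
    exact fun h => hp (by rw [h, twist_zero])

variable (c μ ν) in
/-- The action of `(r, s, t)` on `D₀`, as an endomorphism of `Conv μ ν`. -/
def actConv (r s t : ℝ) (F : Conv μ ν) : Conv μ ν := actAux c μ r s t F

lemma actConv_apply (r s t : ℝ) (F : Conv μ ν) (p : ℤ) :
    actConv c μ ν r s t F p = twist c μ r s t p (F p) := rfl

lemma actConv_single (r s t : ℝ) (p : ℤ) (f : C(ℝ × ℝ, ℂ)) :
    actConv c μ ν r s t (Conv.single p f) = Conv.single p (twist c μ r s t p f) := by
  apply Conv.ext
  intro q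
  rw [actConv_apply, Conv.single_apply, Conv.single_apply]
  by_cases h : p = q
  · subst h; simp
  · simp [h, twist_zero]

lemma actConv_add (r s t : ℝ) (F G : Conv μ ν) :
    actConv c μ ν r s t (F + G) = actConv c μ ν r s t F + actConv c μ ν r s t G := by
  apply Conv.ext
  rintro p
  ext ⟨x, y⟩
  simp only [actConv_apply, Conv.add_apply, ContinuousMap.add_apply, twist_apply, mul_add]

lemma actConv_zero (r s t : ℝ) : actConv c μ ν r s t 0 = 0 := by
  apply Conv.ext
  intro p
  rw [actConv_apply, Conv.zero_apply, twist_zero]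

lemma actConv_smul (r s t : ℝ) (k : ℂ) (F : Conv μ ν) :
    actConv c μ ν r s t (k • F) = k • actConv c μ ν r s t F := by
  apply Conv.ext
  rintro p
  ext ⟨x, y⟩
  simp only [actConv_apply, Conv.smul_apply, ContinuousMap.smul_apply, twist_apply, smul_eq_mul]
  ring

lemma actConv_one (r s t : ℝ) : actConv c μ ν r s t 1 = 1 := by
  rw [Conv.one_def, actConv_single]
  congr 1
  ext ⟨x, y⟩
  simp [twist_apply, e_zero]

lemma actConv_mul (r s t : ℝ) (F G : Conv μ ν) :
    actConv c μ ν r s t (F * G) = actConv c μ ν r s t F * actConv c μ ν r s t G := by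
  induction F using Conv.induction with
  | h0 => simp only [zero_mul, actConv_zero]
  | hadd F F' h h' => simp only [add_mul, actConv_add, h, h']
  | hs p f =>
  induction G using Conv.induction with
  | h0 => simp only [mul_zero, actConv_zero]
  | hadd F F' h h' => simp only [mul_add, actConv_add, h, h']
  | hs q g =>
  rw [Conv.single_mul_single, actConv_single, actConv_single, actConv_single,
    Conv.single_mul_single]
  congr 1
  ext ⟨x, y⟩
  simp only [twist_apply, ContinuousMap.mul_apply, shift_apply]
  have : e ((p + q : ℤ) * (t - c * s * (x - r - (p + q : ℤ) * μ))) =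
      e (p * (t - c * s * (x - r - p * μ))) *
        e (q * (t - c * s * (x - p * (2 * μ) - r - q * μ))) := by
    rw [← e_add]; congr 1; push_cast; ring
  rw [this, sub_right_comm x r, sub_right_comm y s]
  ring_nf

lemma actConv_star (r s t : ℝ) (F : Conv μ ν) :
    actConv c μ ν r s t (star F) = star (actConv c μ ν r s t F) := by
  apply Conv.ext
  rintro p
  ext ⟨x, y⟩
  rw [Conv.star_apply, actConv_apply, actConv_apply, twist_apply, twist_apply, Conv.star_apply,
    star_mul', star_e, show x - r - p * (2 * μ) = x - p * (2 * μ) - r by ring,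
    show y - s - p * (2 * ν) = y - p * (2 * ν) - s by ring]
  congr 2
  push_cast
  ring_nf

lemma actConv_mem (r s t : ℝ) {F : Conv μ ν} (hF : F ∈ preQHM c μ ν) :
    actConv c μ ν r s t F ∈ preQHM c μ ν := by
  have hF : ∀ p : ℤ, QuasiPeriodic c ν p (F p) := hF
  intro p x y
  rw [actConv_apply, twist_apply, twist_apply, twist_apply, show x + 1 - r = x - r + 1 by ring,
    show y + 1 - s = y - s + 1 by ring, (hF _ _ _).1, (hF _ _ _).2, ← mul_assoc, ← mul_assoc,
    ← e_add, ← e_add]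
  refine ⟨?_, rfl⟩
  congr 2
  ring

variable (c μ ν) in
/-- The endomorphism `actConv` as a `*`-homomorphism. -/
def actConvHom (r s t : ℝ) : Conv μ ν →⋆ₐ[ℂ] Conv μ ν where
  toFun := actConv c μ ν r s t
  map_one' := actConv_one r s t
  map_mul' := actConv_mul r s t
  map_zero' := actConv_zero r s t
  map_add' := actConv_add r s t
  commutes' k := by
    rw [Algebra.algebraMap_eq_smul_one, actConv_smul, actConv_one]
  map_star' := actConv_star r s t

variable (c μ ν) in
/-- The action of `(r, s, t)` on `D₀`. -/
def actPre (r s t : ℝ) : preQHM c μ ν →⋆ₐ[ℂ] preQHM c μ ν :=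
  ((actConvHom c μ ν r s t).comp (preQHM c μ ν).subtype).codRestrict (preQHM c μ ν)
    fun F => actConv_mem r s t F.2

lemma actPre_apply (r s t : ℝ) (F : preQHM c μ ν) (p : ℤ) (x y : ℝ) :
    (actPre c μ ν r s t F : Conv μ ν) p (x, y) =
      e (p * (t - c * s * (x - r - p * μ))) * (F : Conv μ ν) p (x - r, y - s) := rfl

end action

section norm

variable {c : ℕ} {μ ν : ℝ}

/-- The norm of the universal C*-algebra: the supremum of `‖ρ(F)‖` over all representations `ρ`. -/
def fullNorm (F : preQHM c μ ν) : ℝ := sSup (repNorms F)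

lemma le_fullNorm (F : preQHM c μ ν) {B : Type} [CStarAlgebra B] (ρ : preQHM c μ ν →⋆ₐ[ℂ] B) :
    ‖ρ F‖ ≤ fullNorm F :=
  le_csSup (repNorms_bddAbove F) ⟨B, _, ρ, rfl⟩

lemma fullNorm_le {F : preQHM c μ ν} {M : ℝ}
    (h : ∀ (B : Type) [CStarAlgebra B] (ρ : preQHM c μ ν →⋆ₐ[ℂ] B), ‖ρ F‖ ≤ M) : fullNorm F ≤ M :=
  csSup_le (repNorms_nonempty F) (by rintro _ ⟨B, _, ρ, rfl⟩; exact h B ρ)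

lemma fullNorm_nonneg (F : preQHM c μ ν) : 0 ≤ fullNorm F := by
  obtain ⟨_, B, _, ρ, rfl⟩ := repNorms_nonempty F
  exact (norm_nonneg _).trans (le_fullNorm F ρ)

variable (c μ ν) in
/-- The norm as a ring seminorm. -/
def fullSeminorm : RingSeminorm (preQHM c μ ν) where
  toFun := fullNorm
  map_zero' := le_antisymm (fullNorm_le fun B _ ρ => by simp) (fullNorm_nonneg _)
  add_le' F G := fullNorm_le fun B _ ρ => by
    rw [map_add]
    exact (norm_add_le _ _).trans (add_le_add (le_fullNorm F ρ) (le_fullNorm G ρ))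
  neg' F := by simp only [fullNorm, repNorms, map_neg, norm_neg]
  mul_le' F G := fullNorm_le fun B _ ρ => by
    rw [map_mul]
    exact (norm_mul_le _ _).trans
      (mul_le_mul (le_fullNorm F ρ) (le_fullNorm G ρ) (norm_nonneg _) (fullNorm_nonneg F))

instance : SeminormedRing (preQHM c μ ν) := (fullSeminorm c μ ν).toSeminormedRing

lemma norm_eq_fullNorm (F : preQHM c μ ν) : ‖F‖ = fullNorm F := rfl

instance : NormedAlgebra ℂ (preQHM c μ ν) where
  norm_smul_le k F := fullNorm_le fun B _ ρ => by
    rw [map_smul, norm_smul]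
    exact mul_le_mul_of_nonneg_left (le_fullNorm F ρ) (norm_nonneg k)

instance : NormedStarGroup (preQHM c μ ν) where
  norm_star_le F := fullNorm_le fun B _ ρ => by
    rw [map_star, norm_star]; exact le_fullNorm F ρ

lemma norm_mul_self_le_star_mul (F : preQHM c μ ν) : ‖F‖ * ‖F‖ ≤ ‖star F * F‖ := by
  have h : ‖F‖ ≤ √‖star F * F‖ := fullNorm_le fun B _ ρ => by
    apply Real.le_sqrt_of_sq_le
    rw [sq, ← CStarRing.norm_star_mul_self, ← map_star, ← map_mul]
    exact le_fullNorm _ ρ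
  calc ‖F‖ * ‖F‖ ≤ √‖star F * F‖ * √‖star F * F‖ :=
        mul_le_mul h h (norm_nonneg _) (Real.sqrt_nonneg _)
    _ = ‖star F * F‖ := Real.mul_self_sqrt (norm_nonneg _)

end norm

open UniformSpace

/-- The quantum Heisenberg manifold `D^c_{μ,ν}`: the universal C*-algebra of `D₀`. -/
abbrev QHMAlg (c : ℕ) (μ ν : ℝ) : Type := Completion (preQHM c μ ν)

variable {c : ℕ} {μ ν : ℝ}

instance : NormedAlgebra ℂ (QHMAlg c μ ν) where
  norm_smul_le := norm_smul_le

instance : Star (QHMAlg c μ ν) where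
  star := Completion.map star

lemma isometry_star' : Isometry (star : preQHM c μ ν → preQHM c μ ν) :=
  AddMonoidHomClass.isometry_of_norm (starAddEquiv (R := preQHM c μ ν)) fun F => norm_star F

lemma star_coe (F : preQHM c μ ν) : star (F : QHMAlg c μ ν) = ((star F : preQHM c μ ν) : QHMAlg c μ ν) :=
  Completion.map_coe isometry_star'.uniformContinuous F

lemma continuous_star' : Continuous (star : QHMAlg c μ ν → QHMAlg c μ ν) :=
  Completion.continuous_map

instance : StarRing (QHMAlg c μ ν) where
  star_involutive a := by
    induction a using Completion.induction_on with
    | hp => exact isClosed_eq (continuous_star'.comp continuous_star') continuous_id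
    | ih F => simp only [star_coe, star_star]
  star_mul a b := by
    induction a, b using Completion.induction_on₂ with
    | hp =>
      exact isClosed_eq (continuous_star'.comp (by fun_prop))
        ((continuous_star'.comp continuous_snd).mul (continuous_star'.comp continuous_fst))
    | ih F G => simp only [← Completion.coe_mul, star_coe, star_mul]
  star_add a b := by
    induction a, b using Completion.induction_on₂ with
    | hp =>
      exact isClosed_eq (continuous_star'.comp (by fun_prop))
        ((continuous_star'.comp continuous_fst).add (continuous_star'.comp continuous_snd))
    | ih F G => simp only [← Completion.coe_add, star_coe, star_add]

instance : StarModule ℂ (QHMAlg c μ ν) where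
  star_smul k a := by
    induction a using Completion.induction_on with
    | hp =>
      exact isClosed_eq (continuous_star'.comp (continuous_const_smul k))
        ((continuous_const_smul (star k)).comp continuous_star')
    | ih F => simp only [← Completion.coe_smul, star_coe, star_smul]

instance : CStarRing (QHMAlg c μ ν) where
  norm_mul_self_le a := by
    induction a using Completion.induction_on with
    | hp => exact isClosed_le (by fun_prop) ((continuous_star'.mul continuous_id).norm)
    | ih F =>
      rw [star_coe, ← Completion.coe_mul, Completion.norm_coe, Completion.norm_coe]
      exact norm_mul_self_le_star_mul F

instance : CStarAlgebra (QHMAlg c μ ν) where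

lemma norm_actPre_le (r s t : ℝ) (F : preQHM c μ ν) : ‖actPre c μ ν r s t F‖ ≤ ‖F‖ :=
  fullNorm_le fun _ _ ρ => le_fullNorm F (ρ.comp (actPre c μ ν r s t))

lemma uniformContinuous_actPre (r s t : ℝ) : UniformContinuous (actPre c μ ν r s t) :=
  (AddMonoidHomClass.lipschitz_of_bound (actPre c μ ν r s t) 1
    (by simpa using norm_actPre_le r s t)).uniformContinuous

lemma map_actPre_coe (r s t : ℝ) (F : preQHM c μ ν) :
    Completion.map (actPre c μ ν r s t) (F : QHMAlg c μ ν) = (actPre c μ ν r s t F : preQHM c μ ν) :=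
  Completion.map_coe (uniformContinuous_actPre r s t) F

lemma continuous_mapAct (r s t : ℝ) :
    Continuous (Completion.map (actPre c μ ν r s t) : QHMAlg c μ ν → QHMAlg c μ ν) :=
  Completion.continuous_map

variable (c μ ν) in
/-- The action of the element `(r, s, t)` of the Heisenberg group on `D^c_{μ,ν}`: the continuous
extension of the action on `D₀`. -/
def act (r s t : ℝ) : QHMAlg c μ ν →⋆ₐ[ℂ] QHMAlg c μ ν where
  toFun := Completion.map (actPre c μ ν r s t)
  map_one' := by
    rw [← Completion.coe_one, map_actPre_coe, map_one]
  map_mul' a b := by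
    induction a, b using Completion.induction_on₂ with
    | hp =>
      exact isClosed_eq (Completion.continuous_map.comp (by fun_prop))
        (continuous_mul.comp (((continuous_mapAct r s t).comp continuous_fst).prodMk
          ((continuous_mapAct r s t).comp continuous_snd)))
    | ih F G => rw [← Completion.coe_mul, map_actPre_coe, map_actPre_coe, map_actPre_coe, map_mul,
        Completion.coe_mul]
  map_zero' := by
    rw [← Completion.coe_zero, map_actPre_coe, map_zero]
  map_add' a b := by
    induction a, b using Completion.induction_on₂ with
    | hp =>
      exact isClosed_eq (Completion.continuous_map.comp (by fun_prop))
        (continuous_add.comp (((continuous_mapAct r s t).comp continuous_fst).prodMk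
          ((continuous_mapAct r s t).comp continuous_snd)))
    | ih F G => rw [← Completion.coe_add, map_actPre_coe, map_actPre_coe, map_actPre_coe, map_add,
        Completion.coe_add]
  commutes' k := by
    rw [Completion.algebraMap_def, map_actPre_coe, AlgHomClass.commutes]
  map_star' a := by
    induction a using Completion.induction_on with
    | hp =>
      exact isClosed_eq (Completion.continuous_map.comp continuous_star')
        (continuous_star'.comp Completion.continuous_map)
    | ih F => rw [star_coe, map_actPre_coe, map_actPre_coe, map_star, star_coe]

lemma act_coe (r s t : ℝ) (F : preQHM c μ ν) :
    act c μ ν r s t (F : QHMAlg c μ ν) = (actPre c μ ν r s t F : preQHM c μ ν) :=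
  map_actPre_coe r s t F

/-! ### The trace -/

lemma continuous_inner_integral (f : C(ℝ × ℝ, ℂ)) :
    Continuous fun x : ℝ => ∫ y in (0 : ℝ)..1, f (x, y) :=
  intervalIntegral.continuous_parametric_intervalIntegral_of_continuous' (by fun_prop) 0 1

variable (c μ ν) in
/-- The trace on `D₀`: `τ(F) = ∫₀¹ ∫_{S¹} F(0, x, y) dy dx`. -/
def tracePreAux : preQHM c μ ν →ₗ[ℂ] ℂ where
  toFun F := ∫ x in (0 : ℝ)..1, ∫ y in (0 : ℝ)..1, (F : Conv μ ν) 0 (x, y)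
  map_add' F G := by
    rw [← intervalIntegral.integral_add ((continuous_inner_integral _).intervalIntegrable _ _)
      ((continuous_inner_integral _).intervalIntegrable _ _)]
    congr 1
    ext x
    rw [← intervalIntegral.integral_add (Continuous.intervalIntegrable (by fun_prop) _ _)
      (Continuous.intervalIntegrable (by fun_prop) _ _)]
    rfl
  map_smul' k F := by
    rw [RingHom.id_apply, smul_eq_mul, ← intervalIntegral.integral_const_mul]
    congr 1
    ext x
    rw [← intervalIntegral.integral_const_mul]
    rfl

lemma norm_tracePreAux_le (F : preQHM c μ ν) : ‖tracePreAux c μ ν F‖ ≤ 1 * ‖F‖ := by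
  have h1 (z : ℝ × ℝ) : ‖(F : Conv μ ν) 0 z‖ ≤ ‖F‖ :=
    (norm_apply_zero_le_regular z F).trans (le_fullNorm F (regular z))
  have h2 (x : ℝ) : ‖∫ y in (0 : ℝ)..1, (F : Conv μ ν) 0 (x, y)‖ ≤ ‖F‖ := by
    simpa using intervalIntegral.norm_integral_le_of_norm_le_const (a := 0) (b := 1)
      fun y _ => h1 (x, y)
  have := intervalIntegral.norm_integral_le_of_norm_le_const (a := (0 : ℝ)) (b := 1)
      fun x _ => h2 x
  rw [sub_zero, abs_one, mul_one] at this
  rw [one_mul]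
  exact this

variable (c μ ν) in
/-- The trace `τ` on `D^c_{μ,ν}`: the continuous extension of the trace on `D₀`. -/
def trace : QHMAlg c μ ν →L[ℂ] ℂ :=
  ((tracePreAux c μ ν).mkContinuous 1 norm_tracePreAux_le).extend Completion.toComplL

lemma trace_coe (F : preQHM c μ ν) : trace c μ ν (F : QHMAlg c μ ν) =
    ∫ x in (0 : ℝ)..1, ∫ y in (0 : ℝ)..1, (F : Conv μ ν) 0 (x, y) :=
  ContinuousLinearMap.extend_eq _ (Completion.denseRange_coe)
    (Completion.isUniformInducing_coe _) F

/-! ### The smooth subalgebra, its derivations and the cyclic cocycles -/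

variable (c μ ν) in
/-- The smooth quantum Heisenberg manifold: the elements `a` for which `g ↦ α_g(a)` is `C^∞` on the
Heisenberg group, in its global coordinates `(r, s, t)`. -/
def smoothQHM : StarSubalgebra ℂ (QHMAlg c μ ν) where
  carrier := {a | ContDiff ℝ ∞ fun g : ℝ × ℝ × ℝ => act c μ ν g.1 g.2.1 g.2.2 a}
  zero_mem' := by simpa only [Set.mem_ofPred_eq, map_zero] using contDiff_const
  add_mem' ha hb := by
    simp only [Set.mem_ofPred_eq, map_add] at ha hb ⊢
    exact ha.add hb
  mul_mem' ha hb := by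
    simp only [Set.mem_ofPred_eq, map_mul] at ha hb ⊢
    exact ha.mul hb
  algebraMap_mem' k := by
    simpa only [Set.mem_ofPred_eq, AlgHomClass.commutes] using contDiff_const
  star_mem' ha := by
    simp only [Set.mem_ofPred_eq, map_star] at ha ⊢
    exact (starL' ℝ : QHMAlg c μ ν ≃L[ℝ] QHMAlg c μ ν).contDiff.comp ha

/-- The point with coordinate `u` on the `i`-th coordinate axis of the Heisenberg group. -/
def axis (i : Fin 3) (u : ℝ) : ℝ × ℝ × ℝ := ![(u, 0, 0), (0, u, 0), (0, 0, u)] i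

variable (c μ ν) in
/-- The curve `u ↦ α_{exp(u X_i)}(a)`. -/
def actAxis (i : Fin 3) (u : ℝ) : QHMAlg c μ ν →⋆ₐ[ℂ] QHMAlg c μ ν :=
  act c μ ν (axis i u).1 (axis i u).2.1 (axis i u).2.2

lemma differentiable_actAxis (i : Fin 3) (a : smoothQHM c μ ν) :
    Differentiable ℝ fun u => actAxis c μ ν i u (a : QHMAlg c μ ν) := by
  have h : ContDiff ℝ ∞ fun g : ℝ × ℝ × ℝ => act c μ ν g.1 g.2.1 g.2.2 (a : QHMAlg c μ ν) := a.2
  have h2 : Differentiable ℝ (axis i) := by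
    fin_cases i
    · exact (by fun_prop : Differentiable ℝ fun u : ℝ => ((u, 0, 0) : ℝ × ℝ × ℝ))
    · exact (by fun_prop : Differentiable ℝ fun u : ℝ => ((0, u, 0) : ℝ × ℝ × ℝ))
    · exact (by fun_prop : Differentiable ℝ fun u : ℝ => ((0, 0, u) : ℝ × ℝ × ℝ))
  exact (h.differentiable (by simp)).comp h2

variable (c μ ν) in
/-- The infinitesimal generators `∂₁, ∂₂, ∂₃` (here `i = 0, 1, 2`) of the action:
`∂_i(a)` is the derivative at `u = 0` of `α_{exp(u X_i)}(a)`. -/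
def deriv3 (i : Fin 3) : smoothQHM c μ ν →ₗ[ℂ] QHMAlg c μ ν where
  toFun a := deriv (fun u : ℝ => actAxis c μ ν i u (a : QHMAlg c μ ν)) 0
  map_add' a b := by
    change deriv (fun u : ℝ => actAxis c μ ν i u ((a : QHMAlg c μ ν) + b)) 0 = _
    simp only [map_add]
    exact deriv_add (differentiable_actAxis i a 0) (differentiable_actAxis i b 0)
  map_smul' k a := by
    change deriv (fun u : ℝ => actAxis c μ ν i u (k • (a : QHMAlg c μ ν))) 0 = _
    simp only [map_smul, RingHom.id_apply]
    exact deriv_const_smul k (differentiable_actAxis i a 0)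

variable (c μ ν) in
/-- The cochain `(a₀, …, aₙ) ↦ τ(a₀ ∂_{I 1}(a₁) ⋯ ∂_{I n}(aₙ))`. -/
def derForm {n : ℕ} (I : Fin n → Fin 3) :
    MultilinearMap ℂ (fun _ : Fin (n + 1) => smoothQHM c μ ν) ℂ :=
  (trace c μ ν).toLinearMap.compMultilinearMap
    ((MultilinearMap.mkPiAlgebraFin ℂ (n + 1) (QHMAlg c μ ν)).compLinearMap
      (Fin.cons (smoothQHM c μ ν).subtype.toLinearMap fun k => deriv3 c μ ν (I k)))


/-! ### The Hochschild complex -/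

section hochschild

variable {A : Type*} [Ring A] [Algebra ℂ A]

variable (A) in
/-- Hochschild `n`-chains: `A^{⊗(n+1)}`. -/
abbrev HChain (n : ℕ) : Type _ := ⨂[ℂ] _ : Fin (n + 1), A

variable (A) in
/-- Hochschild `n`-cochains: `(n+1)`-linear forms on `A`. -/
abbrev HCochain (n : ℕ) : Type _ := MultilinearMap ℂ (fun _ : Fin (n + 1) => A) ℂ

/-- The pairing between chains and cochains: `⟨a₀ ⊗ ⋯ ⊗ aₙ, φ⟩ = φ(a₀, …, aₙ)`. -/
def hPair {n : ℕ} (z : HChain A n) (φ : HCochain A n) : ℂ := PiTensorProduct.lift φ z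

/-- `(a₀, …, aₙ₊₁) ↦ (a₀, …, a_j a_{j+1}, …, aₙ₊₁)` for `j ≤ n`. -/
def innerFace {n : ℕ} (j : Fin (n + 1)) (a : Fin (n + 2) → A) : Fin (n + 1) → A :=
  Fin.contractNth j.castSucc (· * ·) a

/-- `(a₀, …, aₙ₊₁) ↦ (aₙ₊₁ a₀, a₁, …, aₙ)`. -/
def lastFace {n : ℕ} (a : Fin (n + 2) → A) : Fin (n + 1) → A :=
  Function.update (fun i => a i.castSucc) 0 (a (Fin.last (n + 1)) * a 0)

lemma innerFace_update {n : ℕ} (j : Fin (n + 1)) (a : Fin (n + 2) → A) (i : Fin (n + 2)) :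
    ∃ (o : Fin (n + 1)) (L : A →ₗ[ℂ] A), ∀ x,
      innerFace j (Function.update a i x) = Function.update (innerFace j a) o (L x) := by
  have key (b : Fin (n + 2) → A) (k : Fin (n + 1)) : innerFace j b k =
      if (k : ℕ) < j then b k.castSucc else if (k : ℕ) = j then b k.castSucc * b k.succ
        else b k.succ := rfl
  rcases lt_trichotomy (i : ℕ) j with h | h | h
  · refine ⟨⟨i, by omega⟩, LinearMap.id, fun x => funext fun k => ?_⟩
    simp only [key, Function.update_apply, Fin.ext_iff, Fin.val_castSucc, Fin.val_succ,
      LinearMap.id_apply]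
    grind
  · refine ⟨⟨i, by omega⟩, LinearMap.mulRight ℂ (a j.succ), fun x => funext fun k => ?_⟩
    simp only [key, Function.update_apply, Fin.ext_iff, Fin.val_castSucc, Fin.val_succ,
      LinearMap.mulRight_apply]
    grind
  · by_cases h' : (i : ℕ) = j + 1
    · refine ⟨j, LinearMap.mulLeft ℂ (a j.castSucc), fun x => funext fun k => ?_⟩
      simp only [key, Function.update_apply, Fin.ext_iff, Fin.val_castSucc, Fin.val_succ,
        LinearMap.mulLeft_apply]
      grind
    · refine ⟨⟨i - 1, by omega⟩, LinearMap.id, fun x => funext fun k => ?_⟩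
      simp only [key, Function.update_apply, Fin.ext_iff, Fin.val_castSucc, Fin.val_succ,
        LinearMap.id_apply]
      grind

lemma lastFace_update {n : ℕ} (a : Fin (n + 2) → A) (i : Fin (n + 2)) :
    ∃ (o : Fin (n + 1)) (L : A →ₗ[ℂ] A), ∀ x,
      lastFace (Function.update a i x) = Function.update (lastFace a) o (L x) := by
  have key (b : Fin (n + 2) → A) (k : Fin (n + 1)) : lastFace b k =
      if (k : ℕ) = 0 then b (Fin.last (n + 1)) * b 0 else b k.castSucc := by
    simp only [lastFace, Function.update_apply, Fin.ext_iff, Fin.val_zero]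
  by_cases h : (i : ℕ) = n + 1
  · refine ⟨0, LinearMap.mulRight ℂ (a 0), fun x => funext fun k => ?_⟩
    simp only [key, Function.update_apply, Fin.ext_iff, Fin.val_castSucc, Fin.val_last,
      Fin.val_zero, LinearMap.mulRight_apply]
    grind
  · by_cases h' : (i : ℕ) = 0
    · refine ⟨0, LinearMap.mulLeft ℂ (a (Fin.last (n + 1))), fun x => funext fun k => ?_⟩
      simp only [key, Function.update_apply, Fin.ext_iff, Fin.val_castSucc, Fin.val_last,
        Fin.val_zero, LinearMap.mulLeft_apply]
      grind
    · refine ⟨⟨i, by omega⟩, LinearMap.id, fun x => funext fun k => ?_⟩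
      simp only [key, Function.update_apply, Fin.ext_iff, Fin.val_castSucc, Fin.val_last,
        Fin.val_zero, LinearMap.id_apply]
      grind

/-- The multilinear map `a ↦ face a 0 ⊗ ⋯ ⊗ face a n`. -/
def faceTensor {n : ℕ} (face : (Fin (n + 2) → A) → Fin (n + 1) → A)
    (h : ∀ a i, ∃ (o : Fin (n + 1)) (L : A →ₗ[ℂ] A), ∀ x,
      face (Function.update a i x) = Function.update (face a) o (L x)) :
    MultilinearMap ℂ (fun _ : Fin (n + 2) => A) (HChain A n) :=
  MultilinearMap.mk' (fun a => PiTensorProduct.tprod ℂ (face a))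
    (fun a i x y => by
      obtain ⟨o, L, hL⟩ := h a i
      simp only [hL, map_add, MultilinearMap.map_update_add])
    (fun a i k x => by
      obtain ⟨o, L, hL⟩ := h a i
      simp only [hL, map_smul, MultilinearMap.map_update_smul])

variable (A) in
/-- The Hochschild boundary on elementary tensors: `b(a₀ ⊗ ⋯ ⊗ aₙ₊₁)` equals
`∑_{j ≤ n} (-1)^j a₀ ⊗ ⋯ ⊗ a_j a_{j+1} ⊗ ⋯ ⊗ aₙ₊₁ + (-1)^{n+1} aₙ₊₁ a₀ ⊗ a₁ ⊗ ⋯ ⊗ aₙ`. -/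
def hBoundaryMul (n : ℕ) : MultilinearMap ℂ (fun _ : Fin (n + 2) => A) (HChain A n) :=
  ∑ j : Fin (n + 1), (-1 : ℂ) ^ (j : ℕ) • faceTensor (innerFace j) (innerFace_update j) +
    (-1 : ℂ) ^ (n + 1) • faceTensor lastFace lastFace_update

variable (A) in
/-- The Hochschild boundary `b : C_{n+1}(A) → C_n(A)`. -/
def hBoundary (n : ℕ) : HChain A (n + 1) →ₗ[ℂ] HChain A n :=
  PiTensorProduct.lift (hBoundaryMul A n)

variable (A) in
/-- The Hochschild coboundary `b : C^n(A) → C^{n+1}(A)`, `(b φ)(a₀, …, aₙ₊₁) = φ(b(a₀, …, aₙ₊₁))`. -/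
def hCoboundary (n : ℕ) : HCochain A n →ₗ[ℂ] HCochain A (n + 1) where
  toFun φ := (PiTensorProduct.lift φ).compMultilinearMap (hBoundaryMul A n)
  map_add' φ ψ := by ext a; simp
  map_smul' k φ := by ext a; simp

lemma hCoboundary_apply (n : ℕ) (φ : HCochain A n) (a : Fin (n + 2) → A) :
    hCoboundary A n φ a =
      ∑ j : Fin (n + 1), (-1 : ℂ) ^ (j : ℕ) * φ (Fin.contractNth j.castSucc (· * ·) a) +
        (-1 : ℂ) ^ (n + 1) *
          φ (Function.update (fun i => a i.castSucc) 0 (a (Fin.last (n + 1)) * a 0)) := by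
  simp [hCoboundary, hBoundaryMul, faceTensor, innerFace, lastFace]

variable (A) in
/-- The Hochschild cocycles of degree `n`. -/
def hCocycles (n : ℕ) : Submodule ℂ (HCochain A n) := LinearMap.ker (hCoboundary A n)

variable (A) in
/-- The Hochschild coboundaries of degree `n`. -/
def hCoboundaries : (n : ℕ) → Submodule ℂ (HCochain A n)
  | 0 => ⊥
  | n + 1 => LinearMap.range (hCoboundary A n)

variable (A) in
/-- The Hochschild cohomology `HH^n(A) = H^n(A, A^*)`. -/
abbrev HHCoh (n : ℕ) : Type _ :=
  hCocycles A n ⧸ (hCoboundaries A n).comap (hCocycles A n).subtype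

/-- The class of a cocycle in Hochschild cohomology. -/
def hhClass {n : ℕ} (φ : HCochain A n) (h : φ ∈ hCocycles A n) : HHCoh A n :=
  Submodule.Quotient.mk ⟨φ, h⟩

/-- A chain of positive degree is a Hochschild cycle if its boundary vanishes. -/
def IsHCycle {n : ℕ} (z : HChain A (n + 1)) : Prop := hBoundary A n z = 0

end hochschild

/-! ### The cocycles -/

variable (c μ ν) in
/-- The trace as a `0`-cochain on the smooth algebra. -/
def phi0 : HCochain (smoothQHM c μ ν) 0 := derForm c μ ν ![]

variable (c μ ν) in
/-- `φ_i(a₀, a₁) = τ(a₀ ∂_i(a₁))`. -/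
def phi1 (i : Fin 3) : HCochain (smoothQHM c μ ν) 1 := derForm c μ ν ![i]

variable (c μ ν) in
/-- `φ_{i,j}(a₀, a₁, a₂) = τ(a₀ (∂_i(a₁) ∂_j(a₂) - ∂_j(a₁) ∂_i(a₂)))`. -/
def phi2 (i j : Fin 3) : HCochain (smoothQHM c μ ν) 2 :=
  derForm c μ ν ![i, j] - derForm c μ ν ![j, i]

variable (c μ ν) in
/-- `φ_{1,2,3}(a₀, a₁, a₂, a₃) = ∑_σ ε(σ) τ(a₀ ∂_{σ 1}(a₁) ∂_{σ 2}(a₂) ∂_{σ 3}(a₃))`. -/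
def phi3 : HCochain (smoothQHM c μ ν) 3 :=
  ∑ σ : Equiv.Perm (Fin 3), ((Equiv.Perm.sign σ : ℤ) : ℂ) • derForm c μ ν σ

lemma phi0_apply (a : Fin 1 → smoothQHM c μ ν) : phi0 c μ ν a = trace c μ ν (a 0) := by
  simp [phi0, derForm]

lemma phi1_apply (i : Fin 3) (a : Fin 2 → smoothQHM c μ ν) :
    phi1 c μ ν i a = trace c μ ν (a 0 * deriv3 c μ ν i (a 1)) := by
  simp [phi1, derForm]

lemma phi2_apply (i j : Fin 3) (a : Fin 3 → smoothQHM c μ ν) :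
    phi2 c μ ν i j a = trace c μ ν (a 0 * (deriv3 c μ ν i (a 1) * deriv3 c μ ν j (a 2) -
      deriv3 c μ ν j (a 1) * deriv3 c μ ν i (a 2))) := by
  simp [phi2, derForm, List.ofFn_succ, mul_sub]

lemma phi3_apply (a : Fin 4 → smoothQHM c μ ν) :
    phi3 c μ ν a = ∑ σ : Equiv.Perm (Fin 3), ((Equiv.Perm.sign σ : ℤ) : ℂ) *
      trace c μ ν (a 0 * deriv3 c μ ν (σ 0) (a 1) * deriv3 c μ ν (σ 1) (a 2) *
        deriv3 c μ ν (σ 2) (a 3)) := by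
  simp [phi3, derForm, List.ofFn_succ, mul_assoc]

/-! ### The unitaries `U₁`, `U₂` and the frames of the bimodule -/

/-- The function `e(x)` for `j = 0` and `e(y)` for `j = 1`. -/
def unitaryFun (j : Fin 2) : C(ℝ × ℝ, ℂ) :=
  ⟨fun z => e (![z.1, z.2] j), by
    fin_cases j
    · exact continuous_e.comp continuous_fst
    · exact continuous_e.comp continuous_snd⟩

lemma unitaryFun_quasiPeriodic (j : Fin 2) : QuasiPeriodic c ν 0 (unitaryFun j) := fun x y => by
  fin_cases j <;> simp [unitaryFun, e_add, e_one, e_zero]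

variable (c μ ν) in
/-- The unitaries `U_1(p, x, y) = δ_{0,p} e(x)` and `U_2(p, x, y) = δ_{0,p} e(y)` (for `j = 0, 1`). -/
def unitaryPre (j : Fin 2) : preQHM c μ ν := homog μ 0 (unitaryFun j) (unitaryFun_quasiPeriodic j)

lemma actPre_unitaryPre (r s t : ℝ) (j : Fin 2) :
    actPre c μ ν r s t (unitaryPre c μ ν j) = e (-(![r, s] j)) • unitaryPre c μ ν j := by
  apply Subtype.ext
  change actConv c μ ν r s t (Conv.single 0 (unitaryFun j)) =
    e (-(![r, s] j)) • Conv.single 0 (unitaryFun j)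
  rw [actConv_single, Conv.smul_single]
  congr 1
  ext ⟨x, y⟩
  rw [twist_apply, ContinuousMap.smul_apply, smul_eq_mul]
  fin_cases j
  · simp [unitaryFun, e_zero, ← e_add, sub_eq_neg_add]
  · simp [unitaryFun, e_zero, ← e_add, sub_eq_neg_add]

lemma unitary_smooth (j : Fin 2) :
    ((unitaryPre c μ ν j : preQHM c μ ν) : QHMAlg c μ ν) ∈ smoothQHM c μ ν := by
  have h : (fun g : ℝ × ℝ × ℝ => act c μ ν g.1 g.2.1 g.2.2
      ((unitaryPre c μ ν j : preQHM c μ ν) : QHMAlg c μ ν)) = fun g =>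
      e (-(![g.1, g.2.1] j)) • ((unitaryPre c μ ν j : preQHM c μ ν) : QHMAlg c μ ν) := by
    funext g
    rw [act_coe, actPre_unitaryPre, Completion.coe_smul]
  change ContDiff ℝ ∞ _
  rw [h]
  have he : ContDiff ℝ ∞ e := by unfold e; exact (contDiff_const.mul Complex.ofRealCLM.contDiff).cexp
  refine ContDiff.smul (he.comp (ContDiff.neg ?_)) contDiff_const
  fin_cases j
  · exact contDiff_fst
  · exact contDiff_fst.comp contDiff_snd

variable (c μ ν) in
/-- `U_1` and `U_2` (for `j = 0, 1`) as elements of the smooth quantum Heisenberg manifold. -/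
def U (j : Fin 2) : smoothQHM c μ ν := ⟨(unitaryPre c μ ν j : preQHM c μ ν), unitary_smooth j⟩

/-- `a` is (the image of) an element of the Hilbert bimodule `M`, placed in degree one. -/
def InBimodule (a : smoothQHM c μ ν) : Prop :=
  ∃ (f : C(ℝ × ℝ, ℂ)) (hf : QuasiPeriodic c ν 1 f),
    (a : QHMAlg c μ ν) = ((homog μ 1 f hf : preQHM c μ ν) : QHMAlg c μ ν)

/-- A smooth frame of the bimodule `M`: two elements `ξ_1, ξ_2` of `M`, smooth for the action, with
`∑ ξ_p^* ξ_p = 1 = ∑ ξ_p ξ_p^*`. -/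
structure IsFrame (ξ : Fin 2 → smoothQHM c μ ν) : Prop where
  mem : ∀ p, InBimodule (ξ p)
  sum_star_mul : ∑ p, star (ξ p) * ξ p = 1
  sum_mul_star : ∑ p, ξ p * star (ξ p) = 1

/-- A pair of cut-off functions on the circle `ℝ/ℤ`: smooth, with `χ_1² + χ_2² = 1`, and with
`χ_1` supported in the image of `]-1/3, 1/3[`, `χ_2` in the image of `]1/6, 5/6[`. -/
structure IsCutoffPair (χ : Fin 2 → ℝ → ℝ) : Prop where
  smooth : ∀ p, ContDiff ℝ ∞ (χ p)
  periodic : ∀ p x, χ p (x + 1) = χ p x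
  sum_sq : ∀ x, χ 0 x ^ 2 + χ 1 x ^ 2 = 1
  zero_fst : ∀ x ∈ Set.Icc (1 / 3 : ℝ) (2 / 3), χ 0 x = 0
  zero_snd : ∀ x ∈ Set.Icc (-1 / 6 : ℝ) (1 / 6), χ 1 x = 0

/-- `ξ_1, ξ_2` are obtained from the translated cut-off functions `x ↦ χ_p(x - a)`: the element
`ξ_1` of `M` equals `χ_1(x - a)` for `x ∈ [a - 1/2, a + 1/2]` and `ξ_2` equals `χ_2(x - a)` for
`x ∈ [a, a + 1]`; the quasi-periodicity determines them elsewhere. -/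
def IsCutoffFrame (χ : Fin 2 → ℝ → ℝ) (a : ℝ) (ξ : Fin 2 → smoothQHM c μ ν) : Prop :=
  ∃ (f : Fin 2 → C(ℝ × ℝ, ℂ)) (hf : ∀ p, QuasiPeriodic c ν 1 (f p)),
    (∀ p, (ξ p : QHMAlg c μ ν) = ((homog μ 1 (f p) (hf p) : preQHM c μ ν) : QHMAlg c μ ν)) ∧
    (∀ x ∈ Set.Icc (a - 1 / 2) (a + 1 / 2), ∀ y, f 0 (x, y) = χ 0 (x - a)) ∧
    (∀ x ∈ Set.Icc a (a + 1), ∀ y, f 1 (x, y) = χ 1 (x - a))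

/-! ### The Hochschild cycles -/

/-- `U_{p,j}`: equal to `U_j` for `j = 1, 2` and to `ξ_p` for `j = 3`. -/
def UXi (ξ : Fin 2 → smoothQHM c μ ν) (p : Fin 2) (j : Fin 3) : smoothQHM c μ ν :=
  ![U c μ ν 0, U c μ ν 1, ξ p] j

/-- `c_1 = U_1^* ⊗ U_1`, `c_2 = U_2^* ⊗ U_2` and `c_3 = ∑_p ξ_p^* ⊗ ξ_p`. -/
def cyc1 (ξ : Fin 2 → smoothQHM c μ ν) (j : Fin 3) : HChain (smoothQHM c μ ν) 1 :=
  ![PiTensorProduct.tprod ℂ ![star (U c μ ν 0), U c μ ν 0],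
    PiTensorProduct.tprod ℂ ![star (U c μ ν 1), U c μ ν 1],
    ∑ p, PiTensorProduct.tprod ℂ ![star (ξ p), ξ p]] j

/-- `c_{j,3} = ∑_p (ξ_p^* U_j^* ⊗ U_j ⊗ ξ_p - U_j^* ξ_p^* ⊗ ξ_p ⊗ U_j)` for `j = 1, 2`. -/
def cyc2 (ξ : Fin 2 → smoothQHM c μ ν) (j : Fin 2) : HChain (smoothQHM c μ ν) 2 :=
  ∑ p, (PiTensorProduct.tprod ℂ ![star (ξ p) * star (U c μ ν j), U c μ ν j, ξ p] -
    PiTensorProduct.tprod ℂ ![star (U c μ ν j) * star (ξ p), ξ p, U c μ ν j])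

/-- `c_{1,2,3} = ∑_p ∑_σ ε(σ) U_{p,σ 3}^* U_{p,σ 2}^* U_{p,σ 1}^* ⊗ U_{p,σ 1} ⊗ U_{p,σ 2} ⊗ U_{p,σ 3}`. -/
def cyc3 (ξ : Fin 2 → smoothQHM c μ ν) : HChain (smoothQHM c μ ν) 3 :=
  ∑ p, ∑ σ : Equiv.Perm (Fin 3), ((Equiv.Perm.sign σ : ℤ) : ℂ) • PiTensorProduct.tprod ℂ
    ![star (UXi ξ p (σ 2)) * star (UXi ξ p (σ 1)) * star (UXi ξ p (σ 0)),
      UXi ξ p (σ 0), UXi ξ p (σ 1), UXi ξ p (σ 2)]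

end QHM

end

noncomputable section

open scoped ContDiff TensorProduct

namespace QHM

open UniformSpace

variable {c : ℕ} {μ ν : ℝ}

/-! ### The trace property -/

/-! Independence in cohomology is detected by pairing. A Hochschild cycle annihilates coboundaries,
so it defines a functional on cohomology. Once a family of cocycles and a family of cycles have a
diagonal pairing matrix with nonzero diagonal, the classes are independent
(`linearIndependent_hhClass`). In degree zero there are no coboundaries, and `τ(1) = 1` suffices.

The cochains are cocycles because `τ` is a trace and the `∂_i` satisfy the Leibniz rule: the faces
of `τ(a₀ ∂a₁ ⋯ ∂aₙ)` telescope, and the trace property absorbs the last one. No commutation relation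
between the `∂_i` is needed.

The chains are cycles because `U_1` and `U_2` are commuting unitaries, each `ξ_p` commutes with
`U_j` up to a phase, and `∑ ξ_p^* ξ_p = ∑ ξ_p ξ_p^* = 1`. Phases cancel between the starred slot and
the product slot of a tensor, and the remaining faces cancel after the sum over `p`
(`hBoundary_commutator`, `sum_hBoundary_antisymmetrized`).

The pairings come from eigenvalues: `∂_i U_j = -2πi δ_{ij} U_j`, `∂_3 U_j = 0` and `∂_3 ξ_p = 2πi
ξ_p`. In the antisymmetrised pairings of degrees two and three, any term with `∂_1 ξ_p` or `∂_2 ξ_p`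
also contains `∂_3 U_j = 0`. These values therefore do not depend on the frame. Only `⟨c_3, φ_1⟩`
and `⟨c_3, φ_2⟩` see the frame itself.

For a frame built from cut-off functions at `a`, the integrand of `⟨c_3, φ_1⟩` is the derivative of
a periodic function, so this pairing vanishes (`IsBump.trace_deriv_zero`). The pairing `⟨c_3, φ_2⟩`
is `-2πi c (a - μ + K)`, with `K` depending only on the cut-off functions
(`IsBump.trace_deriv_one`), so it vanishes at `a = μ - K`.

The analytic point is that such frames lie in the smooth subalgebra. The C*-norm of a homogeneous
element is at most its supremum norm, so the orbit map can be differentiated pointwise, with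
estimates uniform in the point (`hasFDerivAt_homogL_twistQP`). Its derivative is made of orbit maps
of the same kind, and induction gives `C^∞`. -/

/-- A function of degree zero is 1-periodic in both variables, so translating the unit window
changes neither the inner nor the outer integral. -/
lemma integral_shift {h : C(ℝ × ℝ, ℂ)} (hh : QuasiPeriodic c ν 0 h) (u v : ℝ) :
    ∫ x in (0 : ℝ)..1, ∫ y in (0 : ℝ)..1, h (x - u, y - v) =
      ∫ x in (0 : ℝ)..1, ∫ y in (0 : ℝ)..1, h (x, y) := by
  have h1 (x : ℝ) : ∫ y in (0 : ℝ)..1, h (x, y - v) = ∫ y in (0 : ℝ)..1, h (x, y) := by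
    have hp : Function.Periodic (fun y => h (x, y)) 1 := fun y => (hh x y).2
    rw [intervalIntegral.integral_comp_sub_right (fun y => h (x, y)) v]
    have := hp.intervalIntegral_add_eq (0 - v) 0
    rwa [show 0 - v + 1 = 1 - v by ring, zero_add] at this
  have hp : Function.Periodic (fun x => ∫ y in (0 : ℝ)..1, h (x, y)) 1 := fun x => by
    simp only [(hh x _).1, Int.cast_zero, mul_zero, zero_mul, neg_zero, e_zero, one_mul]
  simp only [h1]
  rw [intervalIntegral.integral_comp_sub_right (fun x => ∫ y in (0 : ℝ)..1, h (x, y)) u]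
  have := hp.intervalIntegral_add_eq (0 - u) 0
  rwa [show 0 - u + 1 = 1 - u by ring, zero_add] at this

lemma trace_homog_of_ne {p : ℤ} (hp : p ≠ 0) {f : C(ℝ × ℝ, ℂ)} (hf : QuasiPeriodic c ν p f) :
    trace c μ ν ((homog μ p f hf : preQHM c μ ν) : QHMAlg c μ ν) = 0 := by
  have h (z : ℝ × ℝ) : ((homog μ p f hf : preQHM c μ ν) : Conv μ ν) 0 z = 0 := by
    change (Conv.single p f : Conv μ ν) 0 z = 0
    rw [Conv.single_apply, if_neg hp]
    rfl
  rw [trace_coe]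
  simp [h]

lemma trace_homog_zero {f : C(ℝ × ℝ, ℂ)} (hf : QuasiPeriodic c ν 0 f) :
    trace c μ ν ((homog μ 0 f hf : preQHM c μ ν) : QHMAlg c μ ν) =
      ∫ x in (0 : ℝ)..1, ∫ y in (0 : ℝ)..1, f (x, y) := by
  have h (z : ℝ × ℝ) : ((homog μ 0 f hf : preQHM c μ ν) : Conv μ ν) 0 z = f z := by
    change (Conv.single 0 f : Conv μ ν) 0 z = f z
    rw [Conv.single_apply, if_pos rfl]
  rw [trace_coe]
  simp only [h]

lemma QuasiPeriodic.mul_shift {p q : ℤ} {f g : C(ℝ × ℝ, ℂ)} (hf : QuasiPeriodic c ν p f)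
    (hg : QuasiPeriodic c ν q g) : QuasiPeriodic c ν (p + q) (f * shift μ ν p g) := by
  have := (homog μ p f hf * homog μ q g hg).2 (p + q)
  change QuasiPeriodic c ν (p + q)
    ((Conv.single p f * Conv.single q g : Conv μ ν) (p + q)) at this
  rwa [Conv.single_mul_single, Conv.single_apply, if_pos rfl] at this

/-- Only opposite degrees `p` and `-p` contribute, and there the degree-zero part of `G * F` is a
translate of that of `F * G`, so translation invariance of the integral applies. -/
lemma trace_coe_mul_comm (F G : preQHM c μ ν) :
    trace c μ ν ((F * G : preQHM c μ ν) : QHMAlg c μ ν) =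
      trace c μ ν ((G * F : preQHM c μ ν) : QHMAlg c μ ν) := by
  induction F using homog_induction with
  | h0 => rw [zero_mul, mul_zero]
  | hadd F F' h h' => rw [add_mul, mul_add, Completion.coe_add, Completion.coe_add, map_add,
      map_add, h, h']
  | hs p f hf =>
  induction G using homog_induction with
  | h0 => rw [zero_mul, mul_zero]
  | hadd F F' h h' => rw [add_mul, mul_add, Completion.coe_add, Completion.coe_add, map_add,
      map_add, h, h']
  | hs q g hg =>
  rw [homog_mul_homog hf hg (hf.mul_shift hg), homog_mul_homog hg hf (hg.mul_shift hf)]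
  by_cases hpq : p + q = 0
  · obtain rfl : q = -p := by omega
    have h1 := hf.mul_shift (μ := μ) hg
    have h2 := hg.mul_shift (μ := μ) hf
    -- Stated for any `n` equal to 0, since the degrees `p + -p` and `-p + p` are not 0 by
    -- definition.
    have e1 : ∀ (n : ℤ) (k : C(ℝ × ℝ, ℂ)) (hk : QuasiPeriodic c ν n k), n = 0 →
        trace c μ ν ((homog μ n k hk : preQHM c μ ν) : QHMAlg c μ ν) =
          ∫ x in (0 : ℝ)..1, ∫ y in (0 : ℝ)..1, k (x, y) := by
      rintro n k hk rfl
      exact trace_homog_zero hk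
    rw [e1 _ _ _ (by omega), e1 _ _ _ (by omega)]
    rw [add_neg_cancel] at h1
    rw [← integral_shift h1 ((-p : ℤ) * (2 * μ)) ((-p : ℤ) * (2 * ν))]
    congr 1; ext x; congr 1; ext y
    simp only [ContinuousMap.mul_apply, shift_apply]
    rw [mul_comm]
    congr 2
    push_cast
    ring_nf
  · rw [trace_homog_of_ne hpq, trace_homog_of_ne (by omega)]

lemma trace_mul_comm (a b : QHMAlg c μ ν) : trace c μ ν (a * b) = trace c μ ν (b * a) := by
  induction a, b using Completion.induction_on₂ with
  | hp =>
    exact isClosed_eq ((trace c μ ν).continuous.comp continuous_mul)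
      ((trace c μ ν).continuous.comp (continuous_snd.mul continuous_fst))
  | ih F G => rw [← Completion.coe_mul, ← Completion.coe_mul, trace_coe_mul_comm]

lemma trace_one : trace c μ ν 1 = 1 := by
  have h1 : (1 : QHMAlg c μ ν) = ((homog μ 0 1 quasiPeriodic_one : preQHM c μ ν) : QHMAlg c μ ν) :=
    rfl
  rw [h1, trace_homog_zero]
  simp

/-! ### The derivations -/

lemma actPre_homog_zero {p : ℤ} {f : C(ℝ × ℝ, ℂ)} (hf : QuasiPeriodic c ν p f) :
    actPre c μ ν 0 0 0 (homog μ p f hf) = homog μ p f hf := by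
  apply Subtype.ext
  change actConv c μ ν 0 0 0 (Conv.single p f) = Conv.single p f
  rw [actConv_single]
  congr 1
  ext ⟨x, y⟩
  simp [twist_apply, e_zero]

lemma act_zero (a : QHMAlg c μ ν) : act c μ ν 0 0 0 a = a := by
  induction a using Completion.induction_on with
  | hp => exact isClosed_eq (continuous_mapAct 0 0 0) continuous_id
  | ih F =>
    rw [act_coe]
    congr 1
    induction F using homog_induction with
    | h0 => rw [map_zero]
    | hadd F F' h h' => rw [map_add, h, h']
    | hs p f hf => exact actPre_homog_zero hf

lemma actAxis_zero (i : Fin 3) (a : QHMAlg c μ ν) : actAxis c μ ν i 0 a = a := by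
  fin_cases i <;> exact act_zero a

lemma hasDerivAt_actAxis (i : Fin 3) (a : smoothQHM c μ ν) :
    HasDerivAt (fun u : ℝ => actAxis c μ ν i u (a : QHMAlg c μ ν)) (deriv3 c μ ν i a) 0 :=
  (differentiable_actAxis i a 0).hasDerivAt

/-- Leibniz rule: each `α_g` is multiplicative, so the orbit curve of `a * b` is a product of
curves, and both factors at time zero are the elements themselves. -/
lemma deriv3_mul (i : Fin 3) (a b : smoothQHM c μ ν) :
    deriv3 c μ ν i (a * b) = deriv3 c μ ν i a * b + a * deriv3 c μ ν i b := by
  have h := (hasDerivAt_actAxis i a).mul (hasDerivAt_actAxis i b)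
  have h' := hasDerivAt_actAxis i (a * b)
  have e1 : (fun u : ℝ => actAxis c μ ν i u ((a * b : smoothQHM c μ ν) : QHMAlg c μ ν)) =
      (fun u : ℝ => actAxis c μ ν i u (a : QHMAlg c μ ν)) *
        fun u : ℝ => actAxis c μ ν i u (b : QHMAlg c μ ν) := by
    ext u
    simp
  rw [e1] at h'
  rw [h'.unique h, actAxis_zero, actAxis_zero]

lemma hasDerivAt_e (x : ℝ) : HasDerivAt e (2 * Real.pi * Complex.I * e x) x := by
  have h := ((hasDerivAt_id x).ofReal_comp.const_mul (2 * Real.pi * Complex.I)).cexp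
  simp only [id, Complex.ofReal_one, mul_one] at h
  rw [mul_comm]
  exact h

lemma contDiff_e : ContDiff ℝ ∞ e := by
  unfold e
  exact (contDiff_const.mul Complex.ofRealCLM.contDiff).cexp

/-- Turns a character by which a one-parameter group acts on `a` into an eigenvalue of the
generator; this evaluates all derivatives of `U_j` and the central derivative of the frame. -/
lemma deriv3_of_eigen {i : Fin 3} {a : smoothQHM c μ ν} (k : ℝ)
    (h : ∀ u, actAxis c μ ν i u (a : QHMAlg c μ ν) = e (k * u) • (a : QHMAlg c μ ν)) :
    deriv3 c μ ν i a = (2 * Real.pi * Complex.I * k) • (a : QHMAlg c μ ν) := by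
  have h1 := hasDerivAt_actAxis i a
  simp only [h] at h1
  refine h1.unique ?_
  have h2 := ((hasDerivAt_e (k * 0)).scomp 0 ((hasDerivAt_id (0 : ℝ)).const_mul k)).smul_const
    (a : QHMAlg c μ ν)
  convert h2 using 2
  · rfl
  rw [mul_zero, e_zero, mul_one, mul_one, Complex.real_smul, mul_comm]

lemma deriv3_U (i : Fin 3) (j : Fin 2) : deriv3 c μ ν i (U c μ ν j) =
    (if i = j.castSucc then -(2 * Real.pi * Complex.I) else 0 : ℂ) • (U c μ ν j : QHMAlg c μ ν) := by
  have h := deriv3_of_eigen (i := i) (a := U c μ ν j) (if i = j.castSucc then -1 else 0) fun u => by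
    change act c μ ν (axis i u).1 (axis i u).2.1 (axis i u).2.2
      ((unitaryPre c μ ν j : preQHM c μ ν) : QHMAlg c μ ν) = _
    rw [act_coe, actPre_unitaryPre, Completion.coe_smul]
    change _ = _ • ((unitaryPre c μ ν j : preQHM c μ ν) : QHMAlg c μ ν)
    congr 2
    fin_cases i <;> fin_cases j <;> simp [axis]
  rw [h]
  congr 1
  split_ifs <;> simp

/-- The central coordinate `t` acts on degree `p` by the scalar `e(pt)`, and here `p = 1`. -/
lemma deriv3_inBimodule {a : smoothQHM c μ ν} (ha : InBimodule a) :
    deriv3 c μ ν 2 a = (2 * Real.pi * Complex.I) • (a : QHMAlg c μ ν) := by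
  obtain ⟨f, hf, hfa⟩ := ha
  have h := deriv3_of_eigen (i := 2) (a := a) 1 fun u => by
    rw [hfa]
    change act c μ ν 0 0 u _ = _
    rw [act_coe, ← Completion.coe_smul]
    congr 1
    apply Subtype.ext
    change actConv c μ ν 0 0 u (Conv.single 1 f) = _ • Conv.single 1 f
    rw [actConv_single, Conv.smul_single]
    congr 1
    ext ⟨x, y⟩
    simp [twist_apply]
  rw [h]
  simp

/-! ### Relations between the unitaries and the bimodule -/

lemma coe_U (j : Fin 2) : (U c μ ν j : QHMAlg c μ ν) =
    ((homog μ 0 (unitaryFun j) (unitaryFun_quasiPeriodic j) : preQHM c μ ν) : QHMAlg c μ ν) := rfl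

lemma star_unitaryFun_mul (j : Fin 2) : star (unitaryFun j) * unitaryFun j = 1 := by
  ext z
  change star (e _) * e _ = 1
  rw [star_e, e_neg_mul]

lemma star_U_mul (j : Fin 2) : star (U c μ ν j) * U c μ ν j = 1 := by
  apply Subtype.ext
  change star ((homog μ 0 (unitaryFun j) (unitaryFun_quasiPeriodic j) : preQHM c μ ν) :
    QHMAlg c μ ν) * ((homog μ 0 (unitaryFun j) (unitaryFun_quasiPeriodic j) : preQHM c μ ν) :
    QHMAlg c μ ν) = ((1 : preQHM c μ ν) : QHMAlg c μ ν)
  rw [star_coe, ← Completion.coe_mul]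
  congr 1
  apply Subtype.ext
  change star (Conv.single 0 (unitaryFun j) : Conv μ ν) * Conv.single 0 (unitaryFun j) =
    Conv.single 0 1
  rw [Conv.star_single, Conv.single_mul_single, neg_zero, add_zero, shift_zero, shift_zero,
    star_unitaryFun_mul]

lemma U_mul_star (j : Fin 2) : U c μ ν j * star (U c μ ν j) = 1 := by
  apply Subtype.ext
  change ((homog μ 0 (unitaryFun j) (unitaryFun_quasiPeriodic j) : preQHM c μ ν) :
    QHMAlg c μ ν) * star ((homog μ 0 (unitaryFun j) (unitaryFun_quasiPeriodic j) : preQHM c μ ν) :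
    QHMAlg c μ ν) = ((1 : preQHM c μ ν) : QHMAlg c μ ν)
  rw [star_coe, ← Completion.coe_mul]
  congr 1
  apply Subtype.ext
  change (Conv.single 0 (unitaryFun j) : Conv μ ν) * star (Conv.single 0 (unitaryFun j)) =
    Conv.single 0 1
  rw [Conv.star_single, Conv.single_mul_single, neg_zero, add_zero, shift_zero, shift_zero,
    mul_comm, star_unitaryFun_mul]

lemma U_mul_comm (i j : Fin 2) : U c μ ν i * U c μ ν j = U c μ ν j * U c μ ν i := by
  apply Subtype.ext
  change ((homog μ 0 (unitaryFun i) (unitaryFun_quasiPeriodic i) : preQHM c μ ν) :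
    QHMAlg c μ ν) * ((homog μ 0 (unitaryFun j) (unitaryFun_quasiPeriodic j) : preQHM c μ ν) :
    QHMAlg c μ ν) = ((homog μ 0 (unitaryFun j) (unitaryFun_quasiPeriodic j) : preQHM c μ ν) :
    QHMAlg c μ ν) * ((homog μ 0 (unitaryFun i) (unitaryFun_quasiPeriodic i) : preQHM c μ ν) :
    QHMAlg c μ ν)
  rw [← Completion.coe_mul, ← Completion.coe_mul]
  congr 1
  apply Subtype.ext
  change (Conv.single 0 (unitaryFun i) : Conv μ ν) * Conv.single 0 (unitaryFun j) =
    Conv.single 0 (unitaryFun j) * Conv.single 0 (unitaryFun i)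
  rw [Conv.single_mul_single, Conv.single_mul_single, shift_zero, shift_zero, mul_comm]

/-- Moving a degree-one element past a function translates the function by `2(μ, ν)`, and a
translate of an exponential is a multiple of it. -/
lemma inBimodule_mul_U {a : smoothQHM c μ ν} (ha : InBimodule a) (j : Fin 2) :
    a * U c μ ν j = e (-(2 * ![μ, ν] j)) • (U c μ ν j * a) := by
  obtain ⟨f, hf, hfa⟩ := ha
  apply Subtype.ext
  change (a : QHMAlg c μ ν) * (U c μ ν j : QHMAlg c μ ν) =
    _ • ((U c μ ν j : QHMAlg c μ ν) * (a : QHMAlg c μ ν))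
  rw [hfa, coe_U, ← Completion.coe_mul, ← Completion.coe_mul, ← Completion.coe_smul]
  congr 1
  apply Subtype.ext
  change (Conv.single 1 f : Conv μ ν) * Conv.single 0 (unitaryFun j) =
    _ • ((Conv.single 0 (unitaryFun j) : Conv μ ν) * Conv.single 1 f)
  rw [Conv.single_mul_single, Conv.single_mul_single, Conv.smul_single, shift_zero, add_zero,
    zero_add]
  congr 1
  ext ⟨x, y⟩
  simp only [ContinuousMap.mul_apply, shift_apply, ContinuousMap.smul_apply, smul_eq_mul]
  fin_cases j
  · simp [unitaryFun, sub_eq_neg_add, e_add]; ring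
  · simp [unitaryFun, sub_eq_neg_add, e_add]; ring

/-! ### Low degree Hochschild boundaries -/

section hochschild

variable {A : Type*} [Ring A] [Algebra ℂ A]

lemma hBoundary_tprod (n : ℕ) (a : Fin (n + 2) → A) : hBoundary A n (PiTensorProduct.tprod ℂ a) =
    ∑ j : Fin (n + 1), (-1 : ℂ) ^ (j : ℕ) • PiTensorProduct.tprod ℂ (innerFace j a) +
      (-1 : ℂ) ^ (n + 1) • PiTensorProduct.tprod ℂ (lastFace a) := by
  simp [hBoundary, hBoundaryMul, faceTensor]

lemma hBoundary_tprod_two (a : Fin 2 → A) : hBoundary A 0 (PiTensorProduct.tprod ℂ a) =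
    PiTensorProduct.tprod ℂ ![a 0 * a 1] -
      PiTensorProduct.tprod ℂ ![a 1 * a 0] := by
  have h0 : innerFace (n := 0) 0 a = ![a 0 * a 1] := by ext k; fin_cases k <;> rfl
  have h1 : lastFace (n := 0) a = ![a 1 * a 0] := by ext k; fin_cases k <;> rfl
  rw [hBoundary_tprod, h1]
  refine (congrArg (· + _) (Fin.sum_univ_one _)).trans ?_
  change (-1 : ℂ) ^ 0 • PiTensorProduct.tprod ℂ (innerFace (n := 0) 0 a) + _ = _
  simp only [h0]
  norm_num [sub_eq_add_neg, pow_succ]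

lemma hBoundary_tprod_three (a : Fin 3 → A) : hBoundary A 1 (PiTensorProduct.tprod ℂ a) =
    PiTensorProduct.tprod ℂ ![a 0 * a 1, a 2] -
      PiTensorProduct.tprod ℂ ![a 0, a 1 * a 2] +
      PiTensorProduct.tprod ℂ ![a 2 * a 0, a 1] := by
  have h0 : innerFace (n := 1) 0 a = ![a 0 * a 1, a 2] := by ext k; fin_cases k <;> rfl
  have h1 : innerFace (n := 1) 1 a = ![a 0, a 1 * a 2] := by ext k; fin_cases k <;> rfl
  have h2 : lastFace (n := 1) a = ![a 2 * a 0, a 1] := by ext k; fin_cases k <;> rfl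
  rw [hBoundary_tprod, h2]
  refine (congrArg (· + _) (Fin.sum_univ_two _)).trans ?_
  change (-1 : ℂ) ^ 0 • PiTensorProduct.tprod ℂ (innerFace (n := 1) 0 a) +
    (-1 : ℂ) ^ 1 • PiTensorProduct.tprod ℂ (innerFace (n := 1) 1 a) + _ = _
  simp only [h0, h1]
  norm_num [sub_eq_add_neg, pow_succ]

lemma hBoundary_tprod_four (a : Fin 4 → A) : hBoundary A 2 (PiTensorProduct.tprod ℂ a) =
    PiTensorProduct.tprod ℂ ![a 0 * a 1, a 2, a 3] -
      PiTensorProduct.tprod ℂ ![a 0, a 1 * a 2, a 3] +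
      PiTensorProduct.tprod ℂ ![a 0, a 1, a 2 * a 3] -
      PiTensorProduct.tprod ℂ ![a 3 * a 0, a 1, a 2] := by
  have h0 : innerFace (n := 2) 0 a = ![a 0 * a 1, a 2, a 3] := by ext k; fin_cases k <;> rfl
  have h1 : innerFace (n := 2) 1 a = ![a 0, a 1 * a 2, a 3] := by ext k; fin_cases k <;> rfl
  have h2 : innerFace (n := 2) 2 a = ![a 0, a 1, a 2 * a 3] := by ext k; fin_cases k <;> rfl
  have h3 : lastFace (n := 2) a = ![a 3 * a 0, a 1, a 2] := by ext k; fin_cases k <;> rfl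
  rw [hBoundary_tprod, h3]
  refine (congrArg (· + _) (Fin.sum_univ_three _)).trans ?_
  change (-1 : ℂ) ^ 0 • PiTensorProduct.tprod ℂ (innerFace (n := 2) 0 a) +
    (-1 : ℂ) ^ 1 • PiTensorProduct.tprod ℂ (innerFace (n := 2) 1 a) +
    (-1 : ℂ) ^ 2 • PiTensorProduct.tprod ℂ (innerFace (n := 2) 2 a) + _ = _
  simp only [h0, h1, h2]
  norm_num [sub_eq_add_neg, pow_succ]

lemma hBoundary_tprod_five (a : Fin 5 → A) : hBoundary A 3 (PiTensorProduct.tprod ℂ a) =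
    PiTensorProduct.tprod ℂ ![a 0 * a 1, a 2, a 3, a 4] -
      PiTensorProduct.tprod ℂ ![a 0, a 1 * a 2, a 3, a 4] +
      PiTensorProduct.tprod ℂ ![a 0, a 1, a 2 * a 3, a 4] -
      PiTensorProduct.tprod ℂ ![a 0, a 1, a 2, a 3 * a 4] +
      PiTensorProduct.tprod ℂ ![a 4 * a 0, a 1, a 2, a 3] := by
  have h0 : innerFace (n := 3) 0 a = ![a 0 * a 1, a 2, a 3, a 4] := by ext k; fin_cases k <;> rfl
  have h1 : innerFace (n := 3) 1 a = ![a 0, a 1 * a 2, a 3, a 4] := by ext k; fin_cases k <;> rfl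
  have h2 : innerFace (n := 3) 2 a = ![a 0, a 1, a 2 * a 3, a 4] := by ext k; fin_cases k <;> rfl
  have h3 : innerFace (n := 3) 3 a = ![a 0, a 1, a 2, a 3 * a 4] := by ext k; fin_cases k <;> rfl
  have h4 : lastFace (n := 3) a = ![a 4 * a 0, a 1, a 2, a 3] := by ext k; fin_cases k <;> rfl
  rw [hBoundary_tprod, h4]
  refine (congrArg (· + _) (Fin.sum_univ_four _)).trans ?_
  change (-1 : ℂ) ^ 0 • PiTensorProduct.tprod ℂ (innerFace (n := 3) 0 a) +
    (-1 : ℂ) ^ 1 • PiTensorProduct.tprod ℂ (innerFace (n := 3) 1 a) +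
    (-1 : ℂ) ^ 2 • PiTensorProduct.tprod ℂ (innerFace (n := 3) 2 a) +
    (-1 : ℂ) ^ 3 • PiTensorProduct.tprod ℂ (innerFace (n := 3) 3 a) + _ = _
  simp only [h0, h1, h2, h3]
  norm_num [sub_eq_add_neg, pow_succ]

/-! ### Pairing cycles with cohomology classes -/

lemma hCoboundary_eq_hPair (n : ℕ) (φ : HCochain A n) (a : Fin (n + 2) → A) :
    hCoboundary A n φ a = hPair (hBoundary A n (PiTensorProduct.tprod ℂ a)) φ := by
  simp [hCoboundary, hPair, hBoundary]

lemma hPair_hCoboundary {n : ℕ} (z : HChain A (n + 1)) (φ : HCochain A n) :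
    hPair z (hCoboundary A n φ) = hPair (hBoundary A n z) φ := by
  have h : PiTensorProduct.lift (hCoboundary A n φ) =
      (PiTensorProduct.lift φ).comp (hBoundary A n) := by
    ext a
    simp [hCoboundary_eq_hPair, hPair]
  exact LinearMap.congr_fun h z

lemma hPair_tprod {n : ℕ} (a : Fin (n + 1) → A) (φ : HCochain A n) :
    hPair (PiTensorProduct.tprod ℂ a) φ = φ a := PiTensorProduct.lift.tprod a

lemma hPair_add {n : ℕ} (z w : HChain A n) (φ : HCochain A n) :
    hPair (z + w) φ = hPair z φ + hPair w φ := map_add _ _ _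

lemma hPair_sub {n : ℕ} (z w : HChain A n) (φ : HCochain A n) :
    hPair (z - w) φ = hPair z φ - hPair w φ := map_sub _ _ _

lemma hPair_sum {n : ℕ} {ι : Type*} (s : Finset ι) (z : ι → HChain A n) (φ : HCochain A n) :
    hPair (∑ i ∈ s, z i) φ = ∑ i ∈ s, hPair (z i) φ := map_sum _ _ _

variable (A) in
/-- The pairing of a chain with cochains, as a linear functional. -/
def hPairLin {n : ℕ} (z : HChain A n) : HCochain A n →ₗ[ℂ] ℂ where
  toFun φ := hPair z φ
  map_add' φ ψ := by simp [hPair]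
  map_smul' k φ := by simp [hPair]

lemma hPair_eq_zero_of_mem_hCoboundaries {n : ℕ} {z : HChain A (n + 1)} (hz : IsHCycle z)
    {φ : HCochain A (n + 1)} (hφ : φ ∈ hCoboundaries A (n + 1)) : hPair z φ = 0 := by
  obtain ⟨ψ, rfl⟩ := hφ
  rw [hPair_hCoboundary, hz]
  exact map_zero _

/-- The pairing with a cycle descends to Hochschild cohomology. -/
def hPairCoh {n : ℕ} (z : HChain A (n + 1)) (hz : IsHCycle z) : HHCoh A (n + 1) →ₗ[ℂ] ℂ :=
  Submodule.liftQ _ ((hPairLin A z).comp (hCocycles A (n + 1)).subtype)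
    fun _ hφ => hPair_eq_zero_of_mem_hCoboundaries hz hφ

lemma hPairCoh_hhClass {n : ℕ} (z : HChain A (n + 1)) (hz : IsHCycle z) (φ : HCochain A (n + 1))
    (h : φ ∈ hCocycles A (n + 1)) : hPairCoh z hz (hhClass φ h) = hPair z φ := rfl

/-- Evaluating the functional of the cycle `z j` on a linear relation isolates the coefficient of
index `j`, multiplied by the nonzero `k j`. -/
lemma linearIndependent_hhClass {n : ℕ} {ι : Type*} [Fintype ι] [DecidableEq ι]
    (z : ι → HChain A (n + 1)) (hz : ∀ j, IsHCycle (z j)) (φ : ι → HCochain A (n + 1))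
    (h : ∀ i, φ i ∈ hCocycles A (n + 1)) (k : ι → ℂ) (hk : ∀ i, k i ≠ 0)
    (hp : ∀ j i, hPair (z j) (φ i) = if j = i then k i else 0) :
    LinearIndependent ℂ fun i => hhClass (φ i) (h i) := by
  rw [Fintype.linearIndependent_iff]
  intro g hg j
  have := congrArg (hPairCoh (z j) (hz j)) hg
  simp only [map_sum, map_smul, hPairCoh_hhClass, hp, map_zero, smul_eq_mul, mul_ite, mul_zero,
    Finset.sum_ite_eq, Finset.mem_univ, if_true] at this
  exact (mul_eq_zero.1 this).resolve_right (hk j)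

end hochschild

/-! ### The cocycles -/

lemma derForm_one_apply (I : Fin 1 → Fin 3) (a : Fin 2 → smoothQHM c μ ν) :
    derForm c μ ν I a = trace c μ ν (a 0 * deriv3 c μ ν (I 0) (a 1)) := by
  simp [derForm]

lemma derForm_two_apply (I : Fin 2 → Fin 3) (a : Fin 3 → smoothQHM c μ ν) :
    derForm c μ ν I a =
      trace c μ ν (a 0 * deriv3 c μ ν (I 0) (a 1) * deriv3 c μ ν (I 1) (a 2)) := by
  simp [derForm, List.ofFn_succ, mul_assoc]

lemma derForm_three_apply (I : Fin 3 → Fin 3) (a : Fin 4 → smoothQHM c μ ν) :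
    derForm c μ ν I a = trace c μ ν (a 0 * deriv3 c μ ν (I 0) (a 1) * deriv3 c μ ν (I 1) (a 2) *
      deriv3 c μ ν (I 2) (a 3)) := by
  simp [derForm, List.ofFn_succ, mul_assoc]

lemma phi0_mem_hCocycles : phi0 c μ ν ∈ hCocycles (smoothQHM c μ ν) 0 := by
  refine LinearMap.mem_ker.2 (MultilinearMap.ext fun a => ?_)
  rw [hCoboundary_eq_hPair, hBoundary_tprod_two, hPair_sub, hPair_tprod, hPair_tprod, phi0_apply,
    phi0_apply]
  simp [trace_mul_comm (a 0 : QHMAlg c μ ν)]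

/-- By Leibniz, the middle face is the sum of the first face and `τ(a₀ ∂(a₁) a₂)`; the last face
equals the latter by the trace property. The same telescoping works in degrees two and three. -/
lemma derForm_one_mem_hCocycles (I : Fin 1 → Fin 3) :
    derForm c μ ν I ∈ hCocycles (smoothQHM c μ ν) 1 := by
  refine LinearMap.mem_ker.2 (MultilinearMap.ext fun a => ?_)
  have h := trace_mul_comm (a 2 : QHMAlg c μ ν) (a 0 * deriv3 c μ ν (I 0) (a 1))
  rw [hCoboundary_eq_hPair, hBoundary_tprod_three]
  -- The trace identity is normalised together with the goal, so that both contain the same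
  -- right-associated words and `h` can rewrite.
  simp [hPair_add, hPair_sub, hPair_tprod, derForm_one_apply, deriv3_mul, mul_add, mul_assoc] at h ⊢
  rw [h]
  ring

lemma derForm_two_mem_hCocycles (I : Fin 2 → Fin 3) :
    derForm c μ ν I ∈ hCocycles (smoothQHM c μ ν) 2 := by
  refine LinearMap.mem_ker.2 (MultilinearMap.ext fun a => ?_)
  have h := trace_mul_comm (a 3 : QHMAlg c μ ν)
    (a 0 * deriv3 c μ ν (I 0) (a 1) * deriv3 c μ ν (I 1) (a 2))
  rw [hCoboundary_eq_hPair, hBoundary_tprod_four]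
  simp [hPair_add, hPair_sub, hPair_tprod, derForm_two_apply, deriv3_mul, mul_add, add_mul,
    mul_assoc] at h ⊢
  rw [h]
  ring

lemma derForm_three_mem_hCocycles (I : Fin 3 → Fin 3) :
    derForm c μ ν I ∈ hCocycles (smoothQHM c μ ν) 3 := by
  refine LinearMap.mem_ker.2 (MultilinearMap.ext fun a => ?_)
  have h := trace_mul_comm (a 4 : QHMAlg c μ ν)
    (a 0 * deriv3 c μ ν (I 0) (a 1) * deriv3 c μ ν (I 1) (a 2) * deriv3 c μ ν (I 2) (a 3))
  rw [hCoboundary_eq_hPair, hBoundary_tprod_five]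
  simp [hPair_add, hPair_sub, hPair_tprod, derForm_three_apply, deriv3_mul, mul_add, add_mul,
    mul_assoc] at h ⊢
  rw [h]
  ring

lemma phi1_mem_hCocycles (i : Fin 3) : phi1 c μ ν i ∈ hCocycles (smoothQHM c μ ν) 1 :=
  derForm_one_mem_hCocycles _

lemma phi2_mem_hCocycles (i j : Fin 3) : phi2 c μ ν i j ∈ hCocycles (smoothQHM c μ ν) 2 :=
  sub_mem (derForm_two_mem_hCocycles _) (derForm_two_mem_hCocycles _)

lemma phi3_mem_hCocycles : phi3 c μ ν ∈ hCocycles (smoothQHM c μ ν) 3 :=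
  sum_mem fun _ _ => Submodule.smul_mem _ _ (derForm_three_mem_hCocycles _)

lemma phi0_ne_zero : phi0 c μ ν ≠ 0 := fun h => by
  have h1 := phi0_apply (c := c) (μ := μ) (ν := ν) ![1]
  rw [h] at h1
  simp [trace_one] at h1

lemma hhClass_phi0_ne_zero : hhClass (phi0 c μ ν) phi0_mem_hCocycles ≠ 0 := fun h => by
  have h1 := (Submodule.Quotient.mk_eq_zero _).1 h
  exact phi0_ne_zero ((Submodule.mem_bot ℂ).1 h1)

/-! ### The Hochschild cycles -/

/-- Used both for the cycle `c_{1,2,3}` and for the cocycle `φ_{1,2,3}`, so the values may lie in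
any complex vector space. -/
lemma sum_perm_three {M : Type*} [AddCommGroup M] [Module ℂ M] (f : Fin 3 → Fin 3 → Fin 3 → M) :
    ∑ σ : Equiv.Perm (Fin 3), ((Equiv.Perm.sign σ : ℤ) : ℂ) • f (σ 0) (σ 1) (σ 2) =
      f 0 1 2 - f 1 0 2 - f 2 1 0 - f 0 2 1 + f 1 2 0 + f 2 0 1 := by
  have h : (Finset.univ : Finset (Equiv.Perm (Fin 3))) =
      {1, Equiv.swap 0 1, Equiv.swap 0 2, Equiv.swap 1 2, Equiv.swap 0 1 * Equiv.swap 1 2,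
        Equiv.swap 1 2 * Equiv.swap 0 1} := by decide
  rw [h, Finset.sum_insert (by decide), Finset.sum_insert (by decide),
    Finset.sum_insert (by decide), Finset.sum_insert (by decide), Finset.sum_insert (by decide),
    Finset.sum_singleton]
  have s1 : Equiv.Perm.sign (Equiv.swap (0 : Fin 3) 1) = -1 := by decide
  have s2 : Equiv.Perm.sign (Equiv.swap (0 : Fin 3) 2) = -1 := by decide
  have s3 : Equiv.Perm.sign (Equiv.swap (1 : Fin 3) 2) = -1 := by decide
  have v1 : Equiv.swap (0 : Fin 3) 1 2 = 2 := by decide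
  have v2 : Equiv.swap (0 : Fin 3) 2 1 = 1 := by decide
  have v3 : Equiv.swap (1 : Fin 3) 2 0 = 0 := by decide
  simp only [map_mul, s1, s2, s3, Equiv.Perm.mul_apply, v1, v2, v3, Equiv.swap_apply_left,
    Equiv.swap_apply_right, Equiv.Perm.one_apply, map_one]
  simp [sub_eq_add_neg, add_assoc]

/-! ### Boundaries of tensors of elements that commute up to a phase -/

section cycles

variable {A : Type*} [Ring A] [Algebra ℂ A]

lemma tprod_cons_add {n : ℕ} (x y : A) (m : Fin n → A) :
    PiTensorProduct.tprod ℂ (Matrix.vecCons (x + y) m : Fin (n + 1) → A) =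
      PiTensorProduct.tprod ℂ (Matrix.vecCons x m : Fin (n + 1) → A) +
        PiTensorProduct.tprod ℂ (Matrix.vecCons y m : Fin (n + 1) → A) :=
  MultilinearMap.cons_add (PiTensorProduct.tprod ℂ (s := fun _ : Fin (n + 1) => A)) m x y

lemma tprod_smul_smul {n : ℕ} (a b : Fin (n + 2) → A) (i : Fin (n + 1)) {k l : ℂ} (hkl : k * l = 1)
    (h0 : b 0 = k • a 0) (hi : b i.succ = l • a i.succ)
    (h : ∀ j : Fin (n + 1), j ≠ i → b j.succ = a j.succ) :
    (PiTensorProduct.tprod ℂ b : HChain A (n + 1)) = PiTensorProduct.tprod ℂ a := by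
  have hb : b = fun j => (Fin.cons k (Function.update (fun _ => 1) i l) : Fin (n + 2) → ℂ) j • a j := by
    ext j
    refine Fin.cases ?_ (fun j => ?_) j
    · simpa using h0
    · by_cases hj : j = i
      · subst hj; simpa using hi
      · simp [hj, h j hj]
  rw [hb, MultilinearMap.map_smul_univ, Fin.prod_univ_succ]
  simp [Finset.prod_update_of_mem, hkl]

/-- Two elements commute up to a phase. -/
def PhaseCommute (u v : A) : Prop := ∃ k : ℂ, star k * k = 1 ∧ u * v = k • (v * u)

lemma PhaseCommute.symm {u v : A} (h : PhaseCommute u v) : PhaseCommute v u := by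
  obtain ⟨k, hk, h⟩ := h
  refine ⟨star k, by rw [star_star, mul_comm, hk], ?_⟩
  rw [h, smul_smul, hk, one_smul]

variable [StarRing A]

/-- The tensor `d^* b^* a^* ⊗ a ⊗ b ⊗ d`. -/
def starTensor (a b d : A) : HChain A 3 :=
  PiTensorProduct.tprod ℂ ![star d * star b * star a, a, b, d]

lemma sum_sign_smul_tprod {ι : Type*} [Fintype ι] (V : ι → Fin 3 → A) :
    ∑ p, ∑ σ : Equiv.Perm (Fin 3), ((Equiv.Perm.sign σ : ℤ) : ℂ) • PiTensorProduct.tprod ℂ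
      ![star (V p (σ 2)) * star (V p (σ 1)) * star (V p (σ 0)),
        V p (σ 0), V p (σ 1), V p (σ 2)] =
    ∑ p, (starTensor (V p 0) (V p 1) (V p 2) - starTensor (V p 1) (V p 0) (V p 2) - starTensor (V p 2) (V p 1) (V p 0) -
      starTensor (V p 0) (V p 2) (V p 1) + starTensor (V p 1) (V p 2) (V p 0) + starTensor (V p 2) (V p 0) (V p 1)) := by
  refine Finset.sum_congr rfl fun p _ => ?_
  exact sum_perm_three fun i j k => starTensor (V p i) (V p j) (V p k)

variable [StarModule ℂ A]

lemma PhaseCommute.star_mul_star {u v : A} {k : ℂ} (h : u * v = k • (v * u)) :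
    star v * star u = star k • (star u * star v) := by
  rw [← star_mul, h, star_smul, star_mul]

/-- Exchanging `u` and `v` multiplies the product slot by `k` and the starred slot by `star k`; the
two scalars cancel. The two lemmas below are the analogues for the inner faces of a 3-chain. -/
lemma PhaseCommute.tprod_two {u v : A} (h : PhaseCommute u v) :
    (PiTensorProduct.tprod ℂ ![star v * star u, u * v] : HChain A 1) =
      PiTensorProduct.tprod ℂ ![star u * star v, v * u] := by
  obtain ⟨k, hk, h⟩ := h
  refine tprod_smul_smul _ _ 0 hk (star_mul_star h) h fun j hj => ?_
  exact absurd (Fin.ext (by omega)) hj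

lemma PhaseCommute.tprod_three_left {u v : A} (h : PhaseCommute u v) (w : A) :
    (PiTensorProduct.tprod ℂ ![star w * star v * star u, u * v, w] : HChain A 2) =
      PiTensorProduct.tprod ℂ ![star w * star u * star v, v * u, w] := by
  obtain ⟨k, hk, h⟩ := h
  refine tprod_smul_smul _ _ 0 hk ?_ h fun j hj => ?_
  · change star w * star v * star u = star k • (star w * star u * star v)
    rw [mul_assoc, star_mul_star h, mul_smul_comm, mul_assoc]
  · fin_cases j
    · exact absurd rfl hj
    · rfl

lemma PhaseCommute.tprod_three_right {v w : A} (h : PhaseCommute v w) (u : A) :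
    (PiTensorProduct.tprod ℂ ![star w * star v * star u, u, v * w] : HChain A 2) =
      PiTensorProduct.tprod ℂ ![star v * star w * star u, u, w * v] := by
  obtain ⟨k, hk, h⟩ := h
  refine tprod_smul_smul _ _ 1 hk ?_ h fun j hj => ?_
  · change star w * star v * star u = star k • (star v * star w * star u)
    rw [star_mul_star h, smul_mul_assoc]
  · fin_cases j
    · rfl
    · exact absurd rfl hj

/-- The inner faces cancel by phase commutation, and the faces containing `u^* u` and `u u^*` cancel
exactly. What is left is `w w^* u^* ⊗ u - u^* w^* w ⊗ u`, which vanishes only after summation over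
`p`: the single `w p` need not be unitary. -/
lemma hBoundary_commutator {ι : Type*} [Fintype ι] {u : A} {w : ι → A} (hu : star u * u = 1)
    (hu' : u * star u = 1) (hwu : ∀ p, PhaseCommute (w p) u) (hw : ∑ p, star (w p) * w p = 1)
    (hw' : ∑ p, w p * star (w p) = 1) :
    hBoundary A 1 (∑ p, (PiTensorProduct.tprod ℂ ![star (w p) * star u, u, w p] -
        PiTensorProduct.tprod ℂ ![star u * star (w p), w p, u])) = 0 := by
  -- The tensor as a linear map of its first slot, which lets the sum over `p` pass inside.
  let S (x : A) : A →ₗ[ℂ] HChain A 1 :=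
    (PiTensorProduct.tprod ℂ (s := fun _ : Fin 2 => A)).toLinearMap ![0, x] 0
  have hS (a x : A) : PiTensorProduct.tprod ℂ ![a, x] = S x a := by
    simp only [S, MultilinearMap.toLinearMap_apply]
    congr 1
    ext k
    fin_cases k <;> simp
  have h (p : ι) : hBoundary A 1 (PiTensorProduct.tprod ℂ ![star (w p) * star u, u, w p] -
        PiTensorProduct.tprod ℂ ![star u * star (w p), w p, u]) =
      S u (w p * star (w p) * star u) - S u (star u * (star (w p) * w p)) := by
    have hc := (hwu p).tprod_two
    rw [map_sub, hBoundary_tprod_three, hBoundary_tprod_three, ← hS, ← hS]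
    simp only [Matrix.cons_val_zero, Matrix.cons_val_one, Matrix.cons_val]
    rw [hc, mul_assoc (star (w p)), hu, mul_one, ← mul_assoc u, hu', one_mul, ← mul_assoc (w p),
      mul_assoc (star u)]
    abel
  rw [map_sum, Finset.sum_congr rfl fun p _ => h p, Finset.sum_sub_distrib, ← map_sum, ← map_sum,
    ← Finset.sum_mul, ← Finset.mul_sum, hw, hw', one_mul, mul_one, sub_self]

/-- The inner faces cancel between permutations that differ by an adjacent transposition, by phase
commutation. The first face of `starTensor a b d` cancels the last face of `starTensor b d a`, which
has the same sign: at once if `a` is `u` or `v`, and after summation over `p` if `a` is `w p`. -/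
lemma sum_hBoundary_antisymmetrized {ι : Type*} [Fintype ι] {u v : A} {w : ι → A}
    (hu : star u * u = 1) (hu' : u * star u = 1) (hv : star v * v = 1) (hv' : v * star v = 1)
    (huv : PhaseCommute u v) (huw : ∀ p, PhaseCommute u (w p)) (hvw : ∀ p, PhaseCommute v (w p))
    (hw : ∑ p, star (w p) * w p = 1) (hw' : ∑ p, w p * star (w p) = 1) :
    hBoundary A 2 (∑ p, (starTensor u v (w p) - starTensor v u (w p) - starTensor (w p) v u - starTensor u (w p) v + starTensor v (w p) u +
      starTensor (w p) u v)) = 0 := by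
  have hd (a b d : A) : hBoundary A 2 (starTensor a b d) =
      PiTensorProduct.tprod ℂ ![star d * star b * (star a * a), b, d] -
      PiTensorProduct.tprod ℂ ![star d * star b * star a, a * b, d] +
      PiTensorProduct.tprod ℂ ![star d * star b * star a, a, b * d] -
      PiTensorProduct.tprod ℂ ![d * star d * (star b * star a), a, b] := by
    rw [starTensor, hBoundary_tprod_four]
    simp [mul_assoc]
  let S (x y : A) : A →ₗ[ℂ] HChain A 2 :=
    (PiTensorProduct.tprod ℂ (s := fun _ : Fin 3 => A)).toLinearMap ![0, x, y] 0
  have hS (a x y : A) : PiTensorProduct.tprod ℂ ![a, x, y] = S x y a := by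
    simp only [S, MultilinearMap.toLinearMap_apply]
    congr 1
    ext k
    fin_cases k <;> simp
  have e1 (a x y : A) : ∑ p, PiTensorProduct.tprod ℂ ![a * (star (w p) * w p), x, y] =
      (PiTensorProduct.tprod ℂ ![a, x, y] : HChain A 2) := by
    simp only [hS]
    rw [← map_sum, ← Finset.mul_sum, hw, mul_one]
  have e2 (a x y : A) : ∑ p, PiTensorProduct.tprod ℂ ![w p * star (w p) * a, x, y] =
      (PiTensorProduct.tprod ℂ ![a, x, y] : HChain A 2) := by
    simp only [hS]
    rw [← map_sum, ← Finset.sum_mul, hw', one_mul]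
  -- For a fixed `p` only the outer faces in which `w p` meets its own adjoint survive; `e1` and
  -- `e2` sum them.
  have hp (p : ι) : hBoundary A 2 (starTensor u v (w p) - starTensor v u (w p) - starTensor (w p) v u - starTensor u (w p) v +
      starTensor v (w p) u + starTensor (w p) u v) =
      (PiTensorProduct.tprod ℂ ![star v * star u * (star (w p) * w p), u, v] -
        PiTensorProduct.tprod ℂ ![w p * star (w p) * (star v * star u), u, v]) -
      (PiTensorProduct.tprod ℂ ![star u * star v * (star (w p) * w p), v, u] -
        PiTensorProduct.tprod ℂ ![w p * star (w p) * (star u * star v), v, u]) := by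
    simp only [map_add, map_sub, hd]
    rw [huv.tprod_three_left (w p), (huw p).tprod_three_left v, (hvw p).tprod_three_left u,
      huv.tprod_three_right (w p), (huw p).tprod_three_right v, (hvw p).tprod_three_right u, hu, hu',
      hv, hv']
    simp only [mul_one, one_mul]
    abel
  rw [map_sum, Finset.sum_congr rfl fun p _ => hp p, Finset.sum_sub_distrib, Finset.sum_sub_distrib,
    Finset.sum_sub_distrib, e1, e1, e2, e2, sub_self, sub_self, sub_self]

end cycles

lemma star_e_mul_e (x : ℝ) : star (e x) * e x = 1 := by rw [star_e, e_neg_mul]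

lemma phaseCommute_U (i j : Fin 2) : PhaseCommute (U c μ ν i) (U c μ ν j) :=
  ⟨1, by simp, by rw [one_smul, U_mul_comm]⟩

lemma InBimodule.phaseCommute_U {a : smoothQHM c μ ν} (ha : InBimodule a) (j : Fin 2) :
    PhaseCommute a (U c μ ν j) :=
  ⟨_, star_e_mul_e _, inBimodule_mul_U ha j⟩

section frame

variable {ξ : Fin 2 → smoothQHM c μ ν}

lemma IsFrame.isHCycle_cyc1 (hξ : IsFrame ξ) (j : Fin 3) : IsHCycle (cyc1 ξ j) := by
  have h1 (i : Fin 2) : hBoundary (smoothQHM c μ ν) 0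
      (PiTensorProduct.tprod ℂ ![star (U c μ ν i), U c μ ν i]) = 0 := by
    rw [hBoundary_tprod_two]
    simp [star_U_mul, U_mul_star]
  fin_cases j
  · exact h1 0
  · exact h1 1
  · change hBoundary (smoothQHM c μ ν) 0 (∑ p, PiTensorProduct.tprod ℂ ![star (ξ p), ξ p]) = 0
    have h2 := hξ.sum_star_mul
    have h3 := hξ.sum_mul_star
    rw [Fin.sum_univ_two] at h2 h3
    rw [Fin.sum_univ_two, map_add, hBoundary_tprod_two, hBoundary_tprod_two, sub_add_sub_comm,
      ← tprod_cons_add, ← tprod_cons_add]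
    change PiTensorProduct.tprod ℂ ![star (ξ 0) * ξ 0 + star (ξ 1) * ξ 1] -
      PiTensorProduct.tprod ℂ ![ξ 0 * star (ξ 0) + ξ 1 * star (ξ 1)] = 0
    rw [h2, h3, sub_self]

lemma IsFrame.isHCycle_cyc2 (hξ : IsFrame ξ) (j : Fin 2) : IsHCycle (cyc2 ξ j) :=
  hBoundary_commutator (star_U_mul j) (U_mul_star j) (fun p => (hξ.mem p).phaseCommute_U j)
    hξ.sum_star_mul hξ.sum_mul_star

lemma cyc3_eq (ξ : Fin 2 → smoothQHM c μ ν) :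
    cyc3 ξ = ∑ p, (starTensor (U c μ ν 0) (U c μ ν 1) (ξ p) - starTensor (U c μ ν 1) (U c μ ν 0) (ξ p) -
      starTensor (ξ p) (U c μ ν 1) (U c μ ν 0) - starTensor (U c μ ν 0) (ξ p) (U c μ ν 1) +
      starTensor (U c μ ν 1) (ξ p) (U c μ ν 0) + starTensor (ξ p) (U c μ ν 0) (U c μ ν 1)) :=
  sum_sign_smul_tprod (UXi ξ)

lemma IsFrame.isHCycle_cyc3 (hξ : IsFrame ξ) : IsHCycle (cyc3 ξ) := by
  change hBoundary (smoothQHM c μ ν) 2 (cyc3 ξ) = 0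
  rw [cyc3_eq]
  exact sum_hBoundary_antisymmetrized (star_U_mul 0) (U_mul_star 0) (star_U_mul 1) (U_mul_star 1)
    (phaseCommute_U 0 1) (fun p => ((hξ.mem p).phaseCommute_U 0).symm)
    (fun p => ((hξ.mem p).phaseCommute_U 1).symm) hξ.sum_star_mul hξ.sum_mul_star

end frame

/-! ### The pairings -/

/-- The constant `2πi`. -/
def twoPiI : ℂ := 2 * Real.pi * Complex.I

lemma twoPiI_ne_zero : twoPiI ≠ 0 := by simp [twoPiI, Real.pi_ne_zero]

section pairings

variable {ξ : Fin 2 → smoothQHM c μ ν}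

lemma hPair_cyc1_U (ξ : Fin 2 → smoothQHM c μ ν) (j : Fin 2) (i : Fin 3) :
    hPair (cyc1 ξ j.castSucc) (phi1 c μ ν i) = if j.castSucc = i then -twoPiI else 0 := by
  have h : cyc1 ξ j.castSucc = PiTensorProduct.tprod ℂ ![star (U c μ ν j), U c μ ν j] := by
    fin_cases j <;> rfl
  have hU : star (U c μ ν j : QHMAlg c μ ν) * (U c μ ν j : QHMAlg c μ ν) = 1 :=
    congrArg Subtype.val (star_U_mul j)
  rw [h, hPair_tprod, phi1_apply]
  change trace c μ ν (star (U c μ ν j : QHMAlg c μ ν) * deriv3 c μ ν i (U c μ ν j)) = _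
  rw [deriv3_U, mul_smul_comm, hU, map_smul, trace_one, smul_eq_mul, mul_one]
  simp only [eq_comm, twoPiI]

lemma hPair_cyc1_two (ξ : Fin 2 → smoothQHM c μ ν) (i : Fin 3) : hPair (cyc1 ξ 2) (phi1 c μ ν i) =
    ∑ p, trace c μ ν (star (ξ p : QHMAlg c μ ν) * deriv3 c μ ν i (ξ p)) := by
  change hPair (∑ p, PiTensorProduct.tprod ℂ ![star (ξ p), ξ p]) _ = _
  rw [hPair_sum]
  refine Finset.sum_congr rfl fun p _ => ?_
  rw [hPair_tprod, phi1_apply]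
  rfl

lemma IsFrame.coe_sum_star_mul (hξ : IsFrame ξ) :
    ∑ p, star (ξ p : QHMAlg c μ ν) * (ξ p : QHMAlg c μ ν) = 1 := by
  have := congrArg (smoothQHM c μ ν).subtype hξ.sum_star_mul
  rw [map_sum, map_one] at this
  exact this

lemma IsFrame.hPair_cyc1_two_two (hξ : IsFrame ξ) :
    hPair (cyc1 ξ 2) (phi1 c μ ν 2) = twoPiI := by
  rw [hPair_cyc1_two]
  have h (p : Fin 2) : trace c μ ν (star (ξ p : QHMAlg c μ ν) * deriv3 c μ ν 2 (ξ p)) =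
      twoPiI * trace c μ ν (star (ξ p : QHMAlg c μ ν) * (ξ p : QHMAlg c μ ν)) := by
    rw [deriv3_inBimodule (hξ.mem p), mul_smul_comm, map_smul, smul_eq_mul, twoPiI]
  rw [Finset.sum_congr rfl fun p _ => h p, ← Finset.mul_sum, ← map_sum, hξ.coe_sum_star_mul,
    trace_one, mul_one]

lemma deriv3_two_U (j : Fin 2) : deriv3 c μ ν 2 (U c μ ν j) = 0 := by
  rw [deriv3_U, if_neg (by fin_cases j <;> decide), zero_smul]

/-- The factor `∂_3 U_j = 0` removes the terms with the unknown `∂_i ξ_p`. Each of the two tensors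
then contributes `(-2πi)(2πi) τ(ξ_p^* ξ_p)` when `i = j`: the sign inside the cocycle cancels the
one inside the cycle. -/
lemma IsFrame.hPair_cyc2 (hξ : IsFrame ξ) (j i : Fin 2) :
    hPair (cyc2 ξ j) (phi2 c μ ν i.castSucc 2) = if j = i then -2 * twoPiI ^ 2 else 0 := by
  have hU : star (U c μ ν j : QHMAlg c μ ν) * (U c μ ν j : QHMAlg c μ ν) = 1 :=
    congrArg Subtype.val (star_U_mul j)
  have hU' : (U c μ ν j : QHMAlg c μ ν) * star (U c μ ν j : QHMAlg c μ ν) = 1 :=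
    congrArg Subtype.val (U_mul_star j)
  have h (p : Fin 2) : hPair (PiTensorProduct.tprod ℂ ![star (ξ p) * star (U c μ ν j), U c μ ν j, ξ p] -
      PiTensorProduct.tprod ℂ ![star (U c μ ν j) * star (ξ p), ξ p, U c μ ν j])
        (phi2 c μ ν i.castSucc 2) =
      (if j = i then -2 * twoPiI ^ 2 else 0) *
        trace c μ ν (star (ξ p : QHMAlg c μ ν) * (ξ p : QHMAlg c μ ν)) := by
    rw [hPair_sub, hPair_tprod, hPair_tprod, phi2_apply, phi2_apply]
    change trace c μ ν ((star (ξ p : QHMAlg c μ ν) * star (U c μ ν j : QHMAlg c μ ν)) *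
        (deriv3 c μ ν i.castSucc (U c μ ν j) * deriv3 c μ ν 2 (ξ p) -
          deriv3 c μ ν 2 (U c μ ν j) * deriv3 c μ ν i.castSucc (ξ p))) -
      trace c μ ν ((star (U c μ ν j : QHMAlg c μ ν) * star (ξ p : QHMAlg c μ ν)) *
        (deriv3 c μ ν i.castSucc (ξ p) * deriv3 c μ ν 2 (U c μ ν j) -
          deriv3 c μ ν 2 (ξ p) * deriv3 c μ ν i.castSucc (U c μ ν j))) = _
    rw [deriv3_two_U, deriv3_inBimodule (hξ.mem p), deriv3_U, zero_mul, mul_zero, sub_zero, zero_sub]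
    -- From here on, only the unitarity of `u` and the trace property are used.
    generalize (U c μ ν j : QHMAlg c μ ν) = u at *
    generalize (ξ p : QHMAlg c μ ν) = x
    have e1 : trace c μ ν (star x * star u * (u * x)) = trace c μ ν (star x * x) := by
      rw [mul_assoc, ← mul_assoc (star u), hU, one_mul]
    have e2 : trace c μ ν (star u * star x * (x * u)) = trace c μ ν (star x * x) := by
      rw [mul_assoc, trace_mul_comm, mul_assoc, mul_assoc, hU', mul_one]
    simp only [smul_mul_assoc, mul_smul_comm, mul_neg, map_neg, map_smul, e1, e2, smul_eq_mul,
      Fin.castSucc_inj, eq_comm (a := i)]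
    split_ifs
    · rw [twoPiI]; ring
    · ring
  change hPair (∑ p, _) _ = _
  rw [hPair_sum, Finset.sum_congr rfl fun p _ => h p, ← Finset.mul_sum, ← map_sum,
    hξ.coe_sum_star_mul, trace_one, mul_one]

lemma hPair_starTensor (a b d : smoothQHM c μ ν) (φ : HCochain (smoothQHM c μ ν) 3) :
    hPair (starTensor a b d) φ = φ ![star d * star b * star a, a, b, d] := hPair_tprod _ _

lemma phi3_expand (a b d : smoothQHM c μ ν) : phi3 c μ ν ![star d * star b * star a, a, b, d] =
    trace c μ ν (star (d : QHMAlg c μ ν) * (star (b : QHMAlg c μ ν) * (star (a : QHMAlg c μ ν) *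
      (deriv3 c μ ν 0 a * deriv3 c μ ν 1 b * deriv3 c μ ν 2 d -
        deriv3 c μ ν 1 a * deriv3 c μ ν 0 b * deriv3 c μ ν 2 d -
        deriv3 c μ ν 2 a * deriv3 c μ ν 1 b * deriv3 c μ ν 0 d -
        deriv3 c μ ν 0 a * deriv3 c μ ν 2 b * deriv3 c μ ν 1 d +
        deriv3 c μ ν 1 a * deriv3 c μ ν 2 b * deriv3 c μ ν 0 d +
        deriv3 c μ ν 2 a * deriv3 c μ ν 0 b * deriv3 c μ ν 1 d)))) := by
  rw [phi3_apply]
  refine (sum_perm_three fun i j k => trace c μ ν (star (d : QHMAlg c μ ν) *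
    star (b : QHMAlg c μ ν) * star (a : QHMAlg c μ ν) * deriv3 c μ ν i a * deriv3 c μ ν j b *
      deriv3 c μ ν k d)).trans ?_
  simp only [← map_sub, ← map_add]
  simp only [mul_assoc, mul_add, mul_sub]

/-- For each of the six tensors, only the term of the cocycle with the matching permutation
survives, because `∂_3` kills `U_1` and `U_2` and the first two derivations are diagonal on them.
The signs square to one, so each tensor gives `(-2πi)² (2πi) τ(ξ_p^* ξ_p)`. -/
lemma IsFrame.hPair_cyc3 (hξ : IsFrame ξ) : hPair (cyc3 ξ) (phi3 c μ ν) = 6 * twoPiI ^ 3 := by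
  have hs := hξ.coe_sum_star_mul
  have h0 : star (U c μ ν 0 : QHMAlg c μ ν) * (U c μ ν 0 : QHMAlg c μ ν) = 1 :=
    congrArg Subtype.val (star_U_mul 0)
  have h1 : star (U c μ ν 1 : QHMAlg c μ ν) * (U c μ ν 1 : QHMAlg c μ ν) = 1 :=
    congrArg Subtype.val (star_U_mul 1)
  have h0' : (U c μ ν 0 : QHMAlg c μ ν) * star (U c μ ν 0 : QHMAlg c μ ν) = 1 :=
    congrArg Subtype.val (U_mul_star 0)
  have h1' : (U c μ ν 1 : QHMAlg c μ ν) * star (U c μ ν 1 : QHMAlg c μ ν) = 1 :=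
    congrArg Subtype.val (U_mul_star 1)
  have d00 : deriv3 c μ ν 0 (U c μ ν 0) = -twoPiI • (U c μ ν 0 : QHMAlg c μ ν) := by
    rw [deriv3_U]; rfl
  have d01 : deriv3 c μ ν 0 (U c μ ν 1) = 0 := by
    rw [deriv3_U, if_neg (by decide), zero_smul]
  have d10 : deriv3 c μ ν 1 (U c μ ν 0) = 0 := by
    rw [deriv3_U, if_neg (by decide), zero_smul]
  have d11 : deriv3 c μ ν 1 (U c μ ν 1) = -twoPiI • (U c μ ν 1 : QHMAlg c μ ν) := by
    rw [deriv3_U]; rfl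
  have dξ (p : Fin 2) : deriv3 c μ ν 2 (ξ p) = twoPiI • (ξ p : QHMAlg c μ ν) :=
    deriv3_inBimodule (hξ.mem p)
  have hp (p : Fin 2) : hPair (starTensor (U c μ ν 0) (U c μ ν 1) (ξ p) -
      starTensor (U c μ ν 1) (U c μ ν 0) (ξ p) - starTensor (ξ p) (U c μ ν 1) (U c μ ν 0) -
      starTensor (U c μ ν 0) (ξ p) (U c μ ν 1) + starTensor (U c μ ν 1) (ξ p) (U c μ ν 0) +
      starTensor (ξ p) (U c μ ν 0) (U c μ ν 1)) (phi3 c μ ν) =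
      6 * twoPiI ^ 3 * trace c μ ν (star (ξ p : QHMAlg c μ ν) * (ξ p : QHMAlg c μ ν)) := by
    simp only [hPair_add, hPair_sub, hPair_starTensor, phi3_expand, deriv3_two_U, dξ, d00, d01, d10,
      d11, zero_mul, mul_zero, sub_zero, add_zero, zero_add, zero_sub]
    -- These derivatives depend on the frame; after generalisation their values can play no role.
    generalize deriv3 c μ ν 0 (ξ p) = y0
    generalize deriv3 c μ ν 1 (ξ p) = y1
    generalize (U c μ ν 0 : QHMAlg c μ ν) = u at *
    generalize (U c μ ν 1 : QHMAlg c μ ν) = v at *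
    generalize (ξ p : QHMAlg c μ ν) = x
    have c0 (z : QHMAlg c μ ν) : star u * (u * z) = z := by rw [← mul_assoc, h0, one_mul]
    have c1 (z : QHMAlg c μ ν) : star v * (v * z) = z := by rw [← mul_assoc, h1, one_mul]
    have t0 (z : QHMAlg c μ ν) : trace c μ ν (star u * (z * u)) = trace c μ ν z := by
      rw [trace_mul_comm, mul_assoc, h0', mul_one]
    have t1 (z : QHMAlg c μ ν) : trace c μ ν (star v * (z * v)) = trace c μ ν z := by
      rw [trace_mul_comm, mul_assoc, h1', mul_one]
    have e1 : trace c μ ν (star u * (star v * (star x * (x * (v * u))))) =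
        trace c μ ν (star x * x) := by
      rw [show star u * (star v * (star x * (x * (v * u)))) =
        star u * ((star v * (star x * x * v)) * u) by simp only [mul_assoc], t0, t1]
    have e2 : trace c μ ν (star v * (star u * (star x * (x * (u * v))))) =
        trace c μ ν (star x * x) := by
      rw [show star v * (star u * (star x * (x * (u * v)))) =
        star v * ((star u * (star x * x * u)) * v) by simp only [mul_assoc], t1, t0]
    have e3 : trace c μ ν (star v * (star x * (x * v))) = trace c μ ν (star x * x) := by
      rw [← mul_assoc (star x), t1]
    have e4 : trace c μ ν (star u * (star x * (x * u))) = trace c μ ν (star x * x) := by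
      rw [← mul_assoc (star x), t0]
    simp only [smul_mul_assoc, mul_smul_comm, mul_neg, map_neg, map_smul, smul_eq_mul, mul_assoc,
      c0, c1, e1, e2, e3, e4]
    ring
  rw [cyc3_eq, hPair_sum, Finset.sum_congr rfl fun p _ => hp p, ← Finset.mul_sum, ← map_sum, hs,
    trace_one, mul_one]

end pairings

/-! ### Smooth elements of homogeneous degree -/

variable (c ν) in
/-- The space of quasi-periodic functions of degree `p`. -/
def qpSubmodule (p : ℤ) : Submodule ℂ C(ℝ × ℝ, ℂ) where
  carrier := {f | QuasiPeriodic c ν p f}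
  zero_mem' x y := by simp
  add_mem' {f g} hf hg x y := by
    simp only [ContinuousMap.add_apply]
    rw [(hf x y).1, (hf x y).2, (hg x y).1, (hg x y).2]
    exact ⟨by ring, rfl⟩
  smul_mem' k f hf x y := by
    simp only [ContinuousMap.smul_apply, smul_eq_mul]
    rw [(hf x y).1, (hf x y).2]
    exact ⟨by ring, rfl⟩

variable (c μ ν) in
/-- The inclusion of the quasi-periodic functions of degree `p` into the quantum Heisenberg
manifold. -/
def homogL (p : ℤ) : qpSubmodule c ν p →ₗ[ℂ] QHMAlg c μ ν where
  toFun f := ((homog μ p f.1 f.2 : preQHM c μ ν) : QHMAlg c μ ν)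
  map_add' f g := by
    rw [← Completion.coe_add]
    congr 1
    exact Subtype.ext (Conv.single_add p f.1 g.1)
  map_smul' k f := by
    rw [RingHom.id_apply, ← Completion.coe_smul]
    congr 1
    exact Subtype.ext (Conv.smul_single k p f.1).symm

lemma homogL_sub {p : ℤ} (f g : qpSubmodule c ν p) :
    homogL c μ ν p (f - g) = homogL c μ ν p f - homogL c μ ν p g := by
  rw [eq_sub_iff_add_eq, ← LinearMap.map_add]
  congr 1
  exact sub_add_cancel f g

/-- Bounds the C*-norm by the supremum norm; through it, every estimate on homogeneous elements
becomes an estimate on functions. -/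
lemma norm_homogL_le {p : ℤ} (f : qpSubmodule c ν p) {M : ℝ} (hM : ∀ z, ‖f.1 z‖ ≤ M) :
    ‖homogL c μ ν p f‖ ≤ M := by
  change ‖((homog μ p f.1 f.2 : preQHM c μ ν) : QHMAlg c μ ν)‖ ≤ M
  rw [Completion.norm_coe]
  exact fullNorm_le fun B _ ρ => norm_homog_le f.2 hM ρ

/-- The modulus of a quasi-periodic function is periodic, which reduces uniform bounds to a compact
set. -/
lemma norm_le_of_unit_square {p : ℤ} (f : qpSubmodule c ν p) {M : ℝ}
    (hM : ∀ z ∈ Set.Icc (0 : ℝ) 1 ×ˢ Set.Icc (0 : ℝ) 1, ‖f.1 z‖ ≤ M) (z : ℝ × ℝ) : ‖f.1 z‖ ≤ M := by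
  have h1 : ∀ y, Function.Periodic (fun x => ‖f.1 (x, y)‖) 1 := fun y x => by
    simp [(f.2 x y).1, norm_e]
  have h2 : ∀ x, Function.Periodic (fun y => ‖f.1 (x, y)‖) 1 := fun x y => by
    simp [(f.2 x y).2]
  obtain ⟨x', hx', hx⟩ := (h1 z.2).exists_mem_Ico₀ one_pos z.1
  obtain ⟨y', hy', hy⟩ := (h2 x').exists_mem_Ico₀ one_pos z.2
  have := hM (x', y') ⟨⟨hx'.1, hx'.2.le⟩, ⟨hy'.1, hy'.2.le⟩⟩
  rwa [← hy, ← hx] at this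

/-- A continuous family of quasi-periodic functions is continuous in the supremum norm. -/
lemma eventually_forall_norm_sub_le {X : Type*} [TopologicalSpace X] {p : ℤ}
    (Ψ : X → qpSubmodule c ν p) (hΨ : Continuous fun q : X × (ℝ × ℝ) => (Ψ q.1).1 q.2) (g : X)
    {ε : ℝ} (hε : 0 < ε) : ∀ᶠ g' in nhds g, ∀ z, ‖(Ψ g').1 z - (Ψ g).1 z‖ ≤ ε := by
  have hK : IsCompact (Set.Icc (0 : ℝ) 1 ×ˢ Set.Icc (0 : ℝ) 1) := isCompact_Icc.prod isCompact_Icc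
  have h : ∀ᶠ g' in nhds g, ∀ z ∈ Set.Icc (0 : ℝ) 1 ×ˢ Set.Icc (0 : ℝ) 1,
      ‖(Ψ g').1 z - (Ψ g).1 z‖ < ε := by
    refine hK.eventually_forall_of_forall_eventually fun z _ => ?_
    have hc : Continuous fun q : X × (ℝ × ℝ) => ‖(Ψ q.1).1 q.2 - (Ψ g).1 q.2‖ :=
      (hΨ.sub ((Ψ g).1.continuous.comp continuous_snd)).norm
    exact hc.continuousAt.eventually_lt continuousAt_const (by simpa using hε)
  filter_upwards [h] with g' hg'
  exact norm_le_of_unit_square (Ψ g' - Ψ g) fun z hz => (hg' z hz).le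

/-! ### Differentiating the action on quasi-periodic functions -/

lemma QuasiPeriodic.twist {p : ℤ} {f : C(ℝ × ℝ, ℂ)} (hf : QuasiPeriodic c ν p f) (μ r s t : ℝ) :
    QuasiPeriodic c ν p (QHM.twist c μ r s t p f) := by
  have := (actPre c μ ν r s t (homog μ p f hf)).2 p
  change QuasiPeriodic c ν p ((actConv c μ ν r s t (Conv.single p f)) p) at this
  rwa [actConv_single, Conv.single_apply, if_pos rfl] at this

/-- The action of the Heisenberg group on the quasi-periodic functions of degree `p`. -/
def twistQP (μ : ℝ) {p : ℤ} (f : qpSubmodule c ν p) (g : ℝ × ℝ × ℝ) : qpSubmodule c ν p :=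
  ⟨twist c μ g.1 g.2.1 g.2.2 p f.1, f.2.twist μ _ _ _⟩

lemma twistQP_apply {p : ℤ} (f : qpSubmodule c ν p) (g : ℝ × ℝ × ℝ) (z : ℝ × ℝ) :
    (twistQP μ f g).1 z = e (p * (g.2.2 - c * g.2.1 * (z.1 - g.1 - p * μ))) *
      f.1 (z.1 - g.1, z.2 - g.2.1) := rfl

lemma twistQP_zero {p : ℤ} (f : qpSubmodule c ν p) : twistQP μ f 0 = f := by
  ext z
  rw [twistQP_apply]
  simp [e_zero]

lemma act_homogL {p : ℤ} (f : qpSubmodule c ν p) (g : ℝ × ℝ × ℝ) :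
    act c μ ν g.1 g.2.1 g.2.2 (homogL c μ ν p f) = homogL c μ ν p (twistQP μ f g) := by
  change act c μ ν g.1 g.2.1 g.2.2 ((homog μ p f.1 f.2 : preQHM c μ ν) : QHMAlg c μ ν) = _
  rw [act_coe]
  congr 1
  exact Subtype.ext (actConv_single _ _ _ _ _)

lemma continuous_twistQP {p : ℤ} (f : qpSubmodule c ν p) :
    Continuous fun q : (ℝ × ℝ × ℝ) × (ℝ × ℝ) => (twistQP μ f q.1).1 q.2 := by
  simp only [twistQP_apply]
  exact (continuous_e.comp (by fun_prop)).mul (f.1.continuous.comp (by fun_prop))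

/-- The infinitesimal action of the first coordinate direction is `-∂/∂x`. -/
lemma exists_derivX {p : ℤ} (f : qpSubmodule c ν p) (hf : ContDiff ℝ ∞ f.1) :
    ∃ f₁ : qpSubmodule c ν p, ContDiff ℝ ∞ f₁.1 ∧ ∀ z, f₁.1 z = -(fderiv ℝ f.1 z (1, 0)) := by
  have hs : ContDiff ℝ ∞ fun z => -(fderiv ℝ f.1 z (1, 0)) :=
    ((hf.fderiv_right (by simp)).clm_apply contDiff_const).neg
  have hd (x y : ℝ) : HasDerivAt (fun x' => f.1 (x', y)) (fderiv ℝ f.1 (x, y) (1, 0)) x :=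
    ((hf.differentiable (by simp)) (x, y)).hasFDerivAt.comp_hasDerivAt x
      ((hasDerivAt_id x).prodMk (hasDerivAt_const x y))
  refine ⟨⟨⟨_, hs.continuous⟩, fun x y => ⟨?_, ?_⟩⟩, hs, fun z => rfl⟩
  -- The factor of quasi-periodicity does not involve `x`, so it passes through the derivative.
  · have h1 := (hd (x + 1) y).comp_add_const x 1
    simp only [(f.2 _ y).1] at h1
    have h2 := h1.unique ((hd x y).const_mul _)
    simp only [ContinuousMap.coe_mk, h2]
    ring
  · have h1 := hd x (y + 1)
    simp only [(f.2 _ y).2] at h1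
    simp only [ContinuousMap.coe_mk, h1.unique (hd x y)]

/-- The infinitesimal action of the second coordinate direction. -/
lemma exists_derivY (μ : ℝ) {p : ℤ} (f : qpSubmodule c ν p) (hf : ContDiff ℝ ∞ f.1) :
    ∃ f₂ : qpSubmodule c ν p, ContDiff ℝ ∞ f₂.1 ∧ ∀ z, f₂.1 z =
      -(2 * Real.pi * Complex.I * (p * c * (z.1 - p * μ) : ℝ)) * f.1 z -
        fderiv ℝ f.1 z (0, 1) := by
  have hs : ContDiff ℝ ∞ fun z : ℝ × ℝ =>
      -(2 * Real.pi * Complex.I * (p * c * (z.1 - p * μ) : ℝ)) * f.1 z -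
        fderiv ℝ f.1 z (0, 1) := by
    refine ContDiff.sub (ContDiff.mul (ContDiff.neg (contDiff_const.mul
      (Complex.ofRealCLM.contDiff.comp ?_))) hf)
      ((hf.fderiv_right (by simp)).clm_apply contDiff_const)
    exact contDiff_const.mul (contDiff_fst.sub contDiff_const)
  have hd (x y : ℝ) : HasDerivAt (fun y' => f.1 (x, y')) (fderiv ℝ f.1 (x, y) (0, 1)) y :=
    ((hf.differentiable (by simp)) (x, y)).hasFDerivAt.comp_hasDerivAt y
      ((hasDerivAt_const y x).prodMk (hasDerivAt_id y))
  refine ⟨⟨⟨_, hs.continuous⟩, fun x y => ⟨?_, ?_⟩⟩, hs, fun z => rfl⟩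
  -- Differentiating the factor of quasi-periodicity in `y` gives an extra term, and the growth of
  -- the coefficient `p c (x - p μ)` under `x ↦ x + 1` compensates it; neither summand is
  -- quasi-periodic by itself in general.
  · have h1 := hd (x + 1) y
    simp only [(f.2 x _).1] at h1
    have h3 : HasDerivAt (fun y' : ℝ => e (-(c * p * (y' - p * ν))))
        ((-(c * p * 1) : ℝ) • (2 * Real.pi * Complex.I * e (-(c * p * (y - p * ν))))) y :=
      (hasDerivAt_e _).scomp y ((((hasDerivAt_id y).sub_const (p * ν)).const_mul (c * p : ℝ)).neg)
    have h2 := h1.unique (h3.mul (hd x y))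
    simp only [ContinuousMap.coe_mk, h2, (f.2 x y).1, Complex.real_smul]
    push_cast
    ring
  · have h1 := (hd x (y + 1)).comp_add_const y 1
    simp only [(f.2 x _).2] at h1
    simp only [ContinuousMap.coe_mk, h1.unique (hd x y), (f.2 x y).2]

/-- At a fixed point `z` this is the chain rule. The correction `c s` in the direction `r` appears
because the phase also depends on `r`; it reflects the noncommutativity of the group. -/
lemma hasFDerivAt_twistQP {p : ℤ} (f f₁ f₂ : qpSubmodule c ν p) (hf : Differentiable ℝ f.1)
    (h₁ : ∀ z, f₁.1 z = -(fderiv ℝ f.1 z (1, 0)))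
    (h₂ : ∀ z, f₂.1 z = -(2 * Real.pi * Complex.I * (p * c * (z.1 - p * μ) : ℝ)) * f.1 z -
        fderiv ℝ f.1 z (0, 1)) (z : ℝ × ℝ) (g : ℝ × ℝ × ℝ) :
    HasFDerivAt (fun g => (twistQP μ f g).1 z)
      ((ContinuousLinearMap.fst ℝ ℝ (ℝ × ℝ)).smulRight ((twistQP μ f₁ g).1 z +
          (c * g.2.1 : ℝ) • (2 * Real.pi * Complex.I * p * (twistQP μ f g).1 z)) +
        ((ContinuousLinearMap.fst ℝ ℝ ℝ).comp (ContinuousLinearMap.snd ℝ ℝ (ℝ × ℝ))).smulRight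
          ((twistQP μ f₂ g).1 z) +
        ((ContinuousLinearMap.snd ℝ ℝ ℝ).comp (ContinuousLinearMap.snd ℝ ℝ (ℝ × ℝ))).smulRight
          (2 * Real.pi * Complex.I * p * (twistQP μ f g).1 z)) g := by
  have hr : HasFDerivAt (fun g : ℝ × ℝ × ℝ => g.1) (ContinuousLinearMap.fst ℝ ℝ (ℝ × ℝ)) g :=
    hasFDerivAt_fst
  have hs : HasFDerivAt (fun g : ℝ × ℝ × ℝ => g.2.1)
    ((ContinuousLinearMap.fst ℝ ℝ ℝ).comp (ContinuousLinearMap.snd ℝ ℝ (ℝ × ℝ))) g :=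
    hasFDerivAt_snd.fst
  have ht : HasFDerivAt (fun g : ℝ × ℝ × ℝ => g.2.2)
    ((ContinuousLinearMap.snd ℝ ℝ ℝ).comp (ContinuousLinearMap.snd ℝ ℝ (ℝ × ℝ))) g :=
    hasFDerivAt_snd.snd
  have hθ := (ht.sub ((hs.const_mul (c : ℝ)).mul ((hr.const_sub z.1).sub_const (p * μ)))).const_mul
    (p : ℝ)
  have he := (hasDerivAt_e (p * (g.2.2 - c * g.2.1 * (z.1 - g.1 - p * μ)))).hasFDerivAt.comp g hθ
  have hfd := (hf (z.1 - g.1, z.2 - g.2.1)).hasFDerivAt.comp g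
    ((hr.const_sub z.1).prodMk (hs.const_sub z.2))
  refine (he.mul hfd).congr_fderiv ?_
  -- The chain rule evaluates the differential at vectors such as `(-1, 0)`; splitting them reduces
  -- to the partial derivatives in `f₁` and `f₂`.
  have hsplit (a b : ℝ) (L : ℝ × ℝ →L[ℝ] ℂ) : L (a, b) = a * L (1, 0) + b * L (0, 1) := by
    have : ((a, b) : ℝ × ℝ) = a • (1, 0) + b • (0, 1) := by simp
    rw [this, map_add, map_smul, map_smul, Complex.real_smul, Complex.real_smul]
  ext <;>
  · simp [twistQP_apply, h₁, h₂]
    try rw [hsplit]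
    push_cast
    ring

/-- The pointwise derivatives are continuous in `g` uniformly in `z`. The mean value inequality
therefore bounds the Taylor remainder in the supremum norm, hence in the C*-norm. -/
lemma hasFDerivAt_homogL_twistQP {p : ℤ} (f f₁ f₂ : qpSubmodule c ν p) (hf : Differentiable ℝ f.1)
    (h₁ : ∀ z, f₁.1 z = -(fderiv ℝ f.1 z (1, 0)))
    (h₂ : ∀ z, f₂.1 z = -(2 * Real.pi * Complex.I * (p * c * (z.1 - p * μ) : ℝ)) * f.1 z -
        fderiv ℝ f.1 z (0, 1)) (g : ℝ × ℝ × ℝ) :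
    HasFDerivAt (fun g => homogL c μ ν p (twistQP μ f g))
      ((ContinuousLinearMap.fst ℝ ℝ (ℝ × ℝ)).smulRight (homogL c μ ν p (twistQP μ f₁ g) +
          (c * g.2.1 : ℝ) • ((2 * Real.pi * Complex.I * p) • homogL c μ ν p (twistQP μ f g))) +
        ((ContinuousLinearMap.fst ℝ ℝ ℝ).comp (ContinuousLinearMap.snd ℝ ℝ (ℝ × ℝ))).smulRight
          (homogL c μ ν p (twistQP μ f₂ g)) +
        ((ContinuousLinearMap.snd ℝ ℝ ℝ).comp (ContinuousLinearMap.snd ℝ ℝ (ℝ × ℝ))).smulRight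
          ((2 * Real.pi * Complex.I * p) • homogL c μ ν p (twistQP μ f g))) g := by
  let Ψ₃ : ℝ × ℝ × ℝ → qpSubmodule c ν p := fun g => (2 * Real.pi * Complex.I * p) • twistQP μ f g
  let Ψ₁ : ℝ × ℝ × ℝ → qpSubmodule c ν p := fun g => twistQP μ f₁ g + (c * g.2.1 : ℝ) • Ψ₃ g
  have hΨ₃ : Continuous fun q : (ℝ × ℝ × ℝ) × (ℝ × ℝ) => (Ψ₃ q.1).1 q.2 :=
    (continuous_twistQP f).const_smul (2 * Real.pi * Complex.I * p)
  have hΨ₁ : Continuous fun q : (ℝ × ℝ × ℝ) × (ℝ × ℝ) => (Ψ₁ q.1).1 q.2 := by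
    refine (continuous_twistQP f₁).add (Continuous.smul (f := fun q : (ℝ × ℝ × ℝ) × (ℝ × ℝ) =>
      (c * q.1.2.1 : ℝ)) ?_ hΨ₃)
    fun_prop
  let L (g : ℝ × ℝ × ℝ) (z : ℝ × ℝ) : ℝ × ℝ × ℝ →L[ℝ] ℂ :=
    (ContinuousLinearMap.fst ℝ ℝ (ℝ × ℝ)).smulRight ((Ψ₁ g).1 z) +
        ((ContinuousLinearMap.fst ℝ ℝ ℝ).comp (ContinuousLinearMap.snd ℝ ℝ (ℝ × ℝ))).smulRight
          ((twistQP μ f₂ g).1 z) +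
        ((ContinuousLinearMap.snd ℝ ℝ ℝ).comp (ContinuousLinearMap.snd ℝ ℝ (ℝ × ℝ))).smulRight
          ((Ψ₃ g).1 z)
  have hL (z : ℝ × ℝ) (g : ℝ × ℝ × ℝ) : HasFDerivAt (fun g => (twistQP μ f g).1 z) (L g z) g :=
    hasFDerivAt_twistQP f f₁ f₂ hf h₁ h₂ z g
  rw [hasFDerivAt_iff_isLittleO, Asymptotics.isLittleO_iff]
  intro ε hε
  -- One third of `ε` for each coordinate direction; this `δ` does not depend on `z`.
  obtain ⟨δ, hδ, hball⟩ := Metric.eventually_nhds_iff_ball.1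
    (((eventually_forall_norm_sub_le Ψ₁ hΨ₁ g (ε := ε / 3) (by positivity)).and
      (eventually_forall_norm_sub_le _ (continuous_twistQP (μ := μ) f₂) g (ε := ε / 3)
        (by positivity))).and
      (eventually_forall_norm_sub_le Ψ₃ hΨ₃ g (ε := ε / 3) (by positivity)))
  filter_upwards [Metric.ball_mem_nhds g hδ] with g' hg'
  have hnorm (z : ℝ × ℝ) : ‖(twistQP μ f g').1 z - (twistQP μ f g).1 z - L g z (g' - g)‖ ≤
      ε * ‖g' - g‖ := by
    refine (convex_ball g δ).norm_image_sub_le_of_norm_hasFDerivWithin_le'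
      (f := fun g => (twistQP μ f g).1 z) (f' := fun g => L g z)
      (fun w _ => (hL z w).hasFDerivWithinAt) (fun w hw => ?_) (Metric.mem_ball_self hδ) hg'
    obtain ⟨⟨b1, b2⟩, b3⟩ := hball w hw
    refine ContinuousLinearMap.opNorm_le_bound _ hε.le fun h => ?_
    have e1 : (L w z - L g z) h = h.1 • ((Ψ₁ w).1 z - (Ψ₁ g).1 z) +
        h.2.1 • ((twistQP μ f₂ w).1 z - (twistQP μ f₂ g).1 z) +
        h.2.2 • ((Ψ₃ w).1 z - (Ψ₃ g).1 z) := by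
      simp only [L, sub_apply, add_apply, ContinuousLinearMap.smulRight_apply,
        ContinuousLinearMap.comp_apply, ContinuousLinearMap.coe_fst', ContinuousLinearMap.coe_snd',
        smul_sub]
      abel
    have n1 : ‖h.1‖ ≤ ‖h‖ := norm_fst_le h
    have n2 : ‖h.2.1‖ ≤ ‖h‖ := (norm_fst_le h.2).trans (norm_snd_le h)
    have n3 : ‖h.2.2‖ ≤ ‖h‖ := (norm_snd_le h.2).trans (norm_snd_le h)
    rw [e1]
    calc _ ≤ ‖h.1‖ * ‖(Ψ₁ w).1 z - (Ψ₁ g).1 z‖ +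
        ‖h.2.1‖ * ‖(twistQP μ f₂ w).1 z - (twistQP μ f₂ g).1 z‖ +
        ‖h.2.2‖ * ‖(Ψ₃ w).1 z - (Ψ₃ g).1 z‖ := by
          refine (norm_add₃_le).trans (le_of_eq ?_)
          rw [norm_smul, norm_smul, norm_smul]
      _ ≤ ‖h‖ * (ε / 3) + ‖h‖ * (ε / 3) + ‖h‖ * (ε / 3) := by
          gcongr
          · exact b1 z
          · exact b2 z
          · exact b3 z
      _ = ε * ‖h‖ := by ring
  -- The remainder as a single quasi-periodic function, so that the comparison of norms applies to
  -- it.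
  let d : qpSubmodule c ν p := twistQP μ f g' - twistQP μ f g -
    ((g' - g).1 • Ψ₁ g + (g' - g).2.1 • twistQP μ f₂ g + (g' - g).2.2 • Ψ₃ g)
  have hd := norm_homogL_le (μ := μ) d (M := ε * ‖g' - g‖) hnorm
  refine le_of_eq_of_le (congrArg _ ?_) hd
  have hr (r : ℝ) (k : qpSubmodule c ν p) : homogL c μ ν p (r • k) = r • homogL c μ ν p k :=
    (homogL c μ ν p).map_smul (r : ℂ) k
  have hd' : homogL c μ ν p d = homogL c μ ν p (twistQP μ f g') - homogL c μ ν p (twistQP μ f g) -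
      homogL c μ ν p ((g' - g).1 • Ψ₁ g + (g' - g).2.1 • twistQP μ f₂ g + (g' - g).2.2 • Ψ₃ g) := by
    rw [← homogL_sub, ← homogL_sub]
  rw [hd', LinearMap.map_add, LinearMap.map_add, hr, hr, hr, LinearMap.map_add, hr,
    LinearMap.map_smul]
  rfl

/-- The derivative is assembled from the orbit maps of `f`, `f₁` and `f₂`, which are again smooth
and quasi-periodic; hence the induction over all `f` at once. -/
lemma contDiff_homogL_twistQP (n : ℕ) {p : ℤ} (f : qpSubmodule c ν p) (hf : ContDiff ℝ ∞ f.1) :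
    ContDiff ℝ n fun g => homogL c μ ν p (twistQP μ f g) := by
  induction n generalizing f with
  | zero =>
    obtain ⟨f₁, -, h₁⟩ := exists_derivX f hf
    obtain ⟨f₂, -, h₂⟩ := exists_derivY μ f hf
    refine contDiff_zero.2 (continuous_iff_continuousAt.2 fun g =>
      (hasFDerivAt_homogL_twistQP f f₁ f₂ (hf.differentiable (by simp)) h₁ h₂ g).continuousAt)
  | succ n ih =>
    obtain ⟨f₁, hf₁, h₁⟩ := exists_derivX f hf
    obtain ⟨f₂, hf₂, h₂⟩ := exists_derivY μ f hf
    refine contDiff_succ_iff_hasFDerivAt.2 ⟨_, ?_,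
      hasFDerivAt_homogL_twistQP f f₁ f₂ (hf.differentiable (by simp)) h₁ h₂⟩
    have h3 := (ih f hf).const_smul (2 * Real.pi * Complex.I * p)
    have hs : ContDiff ℝ n fun g : ℝ × ℝ × ℝ => (c * g.2.1 : ℝ) :=
      contDiff_const.mul (contDiff_fst.comp contDiff_snd)
    exact ((contDiff_const.smulRight ((ih f₁ hf₁).add (hs.smul h3))).add
      (contDiff_const.smulRight (ih f₂ hf₂))).add (contDiff_const.smulRight h3)

lemma homogL_mem_smoothQHM {p : ℤ} (f : qpSubmodule c ν p) (hf : ContDiff ℝ ∞ f.1) :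
    homogL c μ ν p f ∈ smoothQHM c μ ν := by
  change ContDiff ℝ ∞ _
  simp only [act_homogL]
  exact contDiff_infty.2 fun n => contDiff_homogL_twistQP n f hf

lemma axis_hasDerivAt_zero : HasDerivAt (axis 0) (1, 0, 0) 0 :=
  (hasDerivAt_id (0 : ℝ)).prodMk (hasDerivAt_const _ _)

lemma axis_hasDerivAt_one : HasDerivAt (axis 1) (0, 1, 0) 0 :=
  (hasDerivAt_const _ _).prodMk ((hasDerivAt_id (0 : ℝ)).prodMk (hasDerivAt_const _ _))

lemma axis_zero (i : Fin 3) : axis i 0 = 0 := by fin_cases i <;> rfl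

/-- The derivative of the orbit map at the identity, restricted to a coordinate axis. At the
identity `s = 0`, so the correction in the direction `r` disappears. -/
lemma deriv3_homogL {p : ℤ} (f f₁ f₂ : qpSubmodule c ν p) (hf : Differentiable ℝ f.1)
    (h₁ : ∀ z, f₁.1 z = -(fderiv ℝ f.1 z (1, 0)))
    (h₂ : ∀ z, f₂.1 z = -(2 * Real.pi * Complex.I * (p * c * (z.1 - p * μ) : ℝ)) * f.1 z -
        fderiv ℝ f.1 z (0, 1)) (a : smoothQHM c μ ν) (ha : (a : QHMAlg c μ ν) = homogL c μ ν p f) :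
    deriv3 c μ ν 0 a = homogL c μ ν p f₁ ∧ deriv3 c μ ν 1 a = homogL c μ ν p f₂ := by
  have h0 := hasFDerivAt_homogL_twistQP f f₁ f₂ hf h₁ h₂ 0
  have hact (i : Fin 3) : (fun u => actAxis c μ ν i u (a : QHMAlg c μ ν)) =
      (fun g => homogL c μ ν p (twistQP μ f g)) ∘ axis i := by
    ext u
    rw [ha]
    exact act_homogL f (axis i u)
  constructor
  · have h := hasDerivAt_actAxis 0 a
    rw [hact] at h
    rw [← axis_zero 0] at h0
    rw [h.unique (h0.comp_hasDerivAt 0 axis_hasDerivAt_zero), axis_zero]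
    simp [twistQP_zero]
  · have h := hasDerivAt_actAxis 1 a
    rw [hact] at h
    rw [← axis_zero 1] at h0
    rw [h.unique (h0.comp_hasDerivAt 0 axis_hasDerivAt_one), axis_zero]
    simp [twistQP_zero]

/-! ### Frames built from cut-off functions -/

lemma e_intCast (n : ℤ) : e n = 1 := by
  rw [e, mul_comm]
  exact_mod_cast Complex.exp_int_mul_two_pi_mul_I n

/-- The quasi-periodic extension of the function `χ(x - a)` on the interval `[a + β, a + β + 1]`. -/
def cutoffFun (c : ℕ) (ν : ℝ) (χ : ℝ → ℝ) (β a : ℝ) (z : ℝ × ℝ) : ℂ :=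
  e (-(c * ⌊z.1 - a - β⌋ * (z.2 - ν))) * (χ (z.1 - a) : ℂ)

/-- `χ` is a smooth periodic function that vanishes near the points of `β + ℤ`. -/
structure IsBump (χ : ℝ → ℝ) (β : ℝ) : Prop where
  smooth : ContDiff ℝ ∞ χ
  periodic : Function.Periodic χ 1
  zero : ∀ (u : ℝ) (n : ℤ), |u - β - n| ≤ 1 / 6 → χ u = 0

namespace IsBump

variable {χ : ℝ → ℝ} {β : ℝ}

/-- The floor is locally constant except at the points of `a + β + ℤ`, and near these `χ` vanishes.
So the phase may be frozen locally, which gives smoothness and lets derivatives ignore the floor. -/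
lemma eventuallyEq (h : IsBump χ β) (a : ℝ) (z₀ : ℝ × ℝ) : cutoffFun c ν χ β a =ᶠ[nhds z₀]
    fun z => e (-(c * ⌊z₀.1 - a - β⌋ * (z.2 - ν))) * (χ (z.1 - a) : ℂ) := by
  set n := ⌊z₀.1 - a - β⌋ with hn
  have hc : ContinuousAt (fun z : ℝ × ℝ => z.1 - a - β) z₀ := by fun_prop
  by_cases hz : z₀.1 - a - β = n
  · have h1 : ∀ᶠ z : ℝ × ℝ in nhds z₀, |z.1 - a - β - n| < 1 / 6 := by
      refine ContinuousAt.eventually_lt (by fun_prop) continuousAt_const ?_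
      rw [hz]
      norm_num
    filter_upwards [h1] with z hz'
    rw [cutoffFun, h.zero (z.1 - a) n hz'.le]
    simp
  · have h1 : ∀ᶠ z : ℝ × ℝ in nhds z₀, (n : ℝ) < z.1 - a - β :=
      continuousAt_const.eventually_lt hc (lt_of_le_of_ne (Int.floor_le _) (Ne.symm hz))
    have h2 : ∀ᶠ z : ℝ × ℝ in nhds z₀, z.1 - a - β < n + 1 :=
      hc.eventually_lt continuousAt_const (Int.lt_floor_add_one _)
    filter_upwards [h1, h2] with z hz1 hz2
    rw [cutoffFun, Int.floor_eq_iff.2 ⟨hz1.le, hz2⟩]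

lemma contDiff_local (h : IsBump χ β) (k a : ℝ) :
    ContDiff ℝ ∞ fun z : ℝ × ℝ => e (-(k * (z.2 - ν))) * (χ (z.1 - a) : ℂ) := by
  refine ContDiff.mul (contDiff_e.comp ?_) (Complex.ofRealCLM.contDiff.comp (h.smooth.comp ?_))
  · exact (contDiff_const.mul (contDiff_snd.sub contDiff_const)).neg
  · exact contDiff_fst.sub contDiff_const

lemma contDiff_cutoffFun (h : IsBump χ β) (a : ℝ) : ContDiff ℝ ∞ (cutoffFun c ν χ β a) :=
  contDiff_iff_contDiffAt.2 fun z =>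
    (h.contDiff_local _ a).contDiffAt.congr_of_eventuallyEq (h.eventuallyEq a z)

/-- A unit step in `x` raises the floor by one and yields exactly the required factor. Periodicity
in `y` holds because `c` times the floor is an integer. -/
lemma quasiPeriodic_cutoffFun (h : IsBump χ β) (a : ℝ) :
    QuasiPeriodic c ν 1 ⟨cutoffFun c ν χ β a, (h.contDiff_cutoffFun a).continuous⟩ := fun x y => by
  have h1 : χ (x + 1 - a) = χ (x - a) := by rw [← h.periodic (x - a)]; congr 1; ring
  have h2 : ⌊x + 1 - a - β⌋ = ⌊x - a - β⌋ + 1 := by rw [← Int.floor_add_one]; congr 1; ring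
  simp only [ContinuousMap.coe_mk, cutoffFun, h1, h2, ← mul_assoc, ← e_add]
  constructor
  · congr 2
    push_cast
    ring
  · congr 1
    have : -(c * (⌊x - a - β⌋ : ℝ) * (y + 1 - ν)) =
      -(c * ⌊x - a - β⌋ * (y - ν)) + ((-(c * ⌊x - a - β⌋) : ℤ) : ℝ) := by push_cast; ring
    rw [this, e_add, e_intCast, mul_one]

variable (c ν) in
/-- The element of the Hilbert bimodule defined by `cutoffFun`. -/
def elem (h : IsBump χ β) (a : ℝ) : qpSubmodule c ν 1 :=
  ⟨⟨cutoffFun c ν χ β a, (h.contDiff_cutoffFun a).continuous⟩, h.quasiPeriodic_cutoffFun a⟩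

lemma elem_apply (h : IsBump χ β) (a : ℝ) (z : ℝ × ℝ) :
    (h.elem c ν a).1 z = cutoffFun c ν χ β a z := rfl

lemma elem_eq (h : IsBump χ β) (a : ℝ) {x : ℝ} (hx : x ∈ Set.Icc (a + β) (a + β + 1)) (y : ℝ) :
    (h.elem c ν a).1 (x, y) = χ (x - a) := by
  rw [elem_apply, cutoffFun]
  rcases hx.2.lt_or_eq with hx' | rfl
  · have : ⌊x - a - β⌋ = 0 := Int.floor_eq_iff.2
      ⟨by simp; linarith [hx.1], by simp; linarith⟩
    simp [this, e_zero]
  -- At the right endpoint the floor is 1 instead of 0, but `χ` vanishes there.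
  · have := h.zero (a + β + 1 - a) 1 (by ring_nf; norm_num)
    simp [this]

lemma elem_mul_star (h : IsBump χ β) (a : ℝ) (z : ℝ × ℝ) :
    (h.elem c ν a).1 z * star ((h.elem c ν a).1 z) = (χ (z.1 - a) ^ 2 : ℝ) := by
  rw [elem_apply, cutoffFun, star_mul', star_e, Complex.star_def, Complex.conj_ofReal, mul_mul_mul_comm,
    mul_comm (e _), e_neg_mul, one_mul]
  push_cast
  ring

lemma contDiff_elem (h : IsBump χ β) (a : ℝ) : ContDiff ℝ ∞ (h.elem c ν a).1 :=
  h.contDiff_cutoffFun a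

lemma fderiv_elem_x (h : IsBump χ β) (a : ℝ) (z : ℝ × ℝ) :
    fderiv ℝ (h.elem c ν a).1 z (1, 0) =
      e (-(c * ⌊z.1 - a - β⌋ * (z.2 - ν))) * ((deriv χ (z.1 - a) : ℝ) : ℂ) := by
  change fderiv ℝ (cutoffFun c ν χ β a) z (1, 0) = _
  rw [(h.eventuallyEq a z).fderiv_eq]
  have hd := ((h.contDiff_local (ν := ν) (c * ⌊z.1 - a - β⌋) a).differentiable (by simp)
    z).hasFDerivAt.comp_hasDerivAt (x := z.1) (f := fun x => (x, z.2))
    ((hasDerivAt_id z.1).prodMk (hasDerivAt_const z.1 z.2))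
  have h1 : HasDerivAt (fun x => χ (x - a)) (deriv χ (z.1 - a)) z.1 :=
    ((h.smooth.differentiable (by simp) (z.1 - a)).hasDerivAt).comp_sub_const z.1 a
  exact hd.unique (h1.ofReal_comp.const_mul (e (-(c * ⌊z.1 - a - β⌋ * (z.2 - ν)))))

lemma fderiv_elem_y (h : IsBump χ β) (a : ℝ) (z : ℝ × ℝ) :
    fderiv ℝ (h.elem c ν a).1 z (0, 1) =
      -(2 * Real.pi * Complex.I * c * ⌊z.1 - a - β⌋) * (h.elem c ν a).1 z := by
  change fderiv ℝ (cutoffFun c ν χ β a) z (0, 1) = _ * cutoffFun c ν χ β a z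
  rw [(h.eventuallyEq a z).fderiv_eq]
  have hd := ((h.contDiff_local (ν := ν) (c * ⌊z.1 - a - β⌋) a).differentiable (by simp)
    z).hasFDerivAt.comp_hasDerivAt (x := z.2) (f := fun y => (z.1, y))
    ((hasDerivAt_const z.2 z.1).prodMk (hasDerivAt_id z.2))
  have h3 : HasDerivAt (fun y' : ℝ => e (-(c * ⌊z.1 - a - β⌋ * (y' - ν))))
      ((-(c * ⌊z.1 - a - β⌋ * 1) : ℝ) • (2 * Real.pi * Complex.I *
        e (-(c * ⌊z.1 - a - β⌋ * (z.2 - ν))))) z.2 :=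
    (hasDerivAt_e _).scomp z.2
      (((hasDerivAt_id z.2).sub_const ν).const_mul (c * ⌊z.1 - a - β⌋ : ℝ)).neg
  rw [hd.unique (h3.mul_const (χ (z.1 - a) : ℂ)), cutoffFun, Complex.real_smul]
  push_cast
  ring

end IsBump

/-! ### Products of elements of degree `p` -/

lemma QuasiPeriodic.mul_star {p : ℤ} {f g : C(ℝ × ℝ, ℂ)} (hf : QuasiPeriodic c ν p f)
    (hg : QuasiPeriodic c ν p g) : QuasiPeriodic c ν 0 (f * star g) := fun x y => by
  simp only [ContinuousMap.mul_apply, ContinuousMap.star_apply]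
  rw [(hf x y).1, (hf x y).2, (hg x y).1, (hg x y).2, star_mul', star_e, neg_neg]
  refine ⟨?_, rfl⟩
  simp only [Int.cast_zero, mul_zero, zero_mul, neg_zero, e_zero]
  linear_combination (f (x, y) * star (g (x, y))) * e_neg_mul (c * p * (y - p * ν))

lemma QuasiPeriodic.shift {p : ℤ} {f : C(ℝ × ℝ, ℂ)} (hf : QuasiPeriodic c ν 0 f) (μ : ℝ) :
    QuasiPeriodic c ν 0 (QHM.shift μ ν p f) := fun x y => by
  simp only [shift_apply]
  rw [show x + 1 - p * (2 * μ) = x - p * (2 * μ) + 1 by ring,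
    show y + 1 - p * (2 * ν) = y - p * (2 * ν) + 1 by ring, (hf _ _).1, (hf _ _).2]
  simp [e_zero]

lemma homogL_mul_star {p : ℤ} (f g : qpSubmodule c ν p) :
    homogL c μ ν p f * star (homogL c μ ν p g) =
      homogL c μ ν 0 ⟨f.1 * star g.1, f.2.mul_star g.2⟩ := by
  change ((homog μ p f.1 f.2 : preQHM c μ ν) : QHMAlg c μ ν) *
    star ((homog μ p g.1 g.2 : preQHM c μ ν) : QHMAlg c μ ν) = _
  rw [star_coe, ← Completion.coe_mul]
  congr 1
  apply Subtype.ext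
  change (Conv.single p f.1 : Conv μ ν) * star (Conv.single p g.1) = Conv.single 0 (f.1 * star g.1)
  rw [Conv.star_single, Conv.single_mul_single, shift_shift, add_neg_cancel, shift_zero]

lemma star_mul_homogL {p : ℤ} (f g : qpSubmodule c ν p) :
    star (homogL c μ ν p f) * homogL c μ ν p g =
      homogL c μ ν 0 ⟨shift μ ν (-p) (g.1 * star f.1), (g.2.mul_star f.2).shift μ⟩ := by
  change star ((homog μ p f.1 f.2 : preQHM c μ ν) : QHMAlg c μ ν) *
    ((homog μ p g.1 g.2 : preQHM c μ ν) : QHMAlg c μ ν) = _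
  rw [star_coe, ← Completion.coe_mul]
  congr 1
  apply Subtype.ext
  change star (Conv.single p f.1 : Conv μ ν) * Conv.single p g.1 =
    Conv.single 0 (shift μ ν (-p) (g.1 * star f.1))
  rw [Conv.star_single, Conv.single_mul_single, neg_add_cancel, ← map_mul, mul_comm]

lemma integral_eq_integral_add {h : C(ℝ × ℝ, ℂ)} (hh : QuasiPeriodic c ν 0 h) (b : ℝ) :
    ∫ x in (0 : ℝ)..1, ∫ y in (0 : ℝ)..1, h (x, y) =
      ∫ x in b..b + 1, ∫ y in (0 : ℝ)..1, h (x, y) := by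
  have hp : Function.Periodic (fun x => ∫ y in (0 : ℝ)..1, h (x, y)) 1 := fun x => by
    simp only [(hh x _).1, Int.cast_zero, mul_zero, zero_mul, neg_zero, e_zero, one_mul]
  have := hp.intervalIntegral_add_eq 0 b
  rwa [zero_add] at this

/-- The trace property exchanges the factors, and in the order `g f^*` no translation occurs. The
free `b` allows a period interval on which `f` and `g` have a simple form. -/
lemma trace_star_mul_homogL {p : ℤ} (f g : qpSubmodule c ν p) (b : ℝ) :
    trace c μ ν (star (homogL c μ ν p f) * homogL c μ ν p g) =
      ∫ x in b..b + 1, ∫ y in (0 : ℝ)..1, g.1 (x, y) * star (f.1 (x, y)) := by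
  rw [trace_mul_comm, homogL_mul_star]
  exact (trace_homog_zero (g.2.mul_star f.2)).trans
    (integral_eq_integral_add (g.2.mul_star f.2) b)

/-! ### The traces of `ξ^* ∂_1 ξ` and `ξ^* ∂_2 ξ` for a cut-off element -/

namespace IsBump

variable {χ : ℝ → ℝ} {β : ℝ}

/-- The element of the smooth quantum Heisenberg manifold defined by `cutoffFun`. -/
def smoothElem (c : ℕ) (μ ν : ℝ) (h : IsBump χ β) (a : ℝ) : smoothQHM c μ ν :=
  ⟨homogL c μ ν 1 (h.elem c ν a), homogL_mem_smoothQHM _ (h.contDiff_elem a)⟩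

/-- The phases cancel and leave `-χ' χ = -(χ²/2)'`, whose integral over a period is zero. -/
lemma trace_deriv_zero (h : IsBump χ β) (a : ℝ) :
    trace c μ ν (star (h.smoothElem c μ ν a : QHMAlg c μ ν) *
      deriv3 c μ ν 0 (h.smoothElem c μ ν a)) = 0 := by
  obtain ⟨f₁, -, h₁⟩ := exists_derivX _ (h.contDiff_elem (c := c) (ν := ν) a)
  obtain ⟨f₂, -, h₂⟩ := exists_derivY μ _ (h.contDiff_elem (c := c) (ν := ν) a)
  rw [(deriv3_homogL _ f₁ f₂ ((h.contDiff_elem a).differentiable (by simp)) h₁ h₂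
    (h.smoothElem c μ ν a) rfl).1]
  refine (trace_star_mul_homogL _ f₁ 0).trans ?_
  have key (x y : ℝ) : f₁.1 (x, y) * star ((h.elem c ν a).1 (x, y)) =
      ((-(deriv χ (x - a) * χ (x - a)) : ℝ) : ℂ) := by
    rw [h₁, fderiv_elem_x, elem_apply, cutoffFun, star_mul', star_e, Complex.star_def,
      Complex.conj_ofReal]
    push_cast
    linear_combination (-((deriv χ (x - a) : ℝ) : ℂ) * χ (x - a)) *
      e_neg_mul (-(c * ⌊x - a - β⌋ * (y - ν)))
  have hd (x : ℝ) : HasDerivAt (fun x => -(χ (x - a) ^ 2 / 2)) (-(deriv χ (x - a) * χ (x - a))) x := by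
    have h1 : HasDerivAt (fun x => χ (x - a)) (deriv χ (x - a)) x :=
      ((h.smooth.differentiable (by simp) (x - a)).hasDerivAt).comp_sub_const x a
    refine ((h1.pow 2).div_const 2).neg.congr_deriv ?_
    push_cast
    ring
  have hcont : Continuous fun x => -(deriv χ (x - a) * χ (x - a)) := by
    have h1 := h.smooth.continuous
    have h2 := h.smooth.continuous_deriv (by simp)
    fun_prop
  simp only [key, intervalIntegral.integral_const, sub_zero, one_smul]
  rw [intervalIntegral.integral_ofReal, intervalIntegral.integral_eq_sub_of_hasDerivAt
    (fun x _ => hd x) (hcont.intervalIntegrable _ _), zero_add,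
    show (1 : ℝ) - a = 0 - a + 1 by ring, h.periodic, sub_self, Complex.ofReal_zero]

/-- On the period starting at `a + β` the element is `χ(x - a)`, without phase, so `∂_2` multiplies
it by `-2πi c (x - μ)`. The substitution `x = u + a` then makes the dependence on `a` affine. -/
lemma trace_deriv_one (h : IsBump χ β) (a : ℝ) :
    trace c μ ν (star (h.smoothElem c μ ν a : QHMAlg c μ ν) *
      deriv3 c μ ν 1 (h.smoothElem c μ ν a)) = -(2 * Real.pi * Complex.I * c) *
        (((a - μ) * (∫ u in (0 : ℝ)..1, χ u ^ 2) + ∫ u in β..β + 1, u * χ u ^ 2 : ℝ) : ℂ) := by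
  obtain ⟨f₁, -, h₁⟩ := exists_derivX _ (h.contDiff_elem (c := c) (ν := ν) a)
  obtain ⟨f₂, -, h₂⟩ := exists_derivY μ _ (h.contDiff_elem (c := c) (ν := ν) a)
  rw [(deriv3_homogL _ f₁ f₂ ((h.contDiff_elem a).differentiable (by simp)) h₁ h₂
    (h.smoothElem c μ ν a) rfl).2]
  refine (trace_star_mul_homogL _ f₂ (β + a)).trans ?_
  have key (x : ℝ) (hx : x ∈ Set.uIcc (β + a) (β + a + 1)) (y : ℝ) :
      f₂.1 (x, y) * star ((h.elem c ν a).1 (x, y)) =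
      -(2 * Real.pi * Complex.I * c) * (((x - μ) * χ (x - a) ^ 2 : ℝ) : ℂ) := by
    have h3 := h.elem_mul_star (c := c) (ν := ν) a (x, y)
    -- The floor is zero on this period except at its right endpoint, where `χ` is zero.
    have h4 : (⌊x - a - β⌋ : ℂ) * ((χ (x - a) ^ 2 : ℝ) : ℂ) = 0 := by
      rw [Set.uIcc_of_le (by linarith)] at hx
      rcases hx.2.lt_or_eq with hx' | rfl
      · have : ⌊x - a - β⌋ = 0 := Int.floor_eq_iff.2
          ⟨by simp; linarith [hx.1], by simp; linarith⟩
        simp [this]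
      · have := h.zero (β + a + 1 - a) 1 (by ring_nf; norm_num)
        simp [this]
    rw [h₂, fderiv_elem_y]
    push_cast at h3 h4 ⊢
    linear_combination (-(2 * Real.pi * Complex.I * c) * (x - μ - ⌊x - a - β⌋ )) * h3 +
      (2 * Real.pi * Complex.I * c) * h4
  have hcont := h.smooth.continuous
  have e1 : ∫ x in (β + a)..(β + a + 1), ∫ y in (0 : ℝ)..1,
      f₂.1 (x, y) * star ((h.elem c ν a).1 (x, y)) =
      ∫ x in (β + a)..(β + 1 + a),
        -(2 * Real.pi * Complex.I * c) * (((x - μ) * χ (x - a) ^ 2 : ℝ) : ℂ) := by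
    rw [add_right_comm β 1 a]
    refine intervalIntegral.integral_congr fun x hx => ?_
    simp only [key x hx, intervalIntegral.integral_const, sub_zero, one_smul]
  rw [e1, intervalIntegral.integral_const_mul, intervalIntegral.integral_ofReal]
  congr 2
  have e2 := intervalIntegral.integral_comp_add_right (a := β) (b := β + 1)
    (fun x => (x - μ) * χ (x - a) ^ 2) a
  simp only [add_sub_cancel_right] at e2
  rw [← e2]
  -- Only the integral of `χ²` may be moved to `[0, 1]`; `u χ(u)²` is not periodic and keeps its
  -- window.
  have hp : Function.Periodic (fun u => χ u ^ 2) 1 := fun u => by simp only [h.periodic u]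
  have e3 := hp.intervalIntegral_add_eq 0 β
  rw [zero_add] at e3
  rw [e3, ← intervalIntegral.integral_const_mul, ← intervalIntegral.integral_add
    (Continuous.intervalIntegrable (by fun_prop) _ _) (Continuous.intervalIntegrable (by fun_prop) _ _)]
  congr 1
  ext u
  ring

end IsBump

/-! ### Cut-off pairs -/

section cutoff

variable {χ : Fin 2 → ℝ → ℝ}

/-- The points where the functions of a cut-off pair vanish. -/
def cutPoint : Fin 2 → ℝ := ![-1 / 2, 0]

lemma IsCutoffPair.isBump (h : IsCutoffPair χ) (p : Fin 2) : IsBump (χ p) (cutPoint p) where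
  smooth := h.smooth p
  periodic := h.periodic p
  zero u n hu := by
    have hp : Function.Periodic (χ p) 1 := h.periodic p
    have hu' := abs_le.1 hu
    fin_cases p
    -- Being within `1/6` of `n - 1/2` means that `u - (n - 1)` lies in `[1/3, 2/3]`.
    · have h1 := hp.sub_int_mul_eq (x := u) (n - 1)
      rw [mul_one] at h1
      rw [← h1]
      simp only [cutPoint, Fin.zero_eta, Matrix.cons_val_zero] at hu'
      refine h.zero_fst _ ⟨?_, ?_⟩ <;> push_cast <;> linarith [hu'.1, hu'.2]
    · have h1 := hp.sub_int_mul_eq (x := u) n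
      rw [mul_one] at h1
      rw [← h1]
      simp only [cutPoint, Fin.mk_one, Matrix.cons_val_one] at hu'
      refine h.zero_snd _ ⟨?_, ?_⟩ <;> norm_num at hu' ⊢ <;> linarith [hu'.1, hu'.2]

/-- The frame built from a cut-off pair at `a`. -/
def cutoffFrame (c : ℕ) (μ ν : ℝ) (h : IsCutoffPair χ) (a : ℝ) (p : Fin 2) : smoothQHM c μ ν :=
  (h.isBump p).smoothElem c μ ν a

lemma IsCutoffPair.isCutoffFrame (h : IsCutoffPair χ) (a : ℝ) :
    IsCutoffFrame χ a (cutoffFrame c μ ν h a) := by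
  refine ⟨fun p => ((h.isBump p).elem c ν a).1, fun p => ((h.isBump p).elem c ν a).2,
    fun p => rfl, fun x hx y => ?_, fun x hx y => ?_⟩
  · refine (h.isBump 0).elem_eq a ?_ y
    simp only [cutPoint, Matrix.cons_val_zero]
    exact ⟨by linarith [hx.1], by linarith [hx.2]⟩
  · refine (h.isBump 1).elem_eq a ?_ y
    simp only [cutPoint, Matrix.cons_val_one]
    exact ⟨by simpa using hx.1, by simpa using hx.2⟩

/-- Both sums reduce to `χ_1² + χ_2² = 1`, since the phases are unimodular; the translation in `∑
ξ_p^* ξ_p` does not affect a constant. -/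
lemma IsCutoffPair.isFrame (h : IsCutoffPair χ) (a : ℝ) : IsFrame (cutoffFrame c μ ν h a) := by
  have hs (z : ℝ × ℝ) : ((h.isBump 0).elem c ν a).1 z * star (((h.isBump 0).elem c ν a).1 z) +
      ((h.isBump 1).elem c ν a).1 z * star (((h.isBump 1).elem c ν a).1 z) = 1 := by
    rw [IsBump.elem_mul_star, IsBump.elem_mul_star, ← Complex.ofReal_add, h.sum_sq,
      Complex.ofReal_one]
  refine ⟨fun p => ⟨_, ((h.isBump p).elem c ν a).2, rfl⟩, ?_, ?_⟩
  · rw [Fin.sum_univ_two]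
    apply Subtype.ext
    change star (homogL c μ ν 1 _) * homogL c μ ν 1 _ + star (homogL c μ ν 1 _) * homogL c μ ν 1 _ =
      homogL c μ ν 0 ⟨1, quasiPeriodic_one⟩
    rw [star_mul_homogL, star_mul_homogL, ← LinearMap.map_add]
    congr 1
    ext ⟨x, y⟩
    exact hs _
  · rw [Fin.sum_univ_two]
    apply Subtype.ext
    change homogL c μ ν 1 _ * star (homogL c μ ν 1 _) + homogL c μ ν 1 _ * star (homogL c μ ν 1 _) =
      homogL c μ ν 0 ⟨1, quasiPeriodic_one⟩
    rw [homogL_mul_star, homogL_mul_star, ← LinearMap.map_add]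
    congr 1
    ext ⟨x, y⟩
    exact hs _

lemma IsCutoffPair.hPair_zero (h : IsCutoffPair χ) (a : ℝ) :
    hPair (cyc1 (cutoffFrame c μ ν h a) 2) (phi1 c μ ν 0) = 0 := by
  rw [hPair_cyc1_two]
  exact Finset.sum_eq_zero fun p _ => (h.isBump p).trace_deriv_zero a

lemma IsCutoffPair.exists_hPair_one (c : ℕ) (μ ν : ℝ) (h : IsCutoffPair χ) :
    ∃ a, hPair (cyc1 (cutoffFrame c μ ν h a) 2) (phi1 c μ ν 1) = 0 := by
  have hc (p : Fin 2) : Continuous (χ p) := (h.smooth p).continuous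
  have hI : (∫ u in (0 : ℝ)..1, χ 0 u ^ 2) + ∫ u in (0 : ℝ)..1, χ 1 u ^ 2 = 1 := by
    rw [← intervalIntegral.integral_add (f := fun u => χ 0 u ^ 2) (g := fun u => χ 1 u ^ 2)
      (((hc 0).pow 2).intervalIntegrable _ _)
      (((hc 1).pow 2).intervalIntegrable _ _)]
    simp [h.sum_sq]
  -- As `∫ (χ_1² + χ_2²) = 1`, the pairing equals `-2πi c (a - μ + K)`, which vanishes at `a = μ -
  -- K`.
  let K : ℝ := ∑ p, ∫ u in cutPoint p..cutPoint p + 1, u * χ p u ^ 2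
  refine ⟨μ - K, ?_⟩
  rw [hPair_cyc1_two]
  have h1 (p : Fin 2) := (h.isBump p).trace_deriv_one (c := c) (μ := μ) (ν := ν) (μ - K)
  refine (Finset.sum_congr rfl fun p _ => h1 p).trans ?_
  rw [← Finset.mul_sum, ← Complex.ofReal_sum, Finset.sum_add_distrib, ← Finset.mul_sum,
    Fin.sum_univ_two (fun p => ∫ u in (0 : ℝ)..1, χ p u ^ 2), hI]
  simp [K]

lemma exists_isCutoffPair : ∃ χ, IsCutoffPair χ := by
  -- The angle of the point `(χ_1, χ_2)` on the unit circle. It is 0 where `cos(2πx) ≥ 1/2`, which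
  -- contains `[-1/6, 1/6]`, and `π/2` where `cos(2πx) ≤ -1/2`, which contains `[1/3, 2/3]`.
  let θ : ℝ → ℝ := fun x =>
    Real.pi / 2 * Real.smoothTransition (1 / 2 - Real.cos (2 * Real.pi * x))
  have hθ : ContDiff ℝ ∞ θ := by
    refine contDiff_const.mul (Real.smoothTransition.contDiff.comp (contDiff_const.sub
      (Real.contDiff_cos.comp (contDiff_const.mul contDiff_id))))
  have hp (x : ℝ) : θ (x + 1) = θ x := by
    simp only [θ, mul_add, mul_one, Real.cos_add_two_pi]
  have h0 (x : ℝ) (hx : x ∈ Set.Icc (-1 / 6 : ℝ) (1 / 6)) : θ x = 0 := by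
    have h1 : 1 / 2 ≤ Real.cos (2 * Real.pi * x) := by
      rw [← Real.cos_pi_div_three, ← Real.cos_abs (2 * Real.pi * x)]
      have h2 : |2 * Real.pi * x| ≤ Real.pi / 3 := by
        rw [abs_le]
        constructor <;> nlinarith [hx.1, hx.2, Real.pi_pos]
      exact Real.cos_le_cos_of_nonneg_of_le_pi (abs_nonneg _) (by linarith [Real.pi_pos]) h2
    simp only [θ]
    rw [Real.smoothTransition.zero_of_nonpos (by linarith), mul_zero]
  have h1 (x : ℝ) (hx : x ∈ Set.Icc (1 / 3 : ℝ) (2 / 3)) : θ x = Real.pi / 2 := by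
    have h1 : Real.cos (2 * Real.pi * x) ≤ -(1 / 2) := by
      have h3 : 1 / 2 ≤ Real.cos (2 * Real.pi * x - Real.pi) := by
        rw [← Real.cos_pi_div_three, ← Real.cos_abs (2 * Real.pi * x - Real.pi)]
        have h2 : |2 * Real.pi * x - Real.pi| ≤ Real.pi / 3 := by
          rw [abs_le]
          constructor <;> nlinarith [hx.1, hx.2, Real.pi_pos]
        exact Real.cos_le_cos_of_nonneg_of_le_pi (abs_nonneg _) (by linarith [Real.pi_pos]) h2
      rw [Real.cos_sub_pi] at h3
      linarith
    simp only [θ]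
    rw [Real.smoothTransition.one_of_one_le (by linarith), mul_one]
  refine ⟨![fun x => Real.cos (θ x), fun x => Real.sin (θ x)], ?_, ?_, ?_, ?_, ?_⟩
  · intro p
    fin_cases p
    · exact Real.contDiff_cos.comp hθ
    · exact Real.contDiff_sin.comp hθ
  · intro p x
    fin_cases p <;> simp [hp]
  · intro x
    simp
  · intro x hx
    simp [h1 x hx]
  · intro x hx
    simp [h0 x hx]

end cutoff

/-! ### The pairing matrix in degree one and the proof of the theorem -/

/-- The values of the pairings of `c_1, c_2, c_3` with `φ_1, φ_2, φ_3`. -/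
def pairingConst (i : Fin 3) : ℂ := if i = 2 then twoPiI else -twoPiI

lemma pairingConst_ne_zero (i : Fin 3) : pairingConst i ≠ 0 := by
  rw [pairingConst]
  split_ifs
  · exact twoPiI_ne_zero
  · exact neg_ne_zero.2 twoPiI_ne_zero

/-- The hypothesis on `j` and `i` excludes exactly the two entries that see the derivatives of the
frame in the directions `r` and `s`. -/
lemma IsFrame.hPair_cyc1 {ξ : Fin 2 → smoothQHM c μ ν} (hξ : IsFrame ξ) (j i : Fin 3)
    (hji : j ≠ 2 ∨ i = 2) :
    hPair (cyc1 ξ j) (phi1 c μ ν i) = if j = i then pairingConst i else 0 := by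
  by_cases hj : j = 2
  · subst hj
    obtain rfl := hji.resolve_left (not_not.2 rfl)
    rw [hξ.hPair_cyc1_two_two, if_pos rfl, pairingConst, if_pos rfl]
  · obtain ⟨j', rfl⟩ : ∃ j' : Fin 2, j = j'.castSucc :=
      ⟨j.castPred hj, (Fin.castSucc_castPred j hj).symm⟩
    rw [hPair_cyc1_U]
    refine if_ctx_congr Iff.rfl (fun h => ?_) fun _ => rfl
    rw [pairingConst, if_neg (h ▸ hj)]

lemma IsCutoffPair.exists_hPair_cyc1 {χ : Fin 2 → ℝ → ℝ} (c : ℕ) (μ ν : ℝ) (h : IsCutoffPair χ) :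
    ∃ a, ∀ j i, hPair (cyc1 (cutoffFrame c μ ν h a) j) (phi1 c μ ν i) =
      if j = i then pairingConst i else 0 := by
  obtain ⟨a, ha⟩ := h.exists_hPair_one c μ ν
  refine ⟨a, fun j i => ?_⟩
  by_cases hji : j ≠ 2 ∨ i = 2
  · exact (h.isFrame a).hPair_cyc1 j i hji
  · simp only [not_or, not_not] at hji
    obtain ⟨rfl, hi⟩ := hji
    rw [if_neg (Ne.symm hi)]
    obtain rfl | rfl : i = 0 ∨ i = 1 := by
      fin_cases i
      · exact Or.inl rfl
      · exact Or.inr rfl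
      · exact absurd rfl hi
    · exact h.hPair_zero a
    · exact ha

lemma exists_isFrame_hPair (c : ℕ) (μ ν : ℝ) : ∃ ξ : Fin 2 → smoothQHM c μ ν, IsFrame ξ ∧
    ∀ j i, hPair (cyc1 ξ j) (phi1 c μ ν i) = if j = i then pairingConst i else 0 := by
  obtain ⟨χ, h⟩ := exists_isCutoffPair
  obtain ⟨a, ha⟩ := h.exists_hPair_cyc1 c μ ν
  exact ⟨_, h.isFrame a, ha⟩

lemma two_mul_twoPiI_sq_ne_zero : -2 * twoPiI ^ 2 ≠ 0 :=
  mul_ne_zero (by norm_num) (pow_ne_zero _ twoPiI_ne_zero)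

lemma six_mul_twoPiI_cube_ne_zero : 6 * twoPiI ^ 3 ≠ 0 :=
  mul_ne_zero (by norm_num) (pow_ne_zero _ twoPiI_ne_zero)

lemma hhClass_phi3_ne_zero : hhClass (phi3 c μ ν) phi3_mem_hCocycles ≠ 0 := fun h => by
  obtain ⟨ξ, hξ, -⟩ := exists_isFrame_hPair c μ ν
  have h1 := hPairCoh_hhClass (cyc3 ξ) hξ.isHCycle_cyc3 (phi3 c μ ν) phi3_mem_hCocycles
  rw [h, map_zero, hξ.hPair_cyc3] at h1
  exact six_mul_twoPiI_cube_ne_zero h1.symm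

end QHM

end

theorem mainTheorem12 (c : ℕ) (hc : 0 < c) (μ ν : ℝ) :
    (∃ (k₁ : Fin 3 → ℂ) (k₂ : Fin 2 → ℂ) (k₃ : ℂ),
      (∀ i, k₁ i ≠ 0) ∧ (∀ i, k₂ i ≠ 0) ∧ k₃ ≠ 0 ∧
      (∃ χ, QHM.IsCutoffPair χ) ∧
      (∀ χ, QHM.IsCutoffPair χ → ∃ (a : ℝ) (ξ : Fin 2 → QHM.smoothQHM c μ ν),
        QHM.IsCutoffFrame χ a ξ ∧ QHM.IsFrame ξ ∧
        (∀ j, QHM.IsHCycle (QHM.cyc1 ξ j)) ∧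
        (∀ j, QHM.IsHCycle (QHM.cyc2 ξ j)) ∧
        QHM.IsHCycle (QHM.cyc3 ξ) ∧
        (∀ j i, QHM.hPair (QHM.cyc1 ξ j) (QHM.phi1 c μ ν i) = if j = i then k₁ i else 0) ∧
        (∀ j i, QHM.hPair (QHM.cyc2 ξ j) (QHM.phi2 c μ ν i.castSucc 2) =
          if j = i then k₂ i else 0) ∧
        QHM.hPair (QHM.cyc3 ξ) (QHM.phi3 c μ ν) = k₃) ∧
      (∀ χ, QHM.IsCutoffPair χ → ∀ a : ℝ, ∃ ξ : Fin 2 → QHM.smoothQHM c μ ν,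
        QHM.IsCutoffFrame χ a ξ ∧ QHM.IsFrame ξ ∧
        QHM.hPair (QHM.cyc1 ξ 2) (QHM.phi1 c μ ν 0) = 0) ∧
      (∀ ξ : Fin 2 → QHM.smoothQHM c μ ν, QHM.IsFrame ξ →
        (∀ j, QHM.IsHCycle (QHM.cyc1 ξ j)) ∧
        (∀ j, QHM.IsHCycle (QHM.cyc2 ξ j)) ∧
        QHM.IsHCycle (QHM.cyc3 ξ) ∧
        (∀ j i, (j ≠ 2 ∨ i = 2) →
          QHM.hPair (QHM.cyc1 ξ j) (QHM.phi1 c μ ν i) = if j = i then k₁ i else 0) ∧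
        (∀ j i, QHM.hPair (QHM.cyc2 ξ j) (QHM.phi2 c μ ν i.castSucc 2) =
          if j = i then k₂ i else 0) ∧
        QHM.hPair (QHM.cyc3 ξ) (QHM.phi3 c μ ν) = k₃)) ∧
    (∃ h : QHM.phi0 c μ ν ∈ QHM.hCocycles (QHM.smoothQHM c μ ν) 0,
      QHM.hhClass (QHM.phi0 c μ ν) h ≠ 0) ∧
    (∃ h : ∀ i, QHM.phi1 c μ ν i ∈ QHM.hCocycles (QHM.smoothQHM c μ ν) 1,
      LinearIndependent ℂ fun i => QHM.hhClass (QHM.phi1 c μ ν i) (h i)) ∧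
    (∃ h : ∀ i : Fin 2, QHM.phi2 c μ ν i.castSucc 2 ∈ QHM.hCocycles (QHM.smoothQHM c μ ν) 2,
      LinearIndependent ℂ fun i : Fin 2 => QHM.hhClass (QHM.phi2 c μ ν i.castSucc 2) (h i)) ∧
    (∃ h : QHM.phi3 c μ ν ∈ QHM.hCocycles (QHM.smoothQHM c μ ν) 3,
      QHM.hhClass (QHM.phi3 c μ ν) h ≠ 0) := by
  -- One frame with a diagonal pairing matrix in degree one; it proves independence in degrees one
  -- and two.
  obtain ⟨ξ₀, hξ₀, hp₀⟩ := QHM.exists_isFrame_hPair c μ ν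
  refine ⟨⟨QHM.pairingConst, fun _ => -2 * QHM.twoPiI ^ 2, 6 * QHM.twoPiI ^ 3,
    QHM.pairingConst_ne_zero, fun _ => QHM.two_mul_twoPiI_sq_ne_zero,
    QHM.six_mul_twoPiI_cube_ne_zero, QHM.exists_isCutoffPair, fun χ hχ => ?_, fun χ hχ a => ?_,
    fun ξ hξ => ?_⟩, ⟨QHM.phi0_mem_hCocycles, QHM.hhClass_phi0_ne_zero⟩,
    ⟨QHM.phi1_mem_hCocycles, ?_⟩, ⟨fun i => QHM.phi2_mem_hCocycles _ _, ?_⟩,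
    ⟨QHM.phi3_mem_hCocycles, QHM.hhClass_phi3_ne_zero⟩⟩
  · obtain ⟨a, ha⟩ := hχ.exists_hPair_cyc1 c μ ν
    have hξ := hχ.isFrame (c := c) (μ := μ) (ν := ν) a
    exact ⟨a, _, hχ.isCutoffFrame a, hξ, hξ.isHCycle_cyc1, hξ.isHCycle_cyc2, hξ.isHCycle_cyc3, ha,
      hξ.hPair_cyc2, hξ.hPair_cyc3⟩
  · exact ⟨_, hχ.isCutoffFrame a, hχ.isFrame a, hχ.hPair_zero a⟩
  · exact ⟨hξ.isHCycle_cyc1, hξ.isHCycle_cyc2, hξ.isHCycle_cyc3, hξ.hPair_cyc1, hξ.hPair_cyc2,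
      hξ.hPair_cyc3⟩
  · exact QHM.linearIndependent_hhClass _ hξ₀.isHCycle_cyc1 _ _ _ QHM.pairingConst_ne_zero hp₀
  · exact QHM.linearIndependent_hhClass _ hξ₀.isHCycle_cyc2 _ _ (fun _ => -2 * QHM.twoPiI ^ 2)
      (fun _ => QHM.two_mul_twoPiI_sq_ne_zero) hξ₀.hPair_cyc2
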